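/- Let $R$ be a commutative ring with unit and $\Sigma$ a smooth oriented surface, possibly with boundary. \textbf{Loops.} A (generic) loop is an immersion $\alpha:S^1\to\Sigma\setminus\partial\Sigma$ of the counterclockwise oriented circle whose only self-crossings are double and transversal. Loops may be piecewise smooth: finitely many corners, looking like corners of a broken line and distinct from the self-crossings, are allowed. Let $\#\alpha\subset\Sigma$ be the set of self-crossings of $\alpha$. A pointed loop is a pair $(\alpha,\ast_\alpha)$ with $\ast_\alpha\in\alpha(S^1)\setminus\#\alpha$. Loops $\alpha,\beta$ are isotopic if $\beta=h_1\circ\alpha\circ f$ for some continuous family of homeomorphisms $\{h_t:\Sigma\to\Sigma\}_{t\in[0,1]}$ with $h_0=\mathrm{id}$ and some orientation preserving homeomorphism $f:S^1\to S^1$; for pointed loops one also requires $\ast_\beta=h_1(\ast_\alpha)$. Let $\mathcal L$ (respectively $\mathcal L_0$) be the $R$-module freely generated by the isotopy classes of pointed loops (respectively of loops), and let $\mathrm{pr}:\mathcal L\to\mathcal L_0$ be the projection forgetting the base points. For $P\ne Q$ in $S^1$ with $\alpha(P)=\alpha(Q)$, let $\alpha_{P,Q}$ be the loop obtained by restricting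 $\alpha$ to the positively oriented arc of $S^1$ from $P$ to $Q$. \textbf{Lie cobrackets.} A Lie cobracket in an $R$-module $A$ is an $R$-linear map $\nu:A\to A\otimes A$ such that $\mathrm{Perm}\circ\nu=-\nu$ and $(\mathrm{id}+\tau+\tau^2)\circ(\mathrm{id}_A\otimes\nu)\circ\nu=0$, where $\mathrm{Perm}(x\otimes y)=y\otimes x$ and $\tau(x\otimes y\otimes z)=z\otimes x\otimes y$. \textbf{Lemma.} The set $\#\alpha$ is finite for every loop $\alpha$. There is an $R$-linear map $\nu:\mathcal L\to\mathcal L\otimes\mathcal L$ given on every pointed loop by $$\nu(\alpha,\ast_\alpha)=\sum_{p\in\#\alpha}\varepsilon_p\bigl((\alpha_{p_1,p_2},p)\otimes(\alpha_{p_2,p_1},\ast_\alpha)-(\alpha_{p_2,p_1},\ast_\alpha)\otimes(\alpha_{p_1,p_2},p)\bigr),$$ where $\alpha^{-1}(p)=\{p_1,p_2\}$ is numbered in the order in which $p_1,p_2$ are met when moving along $S^1$ in the positive direction from $\alpha^{-1}(\ast_\alpha)$, and $\varepsilon_p=+1$ if the pair (positive tangent direction of $\alpha$ at $p_1$, positive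 tangent direction of $\alpha$ at $p_2$) is positive with respect to the orientation of $\Sigma$, and $\varepsilon_p=-1$ otherwise; this $\nu$ is a Lie cobracket in $\mathcal L$. It induces a Lie cobracket $\nu_0$ in $\mathcal L_0$: there is a unique $R$-linear map $\nu_0:\mathcal L_0\to\mathcal L_0\otimes\mathcal L_0$ with $\nu_0\circ\mathrm{pr}=(\mathrm{pr}\otimes\mathrm{pr})\circ\nu$, it is a Lie cobracket, and for every loop $\alpha$ $$\nu_0(\alpha)=\sum_{p\in\#\alpha}\bigl(\alpha_{p^1,p^2}\otimes\alpha_{p^2,p^1}-\alpha_{p^2,p^1}\otimes\alpha_{p^1,p^2}\bigr),$$ where $\alpha^{-1}(p)=\{p^1,p^2\}$ is numbered so that the pair (positive tangent direction of $\alpha$ at $p^1$, positive tangent direction of $\alpha$ at $p^2$) is positive with respect to the orientation of $\Sigma$. -/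

import Mathlib

open Set Filter Topology
open scoped Manifold ContDiff TensorProduct

namespace SurfaceLoop

/-! ### Lie coalgebras -/

section LieCoalgebra

variable (R A : Type*) [CommRing R] [AddCommGroup A] [Module R A]

/-- The cyclic permutation `x ⊗ y ⊗ z ↦ z ⊗ x ⊗ y` of `A ⊗ A ⊗ A`. -/
noncomputable def cyc : A ⊗[R] (A ⊗[R] A) →ₗ[R] A ⊗[R] (A ⊗[R] A) :=
  (TensorProduct.comm R (A ⊗[R] A) A).toLinearMap ∘ₗ
    (TensorProduct.assoc R A A A).symm.toLinearMap

variable {R A}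

/-- `ν : A → A ⊗ A` is a Lie cobracket: it is antisymmetric and satisfies the co-Jacobi identity. -/
structure IsLieCobracket (ν : A →ₗ[R] A ⊗[R] A) : Prop where
  antisymm : (TensorProduct.comm R A A).toLinearMap ∘ₗ ν = -ν
  coJacobi : (LinearMap.id + cyc R A + cyc R A ∘ₗ cyc R A) ∘ₗ (ν.lTensor A) ∘ₗ ν = 0

end LieCoalgebra

/-! ### The circle `S¹ = ℝ / ℤ` -/

/-- The representative in `[0, 1)` of a point of `S¹ = ℝ / ℤ`. So `frac (Q - P)` is the length of
the positively oriented arc from `P` to `Q`. -/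
noncomputable def frac (x : UnitAddCircle) : ℝ := (AddCircle.equivIco (1 : ℝ) 0 x : ℝ)

theorem frac_nonneg (x : UnitAddCircle) : 0 ≤ frac x := (AddCircle.equivIco (1 : ℝ) 0 x).2.1

theorem frac_lt_one (x : UnitAddCircle) : frac x < 1 := by
  simpa [frac] using (AddCircle.equivIco (1 : ℝ) 0 x).2.2

@[simp] theorem coe_frac (x : UnitAddCircle) : ((frac x : ℝ) : UnitAddCircle) = x :=
  AddCircle.coe_equivIco

theorem frac_coe {t : ℝ} (h0 : 0 ≤ t) (h1 : t < 1) : frac (t : UnitAddCircle) = t :=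
  AddCircle.equivIco_coe_of_mem ⟨h0, by simpa using h1⟩

theorem frac_eq_of_coe {t : ℝ} {x : UnitAddCircle} (h0 : 0 ≤ t) (h1 : t < 1)
    (h : (t : UnitAddCircle) = x) : frac x = t := by rw [← h, frac_coe h0 h1]

theorem frac_injective : Function.Injective frac := fun x y h => by
  rw [← coe_frac x, h, coe_frac]

@[simp] theorem frac_zero : frac 0 = 0 :=
  frac_eq_of_coe le_rfl one_pos (by simp)

theorem frac_pos {x : UnitAddCircle} (h : x ≠ 0) : 0 < frac x :=
  lt_of_le_of_ne (frac_nonneg x) fun h' => h (frac_injective (by rw [← h', frac_zero]))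

/-- A self-homeomorphism of the circle is orientation preserving if it lifts to an increasing
bijection (hence homeomorphism) of the line. -/
def OrientationPreserving (f : UnitAddCircle ≃ₜ UnitAddCircle) : Prop :=
  ∃ F : ℝ ≃o ℝ, ∀ t : ℝ, f (t : UnitAddCircle) = (F t : UnitAddCircle)

theorem OrientationPreserving.refl : OrientationPreserving (Homeomorph.refl UnitAddCircle) :=
  ⟨OrderIso.refl ℝ, fun _ => rfl⟩

theorem OrientationPreserving.trans {f g : UnitAddCircle ≃ₜ UnitAddCircle}
    (hf : OrientationPreserving f) (hg : OrientationPreserving g) :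
    OrientationPreserving (f.trans g) := by
  obtain ⟨F, hF⟩ := hf
  obtain ⟨G, hG⟩ := hg
  exact ⟨F.trans G, fun t => by simp [hF, hG]⟩

theorem OrientationPreserving.symm {f : UnitAddCircle ≃ₜ UnitAddCircle}
    (hf : OrientationPreserving f) : OrientationPreserving f.symm := by
  obtain ⟨F, hF⟩ := hf
  refine ⟨F.symm, fun t => ?_⟩
  rw [Homeomorph.symm_apply_eq, hF]
  simp

/-- The point of `S¹` at parameter `frac u ∈ [0, 1)` of the arc `PQ`, parametrized affinely. -/
noncomputable def arcPoint (P Q u : UnitAddCircle) : UnitAddCircle :=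
  P + ((frac (Q - P) * frac u : ℝ) : UnitAddCircle)

@[simp] theorem arcPoint_zero (P Q : UnitAddCircle) : arcPoint P Q 0 = P := by simp [arcPoint]

theorem frac_arcPoint_sub (P Q u : UnitAddCircle) :
    frac (arcPoint P Q u - P) = frac (Q - P) * frac u := by
  apply frac_eq_of_coe
  · exact mul_nonneg (frac_nonneg _) (frac_nonneg _)
  · nlinarith [frac_nonneg (Q - P), frac_lt_one (Q - P), frac_nonneg u, frac_lt_one u]
  · simp [arcPoint]

theorem arcPoint_injective {P Q : UnitAddCircle} (h : P ≠ Q) :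
    Function.Injective (arcPoint P Q) := fun u v huv => by
  have := frac_arcPoint_sub P Q u
  rw [huv, frac_arcPoint_sub] at this
  exact frac_injective (mul_left_cancel₀ (frac_pos (sub_ne_zero.2 h.symm)).ne' this.symm)

theorem arcPoint_ne_right {P Q : UnitAddCircle} (h : P ≠ Q) (u : UnitAddCircle) :
    arcPoint P Q u ≠ Q := fun hu => by
  have := frac_arcPoint_sub P Q u
  rw [hu] at this
  nlinarith [frac_pos (sub_ne_zero.2 h.symm), frac_lt_one u]

/-! ### Smooth surfaces -/

/-- The coordinate plane. -/
abbrev Plane := EuclideanSpace ℝ (Fin 2)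

/-- The determinant of a pair of vectors of the plane. -/
def cross (v w : Plane) : ℝ := v 0 * w 1 - v 1 * w 0

/-- An orientation of a smooth surface `M`, possibly with boundary. An orientation of each tangent
plane is given by a sign, relative to the standard orientation of the coordinate plane, with which
`TangentSpace (𝓡∂ 2) x` is identified through the preferred chart at `x`; these orientations are
compatible at nearby points. -/
structure SurfaceOrientation (M : Type*) [TopologicalSpace M]
    [ChartedSpace (EuclideanHalfSpace 2) M] [IsManifold (𝓡∂ 2) ∞ M] where
  sign : M → ℤˣ
  compatible : ∀ x₀ : M, ∀ᶠ x in 𝓝 x₀,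
    0 < ((sign x : ℤ) : ℝ) * ((sign x₀ : ℤ) : ℝ) * (tangentCoordChange (𝓡∂ 2) x x₀ x).det

theorem cross_smul (a b : ℝ) (v w : Plane) : cross (a • v) (b • w) = a * b * cross v w := by
  simp [cross]; ring

theorem cross_swap (v w : Plane) : cross w v = -cross v w := by
  simp [cross]; ring

theorem not_sameRay_neg_of_cross_ne {v w : Plane} (h : cross v w ≠ 0) : ¬ SameRay ℝ v (-w) := by
  rintro (h' | h' | ⟨a, b, ha, hb, hab⟩)
  · exact h (by simp [h', cross])
  · exact h (by simp [neg_eq_zero.1 h', cross])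
  · have : a * -b * cross v w = 0 := by
      rw [← cross_smul, hab]; simp [cross]; ring
    have hb' : -b ≠ 0 := by linarith
    exact h (by simpa [ha.ne', hb.ne'] using this)

theorem not_sameRay_smul {l : ℝ} (hl : 0 < l) {v w : Plane} (h : ¬ SameRay ℝ v (-w)) :
    ¬ SameRay ℝ (l • v) (-(l • w)) := fun h' => h <| by
  have := (h'.pos_smul_left (inv_pos.2 hl)).pos_smul_right (inv_pos.2 hl)
  simpa [smul_smul, hl.ne'] using this

variable {M : Type*}

/-- The map `γ : S¹ → M` in the real parameter `s ↦ x + s` around `x ∈ S¹`. -/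
def curve (γ : UnitAddCircle → M) (x : UnitAddCircle) : ℝ → M :=
  fun s => γ (x + (s : UnitAddCircle))

/-- The loop obtained by restricting `γ` to the arc `PQ`, reparametrized affinely by the circle
(it is used for `γ P = γ Q`). -/
noncomputable def restrictArc (γ : UnitAddCircle → M) (P Q : UnitAddCircle) : UnitAddCircle → M :=
  fun u => γ (arcPoint P Q u)

theorem frac_add_coe {u : UnitAddCircle} {s : ℝ} (h0 : 0 ≤ frac u + s) (h1 : frac u + s < 1) :
    frac (u + (s : UnitAddCircle)) = frac u + s :=
  frac_eq_of_coe h0 h1 (by simp)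

theorem curve_restrictArc (γ : UnitAddCircle → M) (P Q u : UnitAddCircle) {s : ℝ}
    (h0 : 0 ≤ frac u + s) (h1 : frac u + s < 1) :
    curve (restrictArc γ P Q) u s = curve γ (arcPoint P Q u) (frac (Q - P) * s) := by
  simp only [curve, restrictArc, arcPoint, frac_add_coe h0 h1, mul_add, AddCircle.coe_add]
  rw [add_assoc]

theorem curve_restrictArc_zero (γ : UnitAddCircle → M) {P Q : UnitAddCircle} (h : γ P = γ Q)
    {s : ℝ} (h0 : -1 ≤ s) (h1 : s ≤ 0) :
    curve (restrictArc γ P Q) 0 s = curve γ Q (frac (Q - P) * s) := by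
  rcases h1.eq_or_lt with rfl | h1
  · simp [curve, restrictArc, h]
  · have : frac ((0 : UnitAddCircle) + (s : UnitAddCircle)) = 1 + s := by
      apply frac_eq_of_coe (by linarith) (by linarith)
      have := AddCircle.coe_add_period (1 : ℝ) s
      rw [add_comm] at this
      rw [zero_add, this]
    simp only [curve, restrictArc, arcPoint, this, mul_add, AddCircle.coe_add, mul_one, coe_frac]
    congr 1
    abel

variable [TopologicalSpace M] [ChartedSpace (EuclideanHalfSpace 2) M]

/-- `curve γ x` in the preferred chart at the point `γ x`. -/
noncomputable def chartCurve (γ : UnitAddCircle → M) (x : UnitAddCircle) : ℝ → Plane :=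
  fun s => extChartAt (𝓡∂ 2) (γ x) (curve γ x s)

/-- The velocity vector of `γ` at `x`, in the preferred chart at `γ x`. -/
noncomputable def velocity (γ : UnitAddCircle → M) (x : UnitAddCircle) : Plane :=
  deriv (chartCurve γ x) 0

/-- The outgoing (right) velocity vector of `γ` at `x`. -/
noncomputable def velocityRight (γ : UnitAddCircle → M) (x : UnitAddCircle) : Plane :=
  derivWithin (chartCurve γ x) (Ici 0) 0

/-- The incoming (left) velocity vector of `γ` at `x`. -/
noncomputable def velocityLeft (γ : UnitAddCircle → M) (x : UnitAddCircle) : Plane :=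
  derivWithin (chartCurve γ x) (Iic 0) 0

/-- `γ : S¹ → M` is a (piecewise smooth) generic loop on the surface `M`: it is an immersion into
the interior of `M`, smooth except for finitely many corners, which look like corners of a broken
line and are not self-crossings, and its only self-crossings are double and transversal.

Piecewise smoothness is expressed by smoothness on a one-sided neighbourhood of each parameter on
either side; since the circle is compact, there are then only finitely many corners. -/
structure IsGenericLoop (γ : UnitAddCircle → M) : Prop where
  interior : ∀ x, (𝓡∂ 2).IsInteriorPoint (γ x)
  smooth_right : ∀ x, ∃ ε > (0 : ℝ), ContMDiffOn 𝓘(ℝ, ℝ) (𝓡∂ 2) ∞ (curve γ x) (Icc 0 ε)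
  smooth_left : ∀ x, ∃ ε > (0 : ℝ), ContMDiffOn 𝓘(ℝ, ℝ) (𝓡∂ 2) ∞ (curve γ x) (Icc (-ε) 0)
  velocityRight_ne : ∀ x, velocityRight γ x ≠ 0
  velocityLeft_ne : ∀ x, velocityLeft γ x ≠ 0
  /-- The loop does not turn back at a corner: incoming and outgoing velocities are not opposite. -/
  not_cusp : ∀ x, ¬ SameRay ℝ (velocityLeft γ x) (-velocityRight γ x)
  smooth_crossing : ∀ x y, x ≠ y → γ x = γ y →
    ContMDiffAt 𝓘(ℝ, ℝ) (𝓡∂ 2) ∞ (curve γ x) 0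
  double : ∀ x y z, γ x = γ y → γ y = γ z → x = y ∨ y = z ∨ x = z
  transversal : ∀ x y, x ≠ y → γ x = γ y → cross (velocity γ x) (velocity γ y) ≠ 0

theorem chartCurve_congr {γ δ : UnitAddCircle → M} {x y : UnitAddCircle} {l s : ℝ}
    (hx : γ x = δ y) (h : curve γ x s = curve δ y (l * s)) :
    chartCurve γ x s = chartCurve δ y (l * s) := by
  simp [chartCurve, hx, h]

open scoped Pointwise in
theorem smul_Ici {l : ℝ} (hl : 0 < l) : l • Ici (0 : ℝ) = Ici 0 := by
  ext t
  rw [Set.mem_smul_set]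
  refine ⟨?_, fun ht => ⟨l⁻¹ * t, ?_, ?_⟩⟩
  · rintro ⟨s, hs, rfl⟩
    exact mul_nonneg hl.le hs
  · exact mul_nonneg (inv_nonneg.2 hl.le) ht
  · simp [hl.ne']

open scoped Pointwise in
theorem smul_Iic {l : ℝ} (hl : 0 < l) : l • Iic (0 : ℝ) = Iic 0 := by
  ext t
  rw [Set.mem_smul_set]
  refine ⟨?_, fun ht => ⟨l⁻¹ * t, ?_, ?_⟩⟩
  · rintro ⟨s, hs, rfl⟩
    exact mul_nonpos_of_nonneg_of_nonpos hl.le hs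
  · exact mul_nonpos_of_nonneg_of_nonpos (inv_nonneg.2 hl.le) ht
  · simp [hl.ne']

theorem velocityRight_of_eq {γ δ : UnitAddCircle → M} {x y : UnitAddCircle} {l ε : ℝ} (hl : 0 < l)
    (hε : 0 < ε) (h : ∀ s ∈ Icc 0 ε, curve γ x s = curve δ y (l * s)) :
    velocityRight γ x = l • velocityRight δ y := by
  have hx : γ x = δ y := by simpa [curve] using h 0 ⟨le_rfl, hε.le⟩
  have : chartCurve γ x =ᶠ[𝓝[≥] 0] fun s => chartCurve δ y (l * s) := by
    filter_upwards [Icc_mem_nhdsGE hε] with s hs using chartCurve_congr hx (h s hs)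
  rw [velocityRight, this.derivWithin_eq (by simpa using chartCurve_congr hx (h 0 ⟨le_rfl, hε.le⟩)),
    derivWithin_comp_mul_left, smul_Ici hl, mul_zero, velocityRight]

theorem velocityLeft_of_eq {γ δ : UnitAddCircle → M} {x y : UnitAddCircle} {l ε : ℝ} (hl : 0 < l)
    (hε : 0 < ε) (h : ∀ s ∈ Icc (-ε) 0, curve γ x s = curve δ y (l * s)) :
    velocityLeft γ x = l • velocityLeft δ y := by
  have h0 : (0 : ℝ) ∈ Icc (-ε) 0 := ⟨by linarith, le_rfl⟩
  have hx : γ x = δ y := by simpa [curve] using h 0 h0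
  have : chartCurve γ x =ᶠ[𝓝[≤] 0] fun s => chartCurve δ y (l * s) := by
    filter_upwards [Icc_mem_nhdsLE (show -ε < 0 by linarith)] with s hs using
      chartCurve_congr hx (h s hs)
  rw [velocityLeft, this.derivWithin_eq (by simpa using chartCurve_congr hx (h 0 h0)),
    derivWithin_comp_mul_left, smul_Iic hl, mul_zero, velocityLeft]

theorem velocity_of_eq {γ δ : UnitAddCircle → M} {x y : UnitAddCircle} {l : ℝ}
    (h : ∀ᶠ s in 𝓝 0, curve γ x s = curve δ y (l * s)) :
    velocity γ x = l • velocity δ y := by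
  have hx : γ x = δ y := by simpa [curve] using h.self_of_nhds
  have : chartCurve γ x =ᶠ[𝓝 0] fun s => chartCurve δ y (l * s) := by
    filter_upwards [h] with s hs using chartCurve_congr hx hs
  rw [velocity, this.deriv_eq, deriv_comp_mul_left, mul_zero, velocity]

theorem contMDiff_mul (l : ℝ) : ContMDiff 𝓘(ℝ, ℝ) 𝓘(ℝ, ℝ) ∞ (fun s : ℝ => l * s) :=
  (contDiff_const.mul contDiff_id).contMDiff

theorem smooth_right_of_eq {γ δ : UnitAddCircle → M} {x y : UnitAddCircle} {l ε : ℝ} (hl : 0 < l)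
    (hε : 0 < ε) (h : ∀ s ∈ Icc 0 ε, curve γ x s = curve δ y (l * s))
    (hδ : ∃ ε > (0 : ℝ), ContMDiffOn 𝓘(ℝ, ℝ) (𝓡∂ 2) ∞ (curve δ y) (Icc 0 ε)) :
    ∃ ε > (0 : ℝ), ContMDiffOn 𝓘(ℝ, ℝ) (𝓡∂ 2) ∞ (curve γ x) (Icc 0 ε) := by
  obtain ⟨η, hη, H⟩ := hδ
  refine ⟨min ε (l⁻¹ * η), by positivity, ?_⟩
  refine (H.comp (contMDiff_mul l).contMDiffOn (s := Icc 0 (min ε (l⁻¹ * η))) ?_).congr ?_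
  · intro s hs
    refine ⟨mul_nonneg hl.le hs.1, ?_⟩
    have := hs.2.trans (min_le_right _ _)
    have := mul_le_mul_of_nonneg_left this hl.le
    rwa [mul_inv_cancel_left₀ hl.ne'] at this
  · intro s hs
    exact h s ⟨hs.1, hs.2.trans (min_le_left _ _)⟩

theorem smooth_left_of_eq {γ δ : UnitAddCircle → M} {x y : UnitAddCircle} {l ε : ℝ} (hl : 0 < l)
    (hε : 0 < ε) (h : ∀ s ∈ Icc (-ε) 0, curve γ x s = curve δ y (l * s))
    (hδ : ∃ ε > (0 : ℝ), ContMDiffOn 𝓘(ℝ, ℝ) (𝓡∂ 2) ∞ (curve δ y) (Icc (-ε) 0)) :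
    ∃ ε > (0 : ℝ), ContMDiffOn 𝓘(ℝ, ℝ) (𝓡∂ 2) ∞ (curve γ x) (Icc (-ε) 0) := by
  obtain ⟨η, hη, H⟩ := hδ
  refine ⟨min ε (l⁻¹ * η), by positivity, ?_⟩
  refine (H.comp (contMDiff_mul l).contMDiffOn (s := Icc (-(min ε (l⁻¹ * η))) 0) ?_).congr ?_
  · intro s hs
    refine ⟨?_, mul_nonpos_of_nonneg_of_nonpos hl.le hs.2⟩
    have : -s ≤ l⁻¹ * η := (neg_le.1 hs.1).trans (min_le_right _ _)
    have := mul_le_mul_of_nonneg_left this hl.le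
    rw [mul_inv_cancel_left₀ hl.ne'] at this
    linarith
  · intro s hs
    exact h s ⟨by linarith [hs.1, min_le_left ε (l⁻¹ * η)], hs.2⟩

theorem velocity_eq_of_smooth [IsManifold (𝓡∂ 2) ∞ M] {γ : UnitAddCircle → M}
    {x : UnitAddCircle}
    (h : ContMDiffAt 𝓘(ℝ, ℝ) (𝓡∂ 2) ∞ (curve γ x) 0) :
    velocityLeft γ x = velocity γ x ∧ velocityRight γ x = velocity γ x := by
  have hd : DifferentiableAt ℝ (chartCurve γ x) 0 := by
    have h1 : ContMDiffAt (𝓡∂ 2) 𝓘(ℝ, Plane) ∞ (extChartAt (𝓡∂ 2) (γ x)) (curve γ x 0) := by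
      apply contMDiffAt_extChartAt' (by simp [curve])
    have h2 : ContMDiffAt 𝓘(ℝ, ℝ) 𝓘(ℝ, Plane) ∞ (chartCurve γ x) 0 := h1.comp 0 h
    exact h2.contDiffAt.differentiableAt (by simp)
  exact ⟨hd.derivWithin (uniqueDiffWithinAt_Iic 0), hd.derivWithin (uniqueDiffWithinAt_Ici 0)⟩

section Arc

variable [IsManifold (𝓡∂ 2) ∞ M]

/-- Restricting a generic loop to one of the two arcs cut out by a self-crossing gives a generic
loop. -/
theorem IsGenericLoop.restrictArc {γ : UnitAddCircle → M} (hγ : IsGenericLoop γ)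
    {P Q : UnitAddCircle} (hne : P ≠ Q) (heq : γ P = γ Q) :
    IsGenericLoop (restrictArc γ P Q) := by
  set l := frac (Q - P) with hl_def
  have hl : 0 < l := frac_pos (sub_ne_zero.2 hne.symm)
  have hright : ∀ u, ∃ ε > (0 : ℝ), ∀ s ∈ Icc 0 ε,
      curve (SurfaceLoop.restrictArc γ P Q) u s = curve γ (arcPoint P Q u) (l * s) := fun u =>
    ⟨(1 - frac u) / 2, by linarith [frac_lt_one u], fun s hs => curve_restrictArc γ P Q u
      (by linarith [frac_nonneg u, hs.1]) (by linarith [hs.2, frac_lt_one u])⟩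
  have hleft : ∀ u, u ≠ 0 → ∃ ε > (0 : ℝ), ∀ s ∈ Icc (-ε) 0,
      curve (SurfaceLoop.restrictArc γ P Q) u s = curve γ (arcPoint P Q u) (l * s) := fun u hu =>
    ⟨frac u, frac_pos hu, fun s hs => curve_restrictArc γ P Q u
      (by linarith [hs.1]) (by linarith [hs.2, frac_lt_one u])⟩
  have hleft0 : ∃ ε > (0 : ℝ), ∀ s ∈ Icc (-ε) 0,
      curve (SurfaceLoop.restrictArc γ P Q) 0 s = curve γ Q (l * s) :=
    ⟨1, one_pos, fun s hs => curve_restrictArc_zero γ heq hs.1 hs.2⟩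
  have hnear : ∀ u, u ≠ 0 → ∀ᶠ s in 𝓝 (0 : ℝ),
      curve (SurfaceLoop.restrictArc γ P Q) u s = curve γ (arcPoint P Q u) (l * s) := fun u hu => by
    filter_upwards [Ioo_mem_nhds (show -frac u < 0 by linarith [frac_pos hu])
      (show 0 < 1 - frac u by linarith [frac_lt_one u])] with s hs
    exact curve_restrictArc γ P Q u (by linarith [hs.1]) (by linarith [hs.2])
  have hcross0 : ∀ v, v ≠ 0 → γ (arcPoint P Q 0) ≠ γ (arcPoint P Q v) := fun v hv h => by
    rw [arcPoint_zero] at h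
    rcases hγ.double Q P (arcPoint P Q v) heq.symm h with h' | h' | h'
    · exact hne h'.symm
    · exact hv (arcPoint_injective hne (by rw [← h', arcPoint_zero]))
    · exact arcPoint_ne_right hne v h'.symm
  have hcross : ∀ u v, u ≠ v → γ (arcPoint P Q u) = γ (arcPoint P Q v) → u ≠ 0 := by
    rintro u v huv h rfl
    exact hcross0 v huv.symm h
  constructor
  · exact fun u => hγ.interior _
  · intro u
    obtain ⟨ε, hε, h⟩ := hright u
    exact smooth_right_of_eq hl hε h (hγ.smooth_right _)
  · intro u
    rcases eq_or_ne u 0 with rfl | hu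
    · obtain ⟨ε, hε, h⟩ := hleft0
      exact smooth_left_of_eq hl hε h (hγ.smooth_left _)
    · obtain ⟨ε, hε, h⟩ := hleft u hu
      exact smooth_left_of_eq hl hε h (hγ.smooth_left _)
  · intro u
    obtain ⟨ε, hε, h⟩ := hright u
    rw [velocityRight_of_eq hl hε h]
    exact smul_ne_zero hl.ne' (hγ.velocityRight_ne _)
  · intro u
    rcases eq_or_ne u 0 with rfl | hu
    · obtain ⟨ε, hε, h⟩ := hleft0
      rw [velocityLeft_of_eq hl hε h]
      exact smul_ne_zero hl.ne' (hγ.velocityLeft_ne _)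
    · obtain ⟨ε, hε, h⟩ := hleft u hu
      rw [velocityLeft_of_eq hl hε h]
      exact smul_ne_zero hl.ne' (hγ.velocityLeft_ne _)
  · intro u
    obtain ⟨ε', hε', h'⟩ := hright u
    rw [velocityRight_of_eq hl hε' h']
    rcases eq_or_ne u 0 with rfl | hu
    · obtain ⟨ε, hε, h⟩ := hleft0
      rw [velocityLeft_of_eq hl hε h]
      refine not_sameRay_smul hl ?_
      rw [arcPoint_zero, (velocity_eq_of_smooth (hγ.smooth_crossing Q P hne.symm heq.symm)).1,
        (velocity_eq_of_smooth (hγ.smooth_crossing P Q hne heq)).2]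
      exact not_sameRay_neg_of_cross_ne (hγ.transversal Q P hne.symm heq.symm)
    · obtain ⟨ε, hε, h⟩ := hleft u hu
      rw [velocityLeft_of_eq hl hε h]
      exact not_sameRay_smul hl (hγ.not_cusp _)
  · intro u v huv h
    have H := hγ.smooth_crossing _ _ ((arcPoint_injective hne).ne huv) h
    have hu := hcross u v huv h
    refine ContMDiffAt.congr_of_eventuallyEq ?_ (hnear u hu)
    refine ContMDiffAt.comp (0 : ℝ) (g := curve γ (arcPoint P Q u)) ?_ (contMDiff_mul l).contMDiffAt
    simpa using H
  · intro u v w huv hvw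
    have i := arcPoint_injective hne
    exact (hγ.double _ _ _ huv hvw).imp (fun h => i h) (Or.imp (fun h => i h) fun h => i h)
  · intro u v huv h
    rw [velocity_of_eq (hnear u (hcross u v huv h)),
      velocity_of_eq (hnear v (hcross v u huv.symm h.symm)), cross_smul]
    exact mul_ne_zero (mul_pos hl hl).ne'
      (hγ.transversal _ _ ((arcPoint_injective hne).ne huv) h)

end Arc

/-! ### Loops and their isotopy classes -/

/-- `h` is an ambient isotopy: a continuous family `h t`, `t ∈ [0, 1]`, of self-homeomorphisms with
`h 0 = id`. -/
def IsAmbientIsotopy {X : Type*} [TopologicalSpace X] (h : unitInterval → X ≃ₜ X) : Prop :=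
  Continuous (fun p : unitInterval × X => h p.1 p.2) ∧ h 0 = Homeomorph.refl X

section AmbientIsotopy

variable {X : Type*} [TopologicalSpace X]

theorem IsAmbientIsotopy.refl : IsAmbientIsotopy fun _ => Homeomorph.refl X :=
  ⟨continuous_snd, rfl⟩

theorem IsAmbientIsotopy.trans {h k : unitInterval → X ≃ₜ X} (hh : IsAmbientIsotopy h)
    (hk : IsAmbientIsotopy k) : IsAmbientIsotopy fun t => (h t).trans (k t) :=
  ⟨hk.1.comp (continuous_fst.prodMk hh.1), by ext; simp [hh.2, hk.2]⟩

theorem IsAmbientIsotopy.symm {h : unitInterval → X ≃ₜ X} (hh : IsAmbientIsotopy h) :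
    IsAmbientIsotopy fun t => (h 1).symm.trans (h (unitInterval.symm t)) :=
  ⟨hh.1.comp ((unitInterval.continuous_symm.comp continuous_fst).prodMk
    ((h 1).symm.continuous.comp continuous_snd)), by ext; simp⟩

end AmbientIsotopy

variable (M) in
/-- Generic loops on `M`. -/
structure GenericLoop where
  toFun : UnitAddCircle → M
  generic : IsGenericLoop toFun

namespace GenericLoop

instance : CoeFun (GenericLoop M) fun _ => UnitAddCircle → M := ⟨toFun⟩

/-- The set `#α` of self-crossings of `α`. -/
def crossings (α : GenericLoop M) : Set M := {p | ∃ x y, x ≠ y ∧ α x = p ∧ α y = p}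

/-- Isotopy of (non-pointed) loops: `β = h₁ ∘ α ∘ f` for an ambient isotopy `h` and an orientation
preserving homeomorphism `f` of the circle. -/
def Isotopic (α β : GenericLoop M) : Prop :=
  ∃ (h : unitInterval → M ≃ₜ M) (f : UnitAddCircle ≃ₜ UnitAddCircle),
    IsAmbientIsotopy h ∧ OrientationPreserving f ∧ ∀ x, β x = h 1 (α (f x))

variable (M) in
/-- Isotopy is an equivalence relation on the set of loops. -/
instance isotopySetoid : Setoid (GenericLoop M) where
  r := Isotopic
  iseqv :=
    { refl := fun _ => ⟨_, _, .refl, .refl, fun _ => rfl⟩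
      symm := by
        rintro α β ⟨h, f, hh, hf, H⟩
        exact ⟨_, _, hh.symm, hf.symm, fun x => by simp [H, hh.2]⟩
      trans := by
        rintro α β γ ⟨h, f, hh, hf, H⟩ ⟨k, g, hk, hg, K⟩
        exact ⟨_, _, hh.trans hk, hg.trans hf, fun x => by simp [H, K]⟩ }

end GenericLoop

variable (M) in
/-- A pointed loop: a generic loop `α` with a base point in `α(S¹) - #α`. -/
structure PointedLoop where
  loop : GenericLoop M
  base : M
  base_mem : base ∈ range loop
  base_notMem : base ∉ loop.crossings

namespace PointedLoop

/-- Isotopy of pointed loops. -/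
def Isotopic (α β : PointedLoop M) : Prop :=
  ∃ (h : unitInterval → M ≃ₜ M) (f : UnitAddCircle ≃ₜ UnitAddCircle),
    IsAmbientIsotopy h ∧ OrientationPreserving f ∧
      (∀ x, β.loop x = h 1 (α.loop (f x))) ∧ β.base = h 1 α.base

variable (M) in
/-- Isotopy is an equivalence relation on the set of pointed loops. -/
instance isotopySetoid : Setoid (PointedLoop M) where
  r := Isotopic
  iseqv :=
    { refl := fun _ => ⟨_, _, .refl, .refl, fun _ => rfl, rfl⟩
      symm := by
        rintro α β ⟨h, f, hh, hf, H, H'⟩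
        exact ⟨_, _, hh.symm, hf.symm, fun x => by simp [H, hh.2], by simp [H', hh.2]⟩
      trans := by
        rintro α β γ ⟨h, f, hh, hf, H, H'⟩ ⟨k, g, hk, hg, K, K'⟩
        exact ⟨_, _, hh.trans hk, hg.trans hf, fun x => by simp [H, K], by simp [H', K']⟩ }

/-- The unique parameter `α⁻¹(∗_α) ∈ S¹` of the base point. -/
noncomputable def baseParam (α : PointedLoop M) : UnitAddCircle := α.base_mem.choose

theorem loop_baseParam (α : PointedLoop M) : α.loop α.baseParam = α.base := α.base_mem.choose_spec

end PointedLoop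

/-! ### Crossings and the two loops that they cut out -/

/-- A self-crossing `p` of `α` with a numeration of the two points of `α⁻¹(p)`. -/
@[ext] structure NumberedCrossing (α : GenericLoop M) where
  fst : UnitAddCircle
  snd : UnitAddCircle
  ne : fst ≠ snd
  eq : α fst = α snd

namespace NumberedCrossing

variable [IsManifold (𝓡∂ 2) ∞ M]

variable {α : GenericLoop M}

/-- The crossing point. -/
def point (c : NumberedCrossing α) : M := α c.fst

/-- The same crossing with the opposite numeration. -/
def swap (c : NumberedCrossing α) : NumberedCrossing α := ⟨c.snd, c.fst, c.ne.symm, c.eq.symm⟩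

/-- The loop `α_{P,Q}`, where `P, Q` are the first and the second point of `α⁻¹(p)`. -/
noncomputable def arc (c : NumberedCrossing α) : GenericLoop M :=
  ⟨restrictArc α c.fst c.snd, α.generic.restrictArc c.ne c.eq⟩

/-- The pair (positive tangent direction of `α` at the first point, positive tangent direction of
`α` at the second point) is positive with respect to the orientation of the surface. -/
def IsPositive (o : SurfaceOrientation M) (c : NumberedCrossing α) : Prop :=
  0 < ((o.sign c.point : ℤ) : ℝ) * cross (velocity α c.fst) (velocity α c.snd)

/-- Starting at the base point and moving along the circle in the positive direction, one meets the
first point before the second one. -/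
def IsFromBase {P : PointedLoop M} (c : NumberedCrossing P.loop) : Prop :=
  frac (c.fst - P.baseParam) < frac (c.snd - P.baseParam)

theorem crossings_arc_subset (c : NumberedCrossing α) : c.arc.crossings ⊆ α.crossings := by
  rintro p ⟨x, y, hxy, hx, hy⟩
  exact ⟨_, _, (arcPoint_injective c.ne).ne hxy, hx, hy⟩

theorem point_mem_range_arc (c : NumberedCrossing α) : c.point ∈ range c.arc :=
  ⟨0, by simp [arc, point, restrictArc]⟩

theorem point_notMem_crossings_arc (c : NumberedCrossing α) : c.point ∉ c.arc.crossings := by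
  rintro ⟨x, y, hxy, hx, hy⟩
  have hxy' := (arcPoint_injective c.ne).ne hxy
  have key : ∀ u, c.arc u = c.point → arcPoint c.fst c.snd u = c.fst := fun u hu => by
    rcases α.generic.double _ _ _ hu c.eq with h | h | h
    · exact h
    · exact absurd h c.ne
    · exact absurd h (arcPoint_ne_right c.ne u)
  exact hxy' ((key x hx).trans (key y hy).symm)

/-- The pointed loop `(α_{P,Q}, p)`. -/
noncomputable def innerLoop (c : NumberedCrossing α) : PointedLoop M :=
  ⟨c.arc, c.point, c.point_mem_range_arc, c.point_notMem_crossings_arc⟩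

theorem base_mem_range_arc {P : PointedLoop M} (c : NumberedCrossing P.loop) (hc : c.IsFromBase) :
    P.base ∈ range c.swap.arc := by
  obtain ⟨x, y, hne, heq⟩ := c
  set b := P.baseParam with hb
  have hc' : frac (x - b) < frac (y - b) := hc
  have hbx : b ≠ x := by
    rintro h
    exact P.base_notMem ⟨x, y, hne, by rw [← h, P.loop_baseParam], by
      rw [← heq, ← h, P.loop_baseParam]⟩
  have hx : 0 < frac (x - b) := frac_pos (sub_ne_zero.2 hbx.symm)
  have hy : frac (y - b) < 1 := frac_lt_one _
  have hby : frac (b - y) = 1 - frac (y - b) := by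
    apply frac_eq_of_coe (by linarith) (by linarith)
    rw [AddCircle.coe_sub, coe_frac, AddCircle.coe_period]
    abel
  have hxy : frac (x - y) = 1 - frac (y - b) + frac (x - b) := by
    apply frac_eq_of_coe (by linarith) (by linarith)
    rw [AddCircle.coe_add, AddCircle.coe_sub, coe_frac, coe_frac, AddCircle.coe_period]
    abel
  have hpos : 0 < frac (x - y) := by linarith
  refine ⟨((frac (b - y) / frac (x - y) : ℝ) : UnitAddCircle), ?_⟩
  have : arcPoint y x ((frac (b - y) / frac (x - y) : ℝ) : UnitAddCircle) = b := by
    rw [arcPoint, frac_coe (div_nonneg (frac_nonneg _) hpos.le)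
      ((div_lt_one hpos).2 (by linarith)), mul_div_cancel₀ _ hpos.ne', coe_frac]
    abel
  change P.loop (arcPoint y x _) = P.base
  rw [this, hb, P.loop_baseParam]

/-- The pointed loop `(α_{p₂,p₁}, ∗_α)`, where `p₁, p₂` are numerated starting from the base
point. -/
noncomputable def outerLoop {P : PointedLoop M} (c : NumberedCrossing P.loop) (hc : c.IsFromBase) :
    PointedLoop M :=
  ⟨c.swap.arc, P.base, c.base_mem_range_arc hc,
    fun h => P.base_notMem (c.swap.crossings_arc_subset h)⟩

end NumberedCrossing

/-! ### The modules of loops and the cobracket formulas -/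

section Modules

variable (R : Type*) [CommRing R]

variable (M) in
/-- The module `𝓛` freely generated by the isotopy classes of pointed loops. -/
abbrev PointedLoopModule := Quotient (PointedLoop.isotopySetoid M) →₀ R

variable (M) in
/-- The module `𝓛₀` freely generated by the isotopy classes of (non-pointed) loops. -/
abbrev LoopModule := Quotient (GenericLoop.isotopySetoid M) →₀ R

/-- The generator of `𝓛` given by a pointed loop. -/
noncomputable def PointedLoop.gen (α : PointedLoop M) : PointedLoopModule M R :=
  Finsupp.single ⟦α⟧ 1

/-- The generator of `𝓛₀` given by a loop. -/
noncomputable def GenericLoop.gen (α : GenericLoop M) : LoopModule M R :=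
  Finsupp.single ⟦α⟧ 1

variable (M) in
/-- The projection `𝓛 → 𝓛₀` forgetting the base points. -/
noncomputable def forgetBase : PointedLoopModule M R →ₗ[R] LoopModule M R :=
  Finsupp.lmapDomain R R <| Quotient.map PointedLoop.loop
    fun _ _ ⟨h, f, hh, hf, H, _⟩ => ⟨h, f, hh, hf, H⟩

variable [IsManifold (𝓡∂ 2) ∞ M]

open Classical in
/-- The sign `ε_p = ±1` of a numbered crossing, as an element of the ground ring. -/
noncomputable def NumberedCrossing.eps (o : SurfaceOrientation M) {α : GenericLoop M}
    (c : NumberedCrossing α) : R :=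
  if c.IsPositive o then 1 else -1

/-- `∑_p ε_p ((α_{p₁,p₂}, p) ⊗ (α_{p₂,p₁}, ∗) - (α_{p₂,p₁}, ∗) ⊗ (α_{p₁,p₂}, p))`, where the sum
runs over the crossings `p` of `α`, each with its numeration `p₁, p₂` from the base point. -/
noncomputable def PointedLoop.cobracketSum (o : SurfaceOrientation M) (α : PointedLoop M) :
    PointedLoopModule M R ⊗[R] PointedLoopModule M R :=
  ∑ᶠ c : {c : NumberedCrossing α.loop // c.IsFromBase},
    c.1.eps R o • (c.1.innerLoop.gen R ⊗ₜ[R] (c.1.outerLoop c.2).gen R -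
      (c.1.outerLoop c.2).gen R ⊗ₜ[R] c.1.innerLoop.gen R)

/-- `∑_p (α_{p¹,p²} ⊗ α_{p²,p¹} - α_{p²,p¹} ⊗ α_{p¹,p²})`, where the sum runs over the crossings
`p` of `α`, each with its numeration `p¹, p²` determined by the orientation of the surface. -/
noncomputable def GenericLoop.cobracketSum (o : SurfaceOrientation M) (α : GenericLoop M) :
    LoopModule M R ⊗[R] LoopModule M R :=
  ∑ᶠ c : {c : NumberedCrossing α // c.IsPositive o},
    (c.1.arc.gen R ⊗ₜ[R] c.1.swap.arc.gen R - c.1.swap.arc.gen R ⊗ₜ[R] c.1.arc.gen R)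

end Modules

end SurfaceLoop

/-! The formulas descend to isotopy classes once the signs `ε_p` are known to be isotopy invariant.
An ambient isotopy consists of mere homeomorphisms, so tangent vectors cannot be transported; the
sign is read as a local degree instead. Near a transversal crossing the two branches `a`, `b`, seen
in a chart, give the map `(s, t) ↦ a s + b t - a 0`, a local homeomorphism whose local degree is the
sign of the crossing. Corrected by the orientation, the local degree is locally constant in time,
hence constant (`localDegree_isotopy`). At the end of the isotopy the transported map and the one
built from the new loop differ by an injective map that preserves both axes with their directions,
and such a map has degree `1` (`localDegree_one_of_axes`). This yields `sign_cross_isotopy`. Since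
orientation preserving homeomorphisms of the circle map arcs to arcs and keep the cyclic order, all
other data in the sums are carried along as well.

Finiteness of the self-crossings is compactness of the torus of parameter pairs: no pair is an
accumulation point, by local injectivity on the diagonal, by transversality at a crossing, and by
the Hausdorff property elsewhere (`IsGenericLoop.finite_pairs`).

For co-Jacobi, crossings are chords of a circle cut open at the base point, and applying the
cobracket twice sums over ordered pairs of chords. Interlaced chords destroy each other and
contribute nothing. For nested chords the two orders of cutting give the same three loops, and for
disjoint chords the contribution is symmetric up to a transposition; after summing over cyclic
permutations everything cancels (`cycSum_lTensor_sum_eq_zero`). That the two orders of cutting leave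
the same loop is true up to a rotation of the parameter circle (`exists_rotation_wrap`).

Without base points, renumbering a crossing reverses both its sign and its antisymmetric tensor, so
the numbering from the base point may be replaced by the one from the orientation. Forgetting base
points is surjective because every loop has a point off its finite crossing set; this transfers the
axioms to the quotient and gives uniqueness. -/

namespace SurfaceLoop

/-! ### Degrees of maps from the circle to the punctured plane -/

open scoped ComplexConjugate

/-- `f : S¹ → ℂ ∖ {0}` is continuous and has degree `n`. -/
def HasDegree (f : Circle → ℂ) (n : ℤ) : Prop :=
  ∃ g : Circle → ℂ, Continuous g ∧ ∀ u, f u = (u : ℂ) ^ n * Complex.exp (g u)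

namespace HasDegree

variable {f f' : Circle → ℂ} {n m : ℤ}

theorem continuous (hf : HasDegree f n) : Continuous f := by
  obtain ⟨g, hg, h⟩ := hf
  rw [show f = fun u : Circle => (u : ℂ) ^ n * Complex.exp (g u) from funext h]
  refine Continuous.mul ?_ (Complex.continuous_exp.comp hg)
  have : Continuous fun u : Circle => (u : ℂ) := continuous_subtype_val
  exact this.zpow₀ n fun u => Or.inl (Circle.coe_ne_zero u)

theorem ne_zero (hf : HasDegree f n) (u : Circle) : f u ≠ 0 := by
  obtain ⟨g, hg, h⟩ := hf
  rw [h]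
  exact mul_ne_zero (zpow_ne_zero _ (Circle.coe_ne_zero u)) (Complex.exp_ne_zero _)

theorem id : HasDegree (fun u => (u : ℂ)) 1 :=
  ⟨fun _ => 0, continuous_const, fun u => by simp⟩

/-- On the slit plane the principal logarithm is continuous, so the logarithm of the quotient can be
added to the exponent `g`. Every later comparison of degrees reduces to this one. -/
theorem of_div_mem_slitPlane (hf : HasDegree f n) (hf' : Continuous f')
    (h : ∀ u, f' u / f u ∈ Complex.slitPlane) : HasDegree f' n := by
  have hc := hf.continuous
  have h0 := hf.ne_zero
  obtain ⟨g, hg, hfg⟩ := hf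
  refine ⟨fun u => g u + Complex.log (f' u / f u), hg.add ?_, fun u => ?_⟩
  · exact (hf'.div hc h0).clog h
  · rw [Complex.exp_add, Complex.exp_log (Complex.slitPlane_ne_zero (h u)), ← mul_assoc, ← hfg,
      mul_div_cancel₀ _ (h0 u)]

theorem const_mul (hf : HasDegree f n) {a : ℂ} (ha : a ≠ 0) : HasDegree (fun u => a * f u) n := by
  obtain ⟨g, hg, h⟩ := hf
  refine ⟨fun u => Complex.log a + g u, continuous_const.add hg, fun u => ?_⟩
  simp only [Complex.exp_add, Complex.exp_log ha, h]
  ring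

theorem conjugate (hf : HasDegree f n) : HasDegree (fun u => conj (f u)) (-n) := by
  obtain ⟨g, hg, h⟩ := hf
  refine ⟨fun u => conj (g u), Complex.continuous_conj.comp hg, fun u => ?_⟩
  dsimp only
  rw [h, map_mul, map_zpow₀, ← Complex.exp_conj, ← Circle.coe_inv_eq_conj, zpow_neg,
    Circle.coe_inv, inv_zpow]

/-- Pulled back to the line, the two logarithms of `f` differ by `2πi j(t)` with `j` continuous and
integer valued, hence constant. Comparing `t = 0` with `t = 2π`, where `g` and `k` return to their
values, leaves `(n - m) 2πi = 0`. -/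
theorem unique (hf : HasDegree f n) (hf' : HasDegree f m) : n = m := by
  obtain ⟨g, hg, h⟩ := hf
  obtain ⟨k, hk, h'⟩ := hf'
  have key : ∀ t : ℝ, ∃ j : ℤ,
      n * (t * Complex.I) + g (Circle.exp t) =
        m * (t * Complex.I) + k (Circle.exp t) + j * (2 * Real.pi * Complex.I) := fun t => by
    rw [← Complex.exp_eq_exp_iff_exists_int, Complex.exp_add, Complex.exp_add, Complex.exp_int_mul,
      Complex.exp_int_mul, ← Circle.coe_exp, ← h, ← h']
  choose j hj using key
  have hpi : (2 * Real.pi * Complex.I : ℂ) ≠ 0 := Complex.two_pi_I_ne_zero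
  have hjr : ∀ t, (j t : ℝ) = (((n - m) * (t * Complex.I) + g (Circle.exp t) - k (Circle.exp t)) /
      (2 * Real.pi * Complex.I)).re := fun t => by
    have : ((n - m) * (t * Complex.I) + g (Circle.exp t) - k (Circle.exp t)) /
      (2 * Real.pi * Complex.I) = j t := by
      rw [div_eq_iff hpi]
      linear_combination hj t
    rw [this, Complex.intCast_re]
  have hjc : Continuous j := by
    rw [Int.isClosedEmbedding_coe_real.isInducing.continuous_iff]
    rw [show ((↑) : ℤ → ℝ) ∘ j = _ from funext hjr]
    have := hg.comp Circle.exp.continuous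
    have := hk.comp Circle.exp.continuous
    simp only [Function.comp_def] at *
    fun_prop
  have h0 := hj 0
  have h1 := hj (2 * Real.pi)
  rw [PreconnectedSpace.constant inferInstance hjc (x := 2 * Real.pi) (y := 0), Circle.exp_two_pi]
    at h1
  rw [Circle.exp_zero] at h0
  push_cast at h0 h1
  have : ((n : ℂ) - m) * (2 * Real.pi * Complex.I) = 0 := by linear_combination h1 - h0
  rcases mul_eq_zero.1 this with h | h
  · exact_mod_cast sub_eq_zero.1 h
  · exact absurd h hpi

end HasDegree

theorem one_add_mem_slitPlane {z : ℂ} (hz : ‖z‖ < 1) : 1 + z ∈ Complex.slitPlane :=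
  Complex.mem_slitPlane_of_norm_lt_one hz

theorem inv_mem_slitPlane {z : ℂ} (hz : z ∈ Complex.slitPlane) : z⁻¹ ∈ Complex.slitPlane := by
  have h0 := Complex.normSq_pos.2 (Complex.slitPlane_ne_zero hz)
  rcases hz with h | h
  · exact Or.inl (by rw [Complex.inv_re]; positivity)
  · exact Or.inr (by rw [Complex.inv_im]; exact div_ne_zero (neg_ne_zero.2 h) h0.ne')

/-- The quotient by `a f` is `1` plus a number of norm `‖b‖ / ‖a‖ < 1`. When `b` dominates instead,
the roles of `f` and its conjugate are exchanged and the degree changes sign. -/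
theorem HasDegree.linear_pos {f : Circle → ℂ} {n : ℤ} (hf : HasDegree f n) {a b : ℂ}
    (h : ‖b‖ < ‖a‖) : HasDegree (fun u => a * f u + b * conj (f u)) n := by
  have ha : a ≠ 0 := norm_pos_iff.1 ((norm_nonneg b).trans_lt h)
  refine (hf.const_mul ha).of_div_mem_slitPlane ?_ fun u => ?_
  · have := hf.continuous
    have := Complex.continuous_conj.comp this
    simp only [Function.comp_def] at this
    fun_prop
  · have h0 := hf.ne_zero u
    have hu : a * f u ≠ 0 := mul_ne_zero ha h0
    rw [add_div, div_self hu]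
    apply one_add_mem_slitPlane
    rw [norm_div, norm_mul, norm_mul, RCLike.norm_conj, div_lt_one (by positivity)]
    exact mul_lt_mul_of_pos_right h (norm_pos_iff.2 h0)

theorem HasDegree.linear_neg {f : Circle → ℂ} {n : ℤ} (hf : HasDegree f n) {a b : ℂ}
    (h : ‖a‖ < ‖b‖) : HasDegree (fun u => a * f u + b * conj (f u)) (-n) := by
  have := hf.conjugate.linear_pos h
  simpa [add_comm] using this

/-- The quotient of nearby maps is close to `1`, uniformly on the circle by compactness, and so lies
in the slit plane. -/
theorem eventually_hasDegree_iff {X : Type*} [TopologicalSpace X] {f : X → Circle → ℂ} {x₀ : X}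
    (hc : ∀ u, ContinuousAt (Function.uncurry f) (x₀, u)) (h0 : ∀ u, f x₀ u ≠ 0)
    (hcx : ∀ᶠ x in 𝓝 x₀, Continuous (f x)) :
    ∀ᶠ x in 𝓝 x₀, ∀ n, HasDegree (f x) n ↔ HasDegree (f x₀) n := by
  have hx0 : Continuous (f x₀) := hcx.self_of_nhds
  have key : ∀ᶠ x in 𝓝 x₀, ∀ u ∈ (univ : Set Circle), f x u / f x₀ u ∈ Complex.slitPlane := by
    apply isCompact_univ.eventually_forall_of_forall_eventually
    intro u _
    have h1 : ContinuousAt (fun z : X × Circle => f z.1 z.2 / f x₀ z.2) (x₀, u) :=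
      ContinuousAt.div (hc u) (hx0.continuousAt.comp continuousAt_snd) (h0 u)
    exact h1.eventually_mem (Complex.isOpen_slitPlane.mem_nhds (by simp [h0 u]))
  filter_upwards [key, hcx] with x hx hxc n
  refine ⟨fun h => h.of_div_mem_slitPlane hx0 fun u => ?_,
    fun h => h.of_div_mem_slitPlane hxc fun u => hx u trivial⟩
  rw [← inv_div]
  exact inv_mem_slitPlane (hx u trivial)

/-! ### Local degrees of maps of the plane -/

/-- The identification of the coordinate plane with `ℂ`. -/
noncomputable def planeC : Plane ≃ₗᵢ[ℝ] ℂ := Complex.orthonormalBasisOneI.repr.symm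

theorem planeC_apply (v : Plane) : planeC v = v 0 + v 1 * Complex.I :=
  Complex.orthonormalBasisOneI_repr_symm_apply v

theorem planeC_re (v : Plane) : (planeC v).re = v 0 := by simp [planeC_apply]

theorem planeC_im (v : Plane) : (planeC v).im = v 1 := by simp [planeC_apply]

/-- The circle of radius `ρ` around the origin. -/
noncomputable def circ (ρ : ℝ) (u : Circle) : Plane := ρ • planeC.symm u

theorem continuous_circ : Continuous (Function.uncurry circ) := by
  unfold circ
  exact continuous_fst.smul
    (planeC.symm.continuous.comp (continuous_subtype_val.comp continuous_snd))

theorem norm_circ {ρ : ℝ} (hρ : 0 ≤ ρ) (u : Circle) : ‖circ ρ u‖ = ρ := by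
  rw [circ, norm_smul, planeC.symm.norm_map, Circle.norm_coe, mul_one, Real.norm_of_nonneg hρ]

theorem circ_ne_zero {ρ : ℝ} (hρ : 0 < ρ) (u : Circle) : circ ρ u ≠ 0 := by
  rw [← norm_pos_iff, norm_circ hρ.le]
  exact hρ

/-- The displacement of the image of the circle of radius `ρ` from the image of the origin. -/
noncomputable def displacement (F : Plane → Plane) (ρ : ℝ) (u : Circle) : ℂ :=
  planeC (F (circ ρ u) - F 0)

theorem displacement_ne_zero {F : Plane → Plane} {ρ : ℝ} {u : Circle} :
    displacement F ρ u ≠ 0 ↔ F (circ ρ u) ≠ F 0 := by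
  rw [displacement, ne_eq, LinearIsometryEquiv.map_eq_zero_iff, sub_eq_zero]

/-- The map `F` has local degree `n` at the origin. -/
def LocalDegree (F : Plane → Plane) (n : ℤ) : Prop :=
  ∀ᶠ ρ in 𝓝[>] (0 : ℝ), HasDegree (displacement F ρ) n

theorem continuous_displacement {F : Plane → Plane} {ρ : ℝ}
    (h : ∀ u, ContinuousAt F (circ ρ u)) : Continuous (displacement F ρ) := by
  refine planeC.continuous.comp (Continuous.sub ?_ continuous_const)
  rw [continuous_iff_continuousAt]
  intro u
  exact ContinuousAt.comp (f := circ ρ) (h u) (continuous_circ.uncurry_left ρ).continuousAt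

/-- On the punctured disc the displacement never vanishes, so the degree is locally constant in the
radius; the interval of radii is connected, so one radius decides. -/
theorem localDegree_iff {F : Plane → Plane} {r : ℝ} (hc : ∀ z, ‖z‖ < r → ContinuousAt F z)
    (h0 : ∀ z, ‖z‖ < r → z ≠ 0 → F z ≠ F 0) {ρ : ℝ} (hρ : 0 < ρ) (hρr : ρ < r) (n : ℤ) :
    LocalDegree F n ↔ HasDegree (displacement F ρ) n := by
  have key : ∀ ρ' ∈ Ioo 0 r,
      (HasDegree (displacement F ρ') n ↔ HasDegree (displacement F ρ) n) := by
    intro ρ' hρ'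
    have : IsLocallyConstant fun s : Ioo 0 r => HasDegree (displacement F s) n := by
      rw [IsLocallyConstant.iff_eventually_eq]
      intro s
      have : ∀ᶠ x : Ioo 0 r in 𝓝 s, ∀ n, HasDegree (displacement F x) n ↔ HasDegree (displacement F s) n := by
        apply eventually_hasDegree_iff (f := fun x : Ioo 0 r => displacement F x)
        · intro u
          apply planeC.continuous.continuousAt.comp
          apply ContinuousAt.sub _ continuousAt_const
          apply ContinuousAt.comp (f := fun x : Ioo 0 r × Circle => circ x.1 x.2)
          · exact hc _ (by rw [norm_circ s.2.1.le]; exact s.2.2)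
          · exact (continuous_circ.comp (Continuous.prodMap continuous_subtype_val
              continuous_id)).continuousAt
        · intro u
          rw [displacement_ne_zero]
          exact h0 _ (by rw [norm_circ s.2.1.le]; exact s.2.2) (circ_ne_zero s.2.1 u)
        · refine Eventually.of_forall fun x => continuous_displacement fun u => hc _ ?_
          rw [norm_circ x.2.1.le]; exact x.2.2
      filter_upwards [this] with x hx
      exact propext (hx n)
    have _ : PreconnectedSpace (Ioo 0 r) := isPreconnected_iff_preconnectedSpace.1 isPreconnected_Ioo
    exact iff_of_eq (this.apply_eq_of_isPreconnected isPreconnected_univ (x := ⟨ρ', hρ'⟩) (y := ⟨ρ, hρ, hρr⟩) trivial trivial)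
  have hmem : Ioo 0 r ∈ 𝓝[>] (0 : ℝ) := Ioo_mem_nhdsGT (hρ.trans hρr)
  constructor
  · intro h
    obtain ⟨ρ', h1, h2⟩ := (h.and hmem).exists
    exact (key ρ' h2).1 h1
  · intro h
    filter_upwards [hmem] with ρ' h'
    exact (key ρ' h').2 h

theorem LocalDegree.unique {F : Plane → Plane} {n m : ℤ} (h : LocalDegree F n)
    (h' : LocalDegree F m) : n = m := by
  obtain ⟨ρ, h1, h2⟩ := (h.and h').exists
  exact h1.unique h2

theorem LocalDegree.congr {F G : Plane → Plane} {n : ℤ} (h : LocalDegree F n)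
    (hFG : F =ᶠ[𝓝 0] G) : LocalDegree G n := by
  obtain ⟨r, hr, hb⟩ := Metric.eventually_nhds_iff.1 hFG
  filter_upwards [h, Ioo_mem_nhdsGT hr] with ρ h1 h2
  convert h1 using 1
  ext u
  rw [displacement, displacement, hb (y := circ ρ u), hb (y := 0) (by simpa using hr)]
  rw [dist_zero_right, norm_circ h2.1.le]
  exact h2.2

theorem localDegree_id : LocalDegree (fun z => z) 1 := by
  filter_upwards [self_mem_nhdsWithin] with ρ (hρ : 0 < ρ)
  have := HasDegree.id.const_mul (a := (ρ : ℂ)) (by exact_mod_cast hρ.ne')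
  convert this using 2 with u
  simp [displacement, circ]

/-- The degree of a linear automorphism. -/
theorem HasDegree.linear {f : Circle → ℂ} {n : ℤ} (hf : HasDegree f n) (A : Plane →L[ℝ] Plane)
    (hA : A.det ≠ 0) :
    HasDegree (fun u => planeC (A (planeC.symm (f u)))) ((SignType.sign A.det : ℤ) * n) := by
  set e : Fin 2 → Plane := fun i => EuclideanSpace.single i 1 with he
  -- A real linear map of `ℂ` is `z ↦ a z + b z̄`, and its determinant is `‖a‖² - ‖b‖²`; its sign
  -- tells which term dominates.
  set a : ℂ := ⟨(A (e 0) 0 + A (e 1) 1) / 2, (A (e 0) 1 - A (e 1) 0) / 2⟩ with ha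
  set b : ℂ := ⟨(A (e 0) 0 - A (e 1) 1) / 2, (A (e 0) 1 + A (e 1) 0) / 2⟩ with hb
  have hdet : A.det = A (e 0) 0 * A (e 1) 1 - A (e 1) 0 * A (e 0) 1 := by
    rw [ContinuousLinearMap.det, ← LinearMap.det_toMatrix (EuclideanSpace.basisFun (Fin 2) ℝ).toBasis,
      Matrix.det_fin_two]
    simp [LinearMap.toMatrix_apply, he]
  have hab : A.det = ‖a‖ ^ 2 - ‖b‖ ^ 2 := by
    rw [hdet, Complex.sq_norm, Complex.sq_norm, Complex.normSq_apply, Complex.normSq_apply, ha, hb]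
    ring
  have hform : ∀ z : ℂ, planeC (A (planeC.symm z)) = a * z + b * conj z := by
    intro z
    have hz : planeC.symm z = z.re • e 0 + z.im • e 1 := by
      ext i
      fin_cases i <;> simp [planeC, he]
    rw [hz, map_add, map_smul, map_smul]
    apply Complex.ext
    · simp [planeC_re, ha, hb]; ring
    · simp [planeC_im, ha, hb]; ring
  simp only [hform]
  rcases hA.lt_or_gt with h | h
  · rw [sign_neg h]
    simpa using hf.linear_neg (a := a) (b := b)
      (by rw [← sq_lt_sq₀ (norm_nonneg _) (norm_nonneg _)]; linarith)
  · rw [sign_pos h]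
    simpa using hf.linear_pos (a := a) (b := b)
      (by rw [← sq_lt_sq₀ (norm_nonneg _) (norm_nonneg _)]; linarith)

/-- The local degree of a composite with a map that has an invertible derivative. -/
theorem LocalDegree.comp_hasFDerivWithinAt {F : Plane → Plane} {n : ℤ} (hF : LocalDegree F n)
    {τ : Plane → Plane} {A : Plane →L[ℝ] Plane} {S : Set Plane}
    (hτ : HasFDerivWithinAt τ A S (F 0)) (hA : A.det ≠ 0)
    (hFc : ContinuousAt F 0) (hFS : ∀ᶠ z in 𝓝 0, F z ∈ S)
    (hc : ∀ᶠ z in 𝓝 0, ContinuousAt (fun z => τ (F z)) z) :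
    LocalDegree (fun z => τ (F z)) ((SignType.sign A.det : ℤ) * n) := by
  set Ae := A.toContinuousLinearEquivOfDetNeZero hA with hAe
  have hAcoe : ∀ v, Ae v = A v := fun v => rfl
  set c : ℝ := ‖(Ae.symm : Plane →L[ℝ] Plane)‖ + 1 with hcdef
  have hcpos : 0 < c := by positivity
  have hbound : ∀ v, ‖v‖ ≤ c * ‖A v‖ := fun v => by
    have := (Ae.symm : Plane →L[ℝ] Plane).le_opNorm (A v)
    rw [← hAcoe] at this
    simp only [ContinuousLinearEquiv.coe_coe, ContinuousLinearEquiv.symm_apply_apply] at this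
    refine this.trans ?_
    rw [← hAcoe]
    gcongr
    linarith
  -- Since `‖w‖ ≤ c ‖A w‖`, the constant `1 / (2c)` makes the error of the linear approximation at
  -- most `‖A w‖ / 2`, so the quotient by `A w` stays in the unit disc around `1`.
  have hlittle := (hτ.isLittleO.def (c := (2 * c)⁻¹) (by positivity))
  have hS : Tendsto F (𝓝 0) (𝓝[S] (F 0)) := tendsto_nhdsWithin_iff.2 ⟨hFc, hFS⟩
  have hl := (hS.eventually hlittle).and hc
  obtain ⟨r, hr, hb⟩ := Metric.eventually_nhds_iff.1 hl
  filter_upwards [hF, Ioo_mem_nhdsGT hr] with ρ h1 h2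
  have hin : ∀ u, dist (circ ρ u) 0 < r := fun u => by
    rw [dist_zero_right, norm_circ h2.1.le]; exact h2.2
  refine (h1.linear A hA).of_div_mem_slitPlane
    (continuous_displacement fun u => (hb (hin u)).2) fun u => ?_
  have h0 := h1.ne_zero u
  set w := F (circ ρ u) - F 0 with hw
  have hw0 : w ≠ 0 := sub_ne_zero.2 (displacement_ne_zero.1 h0)
  have hAw : A w ≠ 0 := fun h => by
    have := hbound w
    rw [h, norm_zero, mul_zero] at this
    exact hw0 (norm_le_zero_iff.1 this)
  have hpA : planeC (A w) ≠ 0 := by simpa using hAw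
  have he : planeC.symm (displacement F ρ u) = w := by simp [displacement, hw]
  rw [he]
  have hsplit : displacement (fun z => τ (F z)) ρ u / planeC (A w) =
      1 + planeC (τ (F (circ ρ u)) - τ (F 0) - A w) / planeC (A w) := by
    rw [map_sub _ _ (A w), sub_div, div_self hpA, displacement]
    ring
  rw [hsplit]
  apply one_add_mem_slitPlane
  rw [norm_div, planeC.norm_map, planeC.norm_map, div_lt_one (norm_pos_iff.2 hAw)]
  have h3 := (hb (hin u)).1
  rw [← hw] at h3
  have h4 := hbound w
  have h5 : (2 * c)⁻¹ * ‖w‖ ≤ (2 * c)⁻¹ * (c * ‖A w‖) := by gcongr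
  have h6 : (2 * c)⁻¹ * (c * ‖A w‖) = ‖A w‖ / 2 := by field_simp
  have h7 := norm_pos_iff.2 hAw
  linarith

/-- A map that preserves the four open half planes cut out by the axes has local degree `1`. -/
theorem localDegree_one_of_halfPlanes {F : Plane → Plane} (h0 : F 0 = 0)
    (hc : ∀ᶠ z in 𝓝 0, ContinuousAt F z)
    (h : ∀ᶠ z in 𝓝 (0 : Plane), ∀ i, z i ≠ 0 → 0 < F z i * z i) : LocalDegree F 1 := by
  obtain ⟨r, hr, hb⟩ := Metric.eventually_nhds_iff.1 (hc.and h)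
  filter_upwards [localDegree_id, Ioo_mem_nhdsGT hr] with ρ h1 h2
  have hin : ∀ u, dist (circ ρ u) 0 < r := fun u => by
    rw [dist_zero_right, norm_circ h2.1.le]; exact h2.2
  refine h1.of_div_mem_slitPlane (continuous_displacement fun u => (hb (hin u)).1) fun u => ?_
  -- The real part of the quotient is the scalar product of `F z` and `z` divided by `‖z‖²`; the
  -- hypothesis makes it positive.
  left
  set z := circ ρ u with hz
  have hz0 : z ≠ 0 := circ_ne_zero h2.1 u
  have hpos : ∀ i, 0 ≤ F z i * z i := fun i => by
    rcases eq_or_ne (z i) 0 with h' | h'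
    · simp [h']
    · exact ((hb (hin u)).2 i h').le
  have hsum : 0 < F z 0 * z 0 + F z 1 * z 1 := by
    by_cases h' : z 0 = 0
    · have : z 1 ≠ 0 := fun h'' => hz0 (by ext i; fin_cases i <;> simp [h', h''])
      have := (hb (hin u)).2 1 this
      linarith [hpos 0]
    · have := (hb (hin u)).2 0 h'
      linarith [hpos 1]
  have hne : planeC z ≠ 0 := by simpa using hz0
  rw [displacement, displacement, h0, sub_zero, sub_zero, ← hz, Complex.div_re, planeC_re, planeC_re, planeC_im,
    planeC_im, ← add_div]
  exact div_pos hsum (Complex.normSq_pos.2 hne)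

/-! ### Planar curves that cross transversally -/

/-- The linear map that sends the standard basis of the plane to `v`, `w`. -/
noncomputable def frameMap (v w : Plane) : Plane →L[ℝ] Plane :=
  (EuclideanSpace.proj 0 : Plane →L[ℝ] ℝ).smulRight v +
    (EuclideanSpace.proj 1 : Plane →L[ℝ] ℝ).smulRight w

theorem frameMap_apply (v w z : Plane) : frameMap v w z = z 0 • v + z 1 • w := by
  simp [frameMap]

theorem det_frameMap (v w : Plane) : (frameMap v w).det = cross v w := by
  rw [ContinuousLinearMap.det, ← LinearMap.det_toMatrix (EuclideanSpace.basisFun (Fin 2) ℝ).toBasis,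
    Matrix.det_fin_two]
  simp [LinearMap.toMatrix_apply, frameMap_apply, cross]
  ring

/-- The map of the plane that restricts to `a` and `b` on the two coordinate axes. -/
def crossMap (a b : ℝ → Plane) (z : Plane) : Plane := a (z 0) + b (z 1) - a 0

theorem crossMap_single_zero {a b : ℝ → Plane} (h : b 0 = a 0) (t : ℝ) :
    crossMap a b (EuclideanSpace.single 0 t) = a t := by
  simp [crossMap, h]

theorem crossMap_single_one {a b : ℝ → Plane} (t : ℝ) :
    crossMap a b (EuclideanSpace.single 1 t) = b t := by
  simp [crossMap]

theorem crossMap_zero {a b : ℝ → Plane} (h : b 0 = a 0) : crossMap a b 0 = a 0 := by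
  simp [crossMap, h]

theorem hasStrictFDerivAt_crossMap {a b : ℝ → Plane} {v w : Plane} (ha : HasStrictDerivAt a v 0)
    (hb : HasStrictDerivAt b w 0) : HasStrictFDerivAt (crossMap a b) (frameMap v w) 0 := by
  have h0 : HasStrictFDerivAt (fun z : Plane => z 0) (EuclideanSpace.proj 0 : Plane →L[ℝ] ℝ) 0 :=
    (EuclideanSpace.proj 0 : Plane →L[ℝ] ℝ).hasStrictFDerivAt
  have h1 : HasStrictFDerivAt (fun z : Plane => z 1) (EuclideanSpace.proj 1 : Plane →L[ℝ] ℝ) 0 :=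
    (EuclideanSpace.proj 1 : Plane →L[ℝ] ℝ).hasStrictFDerivAt
  have ha' := HasStrictFDerivAt.comp (0 : Plane) (g := a) (f := fun z : Plane => z 0)
    (by simpa using ha.hasStrictFDerivAt) h0
  have hb' := HasStrictFDerivAt.comp (0 : Plane) (g := b) (f := fun z : Plane => z 1)
    (by simpa using hb.hasStrictFDerivAt) h1
  refine ((ha'.add hb').sub_const (a 0)).congr_fderiv ?_
  ext z : 1
  simp [frameMap_apply]

/-- The map `crossMap a b` is a local homeomorphism if the curves `a`, `b` are transversal. -/
theorem exists_openPartialHomeomorph_crossMap {a b : ℝ → Plane} {v w : Plane}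
    (ha : HasStrictDerivAt a v 0) (hb : HasStrictDerivAt b w 0) (h : cross v w ≠ 0) :
    ∃ e : OpenPartialHomeomorph Plane Plane, 0 ∈ e.source ∧ (e : Plane → Plane) = crossMap a b := by
  rw [← det_frameMap] at h
  have hs := hasStrictFDerivAt_crossMap ha hb
  have hs' : HasStrictFDerivAt (crossMap a b)
      (((frameMap v w).toContinuousLinearEquivOfDetNeZero h : Plane ≃L[ℝ] Plane) :
        Plane →L[ℝ] Plane) 0 := hs
  exact ⟨hs'.toOpenPartialHomeomorph _, hs'.mem_toOpenPartialHomeomorph_source, rfl⟩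

/-- The derivative of `crossMap a b` at the origin is the frame `(v, w)`, of determinant `cross v
w`; the degree of the composite is then given by `LocalDegree.comp_hasFDerivWithinAt`. -/
theorem localDegree_crossMap {a b : ℝ → Plane} {v w : Plane}
    (ha : HasStrictDerivAt a v 0) (hb : HasStrictDerivAt b w 0) (h : cross v w ≠ 0)
    {G : Plane → Plane} {n : ℤ} (hG : LocalDegree G n) (h0 : G 0 = 0)
    (hc : ∀ᶠ z in 𝓝 0, ContinuousAt G z) :
    LocalDegree (fun z => crossMap a b (G z)) ((SignType.sign (cross v w) : ℤ) * n) := by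
  obtain ⟨e, he0, he⟩ := exists_openPartialHomeomorph_crossMap ha hb h
  rw [← det_frameMap] at h ⊢
  have hs := (hasStrictFDerivAt_crossMap ha hb).hasFDerivAt.hasFDerivWithinAt (s := univ)
  rw [← h0] at hs
  refine hG.comp_hasFDerivWithinAt hs h hc.self_of_nhds (Eventually.of_forall fun _ => trivial) ?_
  have hmem : ∀ᶠ z in 𝓝 0, G z ∈ e.source :=
    hc.self_of_nhds.eventually_mem (e.open_source.mem_nhds (by rwa [h0]))
  filter_upwards [hc, hmem] with z h1 h2
  have := (e.continuousAt h2).comp h1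
  rwa [he] at this

theorem continuous_single (i : Fin 2) :
    Continuous fun t : ℝ => (EuclideanSpace.single i t : Plane) := by
  have : (fun t : ℝ => (EuclideanSpace.single i t : Plane)) =
      fun t => t • EuclideanSpace.single i (1 : ℝ) := by
    ext t j
    by_cases hj : j = i <;> simp [hj]
  rw [this]
  exact continuous_id.smul continuous_const

/-- An injective map of a neighbourhood of the origin that preserves the two coordinate axes with
their directions has local degree `1`. -/
theorem localDegree_one_of_axes {G : Plane → Plane} (h0 : G 0 = 0)
    (hc : ∀ᶠ z in 𝓝 0, ContinuousAt G z) (hinj : ∃ U ∈ 𝓝 (0 : Plane), InjOn G U)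
    (θ : Fin 2 → ℝ ≃o ℝ) (hθ : ∀ i, θ i 0 = 0)
    (h : ∀ i, ∀ᶠ t in 𝓝 (0 : ℝ),
      G (EuclideanSpace.single i t) = EuclideanSpace.single i (θ i t)) : LocalDegree G 1 := by
  refine localDegree_one_of_halfPlanes h0 hc ?_
  rw [← eventually_all] at h
  obtain ⟨U, hU, hinj⟩ := hinj
  have hax : ∀ᶠ t in 𝓝 (0 : ℝ), ∀ i, (EuclideanSpace.single i t : Plane) ∈ U := by
    rw [eventually_all]
    intro i
    have : Tendsto (fun t : ℝ => (EuclideanSpace.single i t : Plane)) (𝓝 0) (𝓝 0) := by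
      have hcs := continuous_single i
      have h00 : (EuclideanSpace.single i 0 : Plane) = 0 := by ext j; simp
      rw [← h00]
      exact hcs.tendsto 0
    exact this hU
  have hsymm : ∀ i, Tendsto (θ i).symm (𝓝 0) (𝓝 0) := fun i => by
    have := (θ i).symm.continuous.tendsto 0
    rwa [show (θ i).symm 0 = 0 by rw [OrderIso.symm_apply_eq, hθ]] at this
  -- As `θ i` is onto, the point of the `i`-th axis with coordinate `G z i` is itself the image of a
  -- point of that axis near the origin.
  have hval : ∀ i, ∀ᶠ z in 𝓝 (0 : Plane),
      G (EuclideanSpace.single i ((θ i).symm (G z i))) = EuclideanSpace.single i (G z i) ∧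
        (EuclideanSpace.single i ((θ i).symm (G z i)) : Plane) ∈ U := fun i => by
    have ht : Tendsto (fun z => (θ i).symm (G z i)) (𝓝 0) (𝓝 0) := by
      refine (hsymm i).comp ?_
      have : ContinuousAt (fun z => G z i) 0 :=
        (EuclideanSpace.proj i : Plane →L[ℝ] ℝ).continuous.continuousAt.comp hc.self_of_nhds
      simpa [ContinuousAt, h0] using this
    filter_upwards [ht.eventually (h.and hax)] with z hz
    exact ⟨by simpa using hz.1 i, hz.2 i⟩
  rw [← eventually_all] at hval
  obtain ⟨r, hr, hb⟩ := Metric.eventually_nhds_iff_ball.1 (hc.and (hval.and hU))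
  -- If `G z` lies on the axis `j ≠ i`, it is also the image of a point of that axis, so injectivity
  -- puts `z` there. Hence `G` maps no point off an axis into that axis.
  have hne : ∀ z ∈ Metric.ball (0 : Plane) r, ∀ i, z i ≠ 0 → G z i ≠ 0 := by
    intro z hz i hzi hGi
    obtain ⟨-, hv, hzU⟩ := hb z hz
    obtain ⟨j, hj⟩ : ∃ j : Fin 2, j ≠ i := exists_ne i
    have hGz : G z = EuclideanSpace.single j (G z j) := by
      ext l
      by_cases hl : l = j
      · subst hl; simp
      · have : l = i := by omega
        subst this
        simp [hGi, hl]
    have := hinj (hv j).2 hzU ((hv j).1.trans hGz.symm)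
    apply hzi
    rw [← this]
    simp [hj.symm]
  obtain ⟨δ, hδ, hb'⟩ := Metric.eventually_nhds_iff_ball.1 h
  -- Sample points on both sides where the sign of `G z i` is known. Half balls are connected and `G
  -- z i` has no zero there, so the sign is the same throughout.
  have hsmall : ∀ i, ∃ t > 0, (EuclideanSpace.single i t : Plane) ∈ Metric.ball (0 : Plane) r ∧
      (EuclideanSpace.single i (-t) : Plane) ∈ Metric.ball (0 : Plane) r ∧
      0 < G (EuclideanSpace.single i t) i ∧ G (EuclideanSpace.single i (-t)) i < 0 := fun i => by
    have hmin : 0 < min r δ := lt_min hr hδ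
    refine ⟨min r δ / 2, by positivity, ?_, ?_, ?_, ?_⟩
    · simp [abs_of_pos hmin]
      linarith [min_le_left r δ]
    · simp [abs_of_pos hmin]
      linarith [min_le_left r δ]
    · rw [hb' _ (by simp [abs_of_pos hmin]; linarith [min_le_right r δ])]
      have := (θ i).strictMono (show 0 < min r δ / 2 by positivity)
      rw [hθ] at this
      simpa using this
    · rw [hb' _ (by simp [abs_of_pos hmin]; linarith [min_le_right r δ])]
      have := (θ i).strictMono (show -(min r δ / 2) < 0 by linarith)
      rw [hθ] at this
      simpa using this
  have hcont : ∀ i, ContinuousOn (fun z => G z i) (Metric.ball (0 : Plane) r) := fun i z hz =>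
    ((EuclideanSpace.proj i : Plane →L[ℝ] ℝ).continuous.continuousAt.comp
      (hb z hz).1).continuousWithinAt
  filter_upwards [Metric.ball_mem_nhds _ hr] with z hz i hzi
  obtain ⟨t, ht, hb1, hb2, hp, hn⟩ := hsmall i
  have hproj : IsLinearMap ℝ fun z : Plane => z i := ⟨fun _ _ => rfl, fun _ _ => rfl⟩
  rcases hzi.lt_or_gt with hlt | hgt
  · have hconn : IsPreconnected (Metric.ball (0 : Plane) r ∩ {z | z i < 0}) :=
      ((convex_ball _ _).inter (convex_halfSpace_lt hproj 0)).isPreconnected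
    have : G z i < 0 := by
      by_contra! hge
      obtain ⟨y, hy, hy0⟩ := hconn.intermediate_value ⟨hb2, by simp [ht]⟩ ⟨hz, hlt⟩
        ((hcont i).mono inter_subset_left) ⟨hn.le, hge⟩
      exact hne y hy.1 i (ne_of_lt hy.2) hy0
    exact mul_pos_of_neg_of_neg this hlt
  · have hconn : IsPreconnected (Metric.ball (0 : Plane) r ∩ {z | 0 < z i}) :=
      ((convex_ball _ _).inter (convex_halfSpace_gt hproj 0)).isPreconnected
    have : 0 < G z i := by
      by_contra! hge
      obtain ⟨y, hy, hy0⟩ := hconn.intermediate_value ⟨hz, hgt⟩ ⟨hb1, by simp [ht]⟩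
        ((hcont i).mono inter_subset_left) ⟨hge, hp.le⟩
      exact hne y hy.1 i (ne_of_gt hy.2) hy0
    exact mul_pos this hgt

/-! ### Local degrees along an ambient isotopy -/

section Isotopy

variable {M : Type*} [TopologicalSpace M] [ChartedSpace (EuclideanHalfSpace 2) M]
  {h : unitInterval → M ≃ₜ M}

/-- The local degree with respect to a fixed chart is locally constant along an isotopy. -/
theorem eventually_localDegree_iff (hh : IsAmbientIsotopy h) {k : Plane → M} {r : ℝ} (hr : 0 < r)
    (hk : ∀ z, ‖z‖ < r → ContinuousAt k z) (hinj : InjOn k (Metric.ball 0 r)) {x : M}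
    {t₀ : unitInterval} (hx : h t₀ (k 0) ∈ (extChartAt (𝓡∂ 2) x).source) :
    ∀ᶠ t in 𝓝 t₀, ∀ n, LocalDegree (fun z => extChartAt (𝓡∂ 2) x (h t (k z))) n ↔
      LocalDegree (fun z => extChartAt (𝓡∂ 2) x (h t₀ (k z))) n := by
  have hcont : ∀ t z, ‖z‖ < r →
      ContinuousAt (fun q : unitInterval × Plane => h q.1 (k q.2)) (t, z) := fun t z hz =>
    hh.1.continuousAt.comp (continuousAt_fst.prodMk ((hk z hz).comp continuousAt_snd))
  have hmem := (hcont t₀ 0 (by simpa using hr)).eventually_mem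
    ((isOpen_extChartAt_source (I := 𝓡∂ 2) x).mem_nhds hx)
  rw [nhds_prod_eq, eventually_prod_iff] at hmem
  obtain ⟨p, hp, q, hq, hpq⟩ := hmem
  obtain ⟨δ, hδ, hq⟩ := Metric.eventually_nhds_iff_ball.1 hq
  set ε := min δ r with hε
  have hε0 : 0 < ε := lt_min hδ hr
  have hsrc : ∀ t, p t → ∀ z, ‖z‖ < ε → h t (k z) ∈ (extChartAt (𝓡∂ 2) x).source :=
    fun t ht z hz => hpq ht (hq z (by simpa using hz.trans_le (min_le_left _ _)))
  have hF : ∀ t, p t → ∀ z, ‖z‖ < ε →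
      ContinuousAt (fun q : unitInterval × Plane => extChartAt (𝓡∂ 2) x (h q.1 (k q.2))) (t, z) :=
    fun t ht z hz => ContinuousAt.comp
      (f := fun q : unitInterval × Plane => h q.1 (k q.2))
      (continuousAt_extChartAt' (hsrc t ht z hz))
      (hcont t z (hz.trans_le (min_le_right _ _)))
  have hFz : ∀ t, p t → ∀ z, ‖z‖ < ε →
      ContinuousAt (fun z : Plane => extChartAt (𝓡∂ 2) x (h t (k z))) z := fun t ht z hz =>
    ContinuousAt.comp (f := fun z : Plane => (t, z)) (hF t ht z hz)
      (continuousAt_const.prodMk continuousAt_id)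
  have hF0 : ∀ t, p t → ∀ z, ‖z‖ < ε → z ≠ 0 →
      extChartAt (𝓡∂ 2) x (h t (k z)) ≠ extChartAt (𝓡∂ 2) x (h t (k 0)) :=
    fun t ht z hz hz0 heq => by
      have h1 := (extChartAt (𝓡∂ 2) x).injOn (hsrc t ht z hz) (hsrc t ht 0 (by simpa using hε0)) heq
      exact hz0 (hinj (by simpa using hz.trans_le (min_le_right _ _)) (by simpa using hr)
        ((h t).injective h1))
  have hhalf : 0 < ε / 2 := by positivity
  have hlt : ε / 2 < ε := by linarith
  -- One fixed circle of radius `ε / 2` computes the local degree for all `t` near `t₀`, because the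
  -- images of the whole disc stay in the chart and the maps are injective on it.
  have key : ∀ᶠ t in 𝓝 t₀, ∀ n,
      HasDegree (displacement (fun z => extChartAt (𝓡∂ 2) x (h t (k z))) (ε / 2)) n ↔
      HasDegree (displacement (fun z => extChartAt (𝓡∂ 2) x (h t₀ (k z))) (ε / 2)) n := by
    have hnorm : ∀ u, ‖circ (ε / 2) u‖ < ε := fun u => by rwa [norm_circ hhalf.le]
    apply eventually_hasDegree_iff (f := fun t => displacement
      (fun z => extChartAt (𝓡∂ 2) x (h t (k z))) (ε / 2))
    · intro u
      apply planeC.continuous.continuousAt.comp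
      apply ContinuousAt.sub
      · exact ContinuousAt.comp (x := (t₀, u))
          (f := fun q : unitInterval × Circle => (q.1, circ (ε / 2) q.2))
          (g := fun q : unitInterval × Plane => extChartAt (𝓡∂ 2) x (h q.1 (k q.2)))
          (hF t₀ hp.self_of_nhds _ (hnorm u)) (continuous_fst.prodMk
            ((continuous_circ.uncurry_left (ε / 2)).comp continuous_snd)).continuousAt
      · exact ContinuousAt.comp (x := (t₀, u))
          (f := fun q : unitInterval × Circle => (q.1, (0 : Plane)))
          (g := fun q : unitInterval × Plane => extChartAt (𝓡∂ 2) x (h q.1 (k q.2)))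
          (hF t₀ hp.self_of_nhds 0 (by simpa using hε0))
          (continuous_fst.prodMk continuous_const).continuousAt
    · intro u
      rw [displacement_ne_zero]
      exact hF0 t₀ hp.self_of_nhds _ (hnorm u) (circ_ne_zero hhalf u)
    · filter_upwards [hp] with t ht
      exact continuous_displacement fun u => hFz t ht _ (hnorm u)
  filter_upwards [key, hp] with t h1 h2 n
  rw [localDegree_iff (hFz t h2) (hF0 t h2) hhalf hlt,
    localDegree_iff (hFz t₀ hp.self_of_nhds) (hF0 t₀ hp.self_of_nhds) hhalf hlt]
  exact h1 n

variable [IsManifold (𝓡∂ 2) ∞ M]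

theorem det_tangentCoordChange_mul {x y z : M} (hx : z ∈ (extChartAt (𝓡∂ 2) x).source)
    (hy : z ∈ (extChartAt (𝓡∂ 2) y).source) :
    (tangentCoordChange (𝓡∂ 2) x y z).det * (tangentCoordChange (𝓡∂ 2) y x z).det = 1 := by
  have : (tangentCoordChange (𝓡∂ 2) x y z).comp (tangentCoordChange (𝓡∂ 2) y x z) =
      ContinuousLinearMap.id ℝ _ := by
    ext1 v
    rw [ContinuousLinearMap.comp_apply, tangentCoordChange_comp ⟨⟨hy, hx⟩, hy⟩,
      tangentCoordChange_self hy]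
    rfl
  have h2 := congrArg (fun A : Plane →L[ℝ] Plane => LinearMap.det (A : Plane →ₗ[ℝ] Plane)) this
  simpa [ContinuousLinearMap.det, ContinuousLinearMap.coe_comp] using h2

/-- The local degree with respect to two charts. -/
theorem localDegree_change_chart {φ : Plane → M} (hφ : ∀ᶠ z in 𝓝 0, ContinuousAt φ z) {x y : M}
    (hx : φ 0 ∈ (extChartAt (𝓡∂ 2) x).source) (hy : φ 0 ∈ (extChartAt (𝓡∂ 2) y).source) {n : ℤ}
    (h : LocalDegree (fun z => extChartAt (𝓡∂ 2) x (φ z)) n) :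
    LocalDegree (fun z => extChartAt (𝓡∂ 2) y (φ z))
      ((SignType.sign (tangentCoordChange (𝓡∂ 2) x y (φ 0)).det : ℤ) * n) := by
  have hxe : ∀ᶠ z in 𝓝 0, φ z ∈ (extChartAt (𝓡∂ 2) x).source :=
    hφ.self_of_nhds.eventually_mem ((isOpen_extChartAt_source x).mem_nhds hx)
  have hye : ∀ᶠ z in 𝓝 0, φ z ∈ (extChartAt (𝓡∂ 2) y).source :=
    hφ.self_of_nhds.eventually_mem ((isOpen_extChartAt_source y).mem_nhds hy)
  have heq : (fun z => (extChartAt (𝓡∂ 2) y ∘ (extChartAt (𝓡∂ 2) x).symm)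
      (extChartAt (𝓡∂ 2) x (φ z))) =ᶠ[𝓝 0] fun z => extChartAt (𝓡∂ 2) y (φ z) := by
    filter_upwards [hxe] with z hz
    rw [Function.comp_apply, (extChartAt (𝓡∂ 2) x).left_inv hz]
  refine LocalDegree.congr ?_ heq
  -- The transition map is differentiated within the range of the model, as the surface may have
  -- boundary; chart images never leave this range.
  refine h.comp_hasFDerivWithinAt (hasFDerivWithinAt_tangentCoordChange ⟨hx, hy⟩) ?_ ?_ ?_ ?_
  · exact left_ne_zero_of_mul_eq_one (det_tangentCoordChange_mul hx hy)
  · exact (continuousAt_extChartAt' hx).comp hφ.self_of_nhds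
  · filter_upwards [hxe] with z hz
    exact extChartAt_target_subset_range x ((extChartAt (𝓡∂ 2) x).map_source hz)
  · filter_upwards [hφ, hye, heq.eventuallyEq_nhds] with z h1 h2 h3
    exact ((continuousAt_extChartAt' h2).comp h1).congr h3.symm

theorem sign_eq_of_mul_pos {s s' : ℤˣ} {d : ℝ} (h : 0 < ((s : ℤ) : ℝ) * ((s' : ℤ) : ℝ) * d) :
    (SignType.sign d : ℤ) = s * s' := by
  rcases Int.units_eq_one_or s with rfl | rfl <;> rcases Int.units_eq_one_or s' with rfl | rfl <;>
    simp at h ⊢ <;> simp [h]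

/-- Along an isotopy, the local degree with respect to the orientation does not change. -/
theorem localDegree_isotopy (o : SurfaceOrientation M) (hh : IsAmbientIsotopy h) {k : Plane → M}
    (hk : ∀ᶠ z in 𝓝 0, ContinuousAt k z) (hinj : ∃ U ∈ 𝓝 (0 : Plane), InjOn k U) {n : ℤ}
    (hn : LocalDegree (fun z => extChartAt (𝓡∂ 2) (k 0) (k z)) n) :
    LocalDegree (fun z => extChartAt (𝓡∂ 2) (h 1 (k 0)) (h 1 (k z)))
      (n * o.sign (k 0) * o.sign (h 1 (k 0))) := by
  obtain ⟨U, hU, hinj⟩ := hinj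
  obtain ⟨r, hr, hb⟩ := Metric.eventually_nhds_iff_ball.1 (hk.and hU)
  have hk' : ∀ z, ‖z‖ < r → ContinuousAt k z := fun z hz => (hb z (by simpa using hz)).1
  have hinj' : InjOn k (Metric.ball 0 r) := hinj.mono fun z hz => (hb z hz).2
  set c : unitInterval → M := fun t => h t (k 0) with hc
  have hcc : Continuous c := hh.1.comp (continuous_id.prodMk continuous_const)
  have hφ : ∀ t, ∀ᶠ z in 𝓝 0, ContinuousAt (fun z => h t (k z)) z := fun t =>
    hk.mono fun z hz => (h t).continuous.continuousAt.comp hz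
  -- The preferred chart at `c t` may jump with `t`. Passing to the fixed chart at `c t₀` multiplies
  -- the degree by the sign of a transition determinant, which by `o.compatible` is exactly `o.sign
  -- (c t) * o.sign (c t₀)`.
  have hloc : IsLocallyConstant fun t => LocalDegree
      (fun z => extChartAt (𝓡∂ 2) (c t) (h t (k z))) (n * o.sign (k 0) * o.sign (c t)) := by
    rw [IsLocallyConstant.iff_eventually_eq]
    intro t₀
    filter_upwards [eventually_localDegree_iff hh hr hk' hinj' (x := c t₀)
      (mem_extChartAt_source (I := 𝓡∂ 2) (c t₀)), hcc.continuousAt.eventually (o.compatible (c t₀)),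
      hcc.continuousAt.eventually_mem ((isOpen_extChartAt_source (I := 𝓡∂ 2) (c t₀)).mem_nhds
        (mem_extChartAt_source (c t₀)))] with t h1 h2 h3
    have hs := sign_eq_of_mul_pos h2
    have hd := det_tangentCoordChange_mul h3 (mem_extChartAt_source (I := 𝓡∂ 2) (c t))
    have hs' : (SignType.sign (tangentCoordChange (𝓡∂ 2) (c t₀) (c t) (c t)).det : ℤ) =
        o.sign (c t) * o.sign (c t₀) := by
      apply sign_eq_of_mul_pos
      have : 0 < (tangentCoordChange (𝓡∂ 2) (c t) (c t₀) (c t)).det ^ 2 := by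
        have : (tangentCoordChange (𝓡∂ 2) (c t) (c t₀) (c t)).det ≠ 0 :=
          right_ne_zero_of_mul_eq_one hd
        positivity
      rw [← mul_pos_iff_of_pos_right this]
      calc _ < _ := h2
        _ = _ := by
          linear_combination (-(((o.sign (c t) : ℤ) : ℝ) * ((o.sign (c t₀) : ℤ) : ℝ) *
            (tangentCoordChange (𝓡∂ 2) (c t) (c t₀) (c t)).det)) * hd
    have hsq : ∀ s : ℤˣ, (s : ℤ) * s = 1 := fun s => by
      rcases Int.units_eq_one_or s with rfl | rfl <;> simp
    refine propext ⟨fun hS => ?_, fun hS => ?_⟩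
    · have := localDegree_change_chart (hφ t) (mem_extChartAt_source (I := 𝓡∂ 2) (c t)) h3 hS
      rw [hs] at this
      rw [h1] at this
      convert this using 1
      linear_combination (-(n * o.sign (k 0) * o.sign (c t₀)) : ℤ) * hsq (o.sign (c t))
    · rw [← h1] at hS
      have := localDegree_change_chart (hφ t) h3 (mem_extChartAt_source (I := 𝓡∂ 2) (c t)) hS
      rw [hs'] at this
      convert this using 1
      linear_combination (-(n * o.sign (k 0) * o.sign (c t)) : ℤ) * hsq (o.sign (c t₀))
  have h01 := hloc.apply_eq_of_isPreconnected isPreconnected_univ (x := 0) (y := 1) trivial trivial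
  rw [← h01]
  have : (n * o.sign (k 0) * o.sign (k 0) : ℤ) = n := by
    rcases Int.units_eq_one_or (o.sign (k 0)) with h | h <;> simp [h]
  simpa [hc, hh.2, this] using hn

end Isotopy

/-! ### Lifts of orientation preserving homeomorphisms of the circle -/

theorem coe_eq_coe_iff {s t : ℝ} : (s : UnitAddCircle) = t ↔ ∃ n : ℤ, t - s = n := by
  rw [eq_comm, ← sub_eq_zero, ← AddCircle.coe_sub, AddCircle.coe_eq_zero_iff]
  simp [eq_comm]

theorem coe_add_one (s : ℝ) : ((s + 1 : ℝ) : UnitAddCircle) = s :=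
  AddCircle.coe_add_period 1 s

/-- The restriction of an orientation preserving homeomorphism near a point, in real parameters. -/
theorem OrientationPreserving.exists_lift_at {f : UnitAddCircle ≃ₜ UnitAddCircle}
    (hf : OrientationPreserving f) (x : UnitAddCircle) :
    ∃ θ : ℝ ≃o ℝ, θ 0 = 0 ∧ ∀ s : ℝ, f (x + (s : UnitAddCircle)) = f x + (θ s : UnitAddCircle) := by
  obtain ⟨F, hF⟩ := hf
  refine ⟨((OrderIso.addLeft (frac x)).trans F).trans (OrderIso.addRight (-F (frac x))), by simp,
    fun s => ?_⟩
  conv_lhs => rw [← coe_frac x]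
  conv_rhs => rw [← coe_frac x]
  rw [← AddCircle.coe_add, hF, hF, ← AddCircle.coe_add]
  simp

/-! ### Isotopy invariance of the sign of a crossing -/

section Crossing

variable {M : Type*} [TopologicalSpace M] [ChartedSpace (EuclideanHalfSpace 2) M]

theorem chartCurve_zero (γ : UnitAddCircle → M) (x : UnitAddCircle) :
    chartCurve γ x 0 = extChartAt (𝓡∂ 2) (γ x) (γ x) := by
  simp [chartCurve, curve]

theorem extChartAt_target_mem_nhds_of_interior {p : M} (hp : (𝓡∂ 2).IsInteriorPoint p) :
    (extChartAt (𝓡∂ 2) p).target ∈ 𝓝 (extChartAt (𝓡∂ 2) p p) := by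
  have h1 := extChartAt_target_mem_nhdsWithin (I := 𝓡∂ 2) p
  rwa [nhdsWithin_eq_nhds.2] at h1
  exact mem_interior_iff_mem_nhds.1 hp

variable [IsManifold (𝓡∂ 2) ∞ M]

theorem hasStrictDerivAt_chartCurve {γ : UnitAddCircle → M} {x : UnitAddCircle}
    (h : ContMDiffAt 𝓘(ℝ, ℝ) (𝓡∂ 2) ∞ (curve γ x) 0) :
    HasStrictDerivAt (chartCurve γ x) (velocity γ x) 0 := by
  have h1 : ContMDiffAt (𝓡∂ 2) 𝓘(ℝ, Plane) ∞ (extChartAt (𝓡∂ 2) (γ x)) (curve γ x 0) := by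
    apply contMDiffAt_extChartAt' (by simp [curve])
  have h2 : ContMDiffAt 𝓘(ℝ, ℝ) 𝓘(ℝ, Plane) ∞ (chartCurve γ x) 0 := h1.comp 0 h
  exact h2.contDiffAt.hasStrictDerivAt (by simp)

variable {α β : UnitAddCircle → M}

/-- The sign of a transversal crossing does not change under isotopy. -/
theorem sign_cross_isotopy (o : SurfaceOrientation M) (hα : IsGenericLoop α) (hβ : IsGenericLoop β)
    {h : unitInterval → M ≃ₜ M} (hh : IsAmbientIsotopy h) {f : UnitAddCircle ≃ₜ UnitAddCircle}
    (hf : OrientationPreserving f) (H : ∀ x, β x = h 1 (α (f x))) {x y : UnitAddCircle}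
    (hxy : x ≠ y) (hβxy : β x = β y) :
    (SignType.sign (cross (velocity β x) (velocity β y)) : ℤ) =
      SignType.sign (cross (velocity α (f x)) (velocity α (f y))) * o.sign (α (f x)) *
        o.sign (β x) := by
  have hαxy : α (f x) = α (f y) := (h 1).injective (by rw [← H, ← H, hβxy])
  have hfxy : f x ≠ f y := f.injective.ne hxy
  set p := α (f x) with hp
  have hq : h 1 p = β x := (H x).symm
  set a := chartCurve α (f x) with ha
  set b := chartCurve α (f y) with hb
  set a' := chartCurve β x with ha'
  set b' := chartCurve β y with hb'
  have hba : b 0 = a 0 := by rw [ha, hb, chartCurve_zero, chartCurve_zero, ← hαxy]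
  have hba' : b' 0 = a' 0 := by rw [ha', hb', chartCurve_zero, chartCurve_zero, hβxy]
  have ha0 : a 0 = extChartAt (𝓡∂ 2) p p := chartCurve_zero _ _
  have ha0' : a' 0 = extChartAt (𝓡∂ 2) (β x) (β x) := chartCurve_zero _ _
  have hda := hasStrictDerivAt_chartCurve (hα.smooth_crossing _ _ hfxy hαxy)
  have hdb := hasStrictDerivAt_chartCurve (hα.smooth_crossing _ _ hfxy.symm hαxy.symm)
  have hda' := hasStrictDerivAt_chartCurve (hβ.smooth_crossing _ _ hxy hβxy)
  have hdb' := hasStrictDerivAt_chartCurve (hβ.smooth_crossing _ _ hxy.symm hβxy.symm)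
  have hv := hα.transversal _ _ hfxy hαxy
  have hv' := hβ.transversal _ _ hxy hβxy
  rw [← ha] at hda
  rw [← hb] at hdb
  rw [← ha'] at hda'
  rw [← hb'] at hdb'
  obtain ⟨e, he0, he⟩ := exists_openPartialHomeomorph_crossMap hda hdb hv
  obtain ⟨e', he0', he'⟩ := exists_openPartialHomeomorph_crossMap hda' hdb' hv'
  -- a parametrization of a neighbourhood of the crossing
  set k : Plane → M := fun z => (extChartAt (𝓡∂ 2) p).symm (crossMap a b z) with hkdef
  have hk0 : k 0 = p := by
    rw [hkdef]; dsimp only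
    rw [crossMap_zero hba, ha0, extChartAt_to_inv]
  have hcm : ∀ᶠ z in 𝓝 0, ContinuousAt (crossMap a b) z := by
    filter_upwards [e.open_source.mem_nhds he0] with z hz
    rw [← he]; exact e.continuousAt hz
  have htarget : ∀ᶠ w in 𝓝 (crossMap a b 0), w ∈ interior (extChartAt (𝓡∂ 2) p).target := by
    rw [crossMap_zero hba, ha0]
    exact isOpen_interior.mem_nhds (mem_interior_iff_mem_nhds.2
      (extChartAt_target_mem_nhds_of_interior (hα.interior _)))
  have hint : ∀ᶠ z in 𝓝 0, crossMap a b z ∈ interior (extChartAt (𝓡∂ 2) p).target :=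
    hcm.self_of_nhds.eventually htarget
  have hkc : ∀ᶠ z in 𝓝 0, ContinuousAt k z := by
    filter_upwards [hcm, hint] with z h1 h2
    exact ContinuousAt.comp ((continuousOn_extChartAt_symm p).continuousAt
      (mem_interior_iff_mem_nhds.1 h2)) h1
  have hkinj : ∃ U ∈ 𝓝 (0 : Plane), InjOn k U := by
    refine ⟨_, inter_mem (e.open_source.mem_nhds he0) hint, fun z hz w hw hzw => ?_⟩
    have := (extChartAt (𝓡∂ 2) p).symm.injOn (interior_subset hz.2) (interior_subset hw.2) hzw
    rw [← he] at this
    exact e.injOn hz.1 hw.1 this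
  have hdeg0 : LocalDegree (fun z => extChartAt (𝓡∂ 2) (k 0) (k z))
      (SignType.sign (cross (velocity α (f x)) (velocity α (f y))) : ℤ) := by
    have := localDegree_crossMap hda hdb hv localDegree_id rfl
      (Eventually.of_forall fun _ => continuousAt_id)
    rw [mul_one] at this
    refine this.congr ?_
    filter_upwards [hint] with z hz
    rw [hk0, hkdef]
    exact ((extChartAt (𝓡∂ 2) p).right_inv (interior_subset hz)).symm
  have hdeg1 := localDegree_isotopy o hh hkc hkinj hdeg0
  rw [hk0, hq] at hdeg1
  -- the image of the parametrization, compared with the crossing of `β`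
  set F : Plane → Plane := fun z => extChartAt (𝓡∂ 2) (β x) (h 1 (k z)) with hF
  have hF0 : F 0 = a' 0 := by rw [hF]; dsimp only; rw [hk0, hq, ha0']
  have hsrc : ∀ᶠ z in 𝓝 0, h 1 (k z) ∈ (extChartAt (𝓡∂ 2) (β x)).source := by
    have : ContinuousAt (fun z => h 1 (k z)) 0 :=
      (h 1).continuous.continuousAt.comp hkc.self_of_nhds
    refine this.eventually_mem ((isOpen_extChartAt_source _).mem_nhds ?_)
    rw [hk0, hq]; exact mem_extChartAt_source _
  have hFc : ∀ᶠ z in 𝓝 0, ContinuousAt F z := by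
    filter_upwards [hkc, hsrc] with z h1 h2
    exact ContinuousAt.comp (f := fun z => h 1 (k z)) (continuousAt_extChartAt' h2)
      ((h 1).continuous.continuousAt.comp h1)
  have hFt : ∀ᶠ z in 𝓝 0, F z ∈ e'.target := by
    refine hFc.self_of_nhds.eventually_mem (e'.open_target.mem_nhds ?_)
    rw [hF0, ← crossMap_zero hba', ← he']
    exact e'.map_source he0'
  -- `G` compares the transported parametrization with the one given by the branches of `β`. It maps
  -- each axis to itself, since the isotopy maps the branches of `α` to those of `β`.
  set G : Plane → Plane := fun z => e'.symm (F z) with hG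
  have hG0 : G 0 = 0 := by
    rw [hG]; dsimp only
    rw [hF0, ← crossMap_zero hba', ← he', e'.left_inv he0']
  have hGc : ∀ᶠ z in 𝓝 0, ContinuousAt G z := by
    filter_upwards [hFc, hFt] with z h1 h2
    exact ContinuousAt.comp (e'.symm.continuousAt h2) h1
  have hFG : (fun z => crossMap a' b' (G z)) =ᶠ[𝓝 0] F := by
    filter_upwards [hFt] with z hz
    rw [← he']
    exact e'.right_inv hz
  have hGinj : ∃ U ∈ 𝓝 (0 : Plane), InjOn G U := by
    obtain ⟨U, hU, hi⟩ := hkinj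
    refine ⟨_, inter_mem hU (inter_mem hFt hsrc), fun z hz w hw hzw => ?_⟩
    have h1 := e'.symm.injOn hz.2.1 hw.2.1 hzw
    have h2 := (extChartAt (𝓡∂ 2) (β x)).injOn hz.2.2 hw.2.2 h1
    exact hi hz.1 hw.1 ((h 1).injective h2)
  obtain ⟨θ, hθ0, hθ⟩ := hf.exists_lift_at x
  obtain ⟨η, hη0, hη⟩ := hf.exists_lift_at y
  have hθs : θ.symm 0 = 0 := by rw [OrderIso.symm_apply_eq, hθ0]
  have hηs : η.symm 0 = 0 := by rw [OrderIso.symm_apply_eq, hη0]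
  -- Along one branch, `β (z + s) = h 1 (α (f z + ζ s))`; reading this at `t = ζ s` shows that the
  -- axis is reparametrized by the increasing map `ζ.symm`.
  have hcurve : ∀ (z : UnitAddCircle) (ζ : ℝ ≃o ℝ), ζ 0 = 0 → α (f z) = p →
      ContMDiffAt 𝓘(ℝ, ℝ) (𝓡∂ 2) ∞ (curve α (f z)) 0 →
      (∀ s : ℝ, f (z + (s : UnitAddCircle)) = f z + (ζ s : UnitAddCircle)) →
      ∀ᶠ t in 𝓝 (0 : ℝ), extChartAt (𝓡∂ 2) (β x)
        (h 1 ((extChartAt (𝓡∂ 2) p).symm (chartCurve α (f z) t))) =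
          chartCurve β z (ζ.symm t) := by
    intro z ζ hζ0 hz hzx hζ
    have hβz : β z = β x := by rw [H, H, hz, ← hp]
    have hmem : ∀ᶠ t in 𝓝 (0 : ℝ), curve α (f z) t ∈ (extChartAt (𝓡∂ 2) p).source := by
      refine hzx.continuousAt.eventually_mem ((isOpen_extChartAt_source _).mem_nhds ?_)
      simp only [curve, AddCircle.coe_zero, add_zero, hz]
      exact mem_extChartAt_source _
    filter_upwards [hmem] with t ht
    rw [chartCurve, chartCurve, hz, (extChartAt (𝓡∂ 2) p).left_inv ht, hβz, curve, curve,
      H (z + _), hζ, OrderIso.apply_symm_apply]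
  set Θ : Fin 2 → ℝ ≃o ℝ := ![θ.symm, η.symm] with hΘ
  have hdegG : LocalDegree G 1 := by
    refine localDegree_one_of_axes hG0 hGc hGinj Θ ?_ ?_
    · intro i; fin_cases i
      · exact hθs
      · exact hηs
    · have hsingle : ∀ (i : Fin 2) (ζ : ℝ ≃o ℝ), ζ 0 = 0 →
          ∀ᶠ t in 𝓝 (0 : ℝ), (EuclideanSpace.single i (ζ t) : Plane) ∈ e'.source := by
        intro i ζ hζ
        have hc := (continuous_single i).comp ζ.continuous
        refine hc.continuousAt.eventually_mem (e'.open_source.mem_nhds ?_)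
        have h00 : (EuclideanSpace.single i 0 : Plane) = 0 := by ext j; simp
        rw [Function.comp_apply, hζ, h00]
        exact he0'
      intro i; fin_cases i
      · filter_upwards [hcurve x θ hθ0 rfl (hα.smooth_crossing _ _ hfxy hαxy) hθ, hsingle 0 θ.symm hθs] with t ht hs
        change e'.symm (extChartAt (𝓡∂ 2) (β x) (h 1 ((extChartAt (𝓡∂ 2) p).symm
          (crossMap a b (EuclideanSpace.single 0 t))))) = EuclideanSpace.single 0 (θ.symm t)
        rw [crossMap_single_zero hba, ha, ht, ← ha', ← crossMap_single_zero hba', ← he',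
          e'.left_inv hs]
      · filter_upwards [hcurve y η hη0 hαxy.symm
          (hα.smooth_crossing _ _ hfxy.symm hαxy.symm) hη, hsingle 1 η.symm hηs] with t ht hs
        change e'.symm (extChartAt (𝓡∂ 2) (β x) (h 1 ((extChartAt (𝓡∂ 2) p).symm
          (crossMap a b (EuclideanSpace.single 1 t))))) = EuclideanSpace.single 1 (η.symm t)
        rw [crossMap_single_one, hb, ht, ← hb', ← crossMap_single_one (a := a') (b := b'), ← he',
          e'.left_inv hs]
  -- The degree of `F` is now known twice: through `G` it is the sign of the crossing of `β`, and
  -- along the isotopy it is that of `α`, corrected by the orientation.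
  have hdegF := (localDegree_crossMap hda' hdb' hv' hdegG hG0 hGc).congr hFG
  rw [mul_one] at hdegF
  exact hdegF.unique hdeg1

end Crossing

/-! ### Finiteness of the set of self-crossings -/

theorem nhds_eq_map_add (x : UnitAddCircle) :
    𝓝 x = map (fun s : ℝ => x + (s : UnitAddCircle)) (𝓝 0) := by
  have h1 : map (fun s : ℝ => (s : UnitAddCircle)) (𝓝 0) = 𝓝 (0 : UnitAddCircle) := by
    have h := (QuotientAddGroup.isOpenMap_coe (N := AddSubgroup.zmultiples (1 : ℝ))).nhds_le 0
    exact le_antisymm ((AddCircle.continuous_mk' (1 : ℝ)).tendsto' 0 0 (by simp)) h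
  rw [show (fun s : ℝ => x + (s : UnitAddCircle)) = (fun u => x + u) ∘ fun s : ℝ => (s : UnitAddCircle)
    from rfl, ← map_map, h1, map_add_left_nhds_zero]

/-- The one-sided derivative is continuous up to the endpoint, so it stays positive on a short
interval. -/
theorem strictMonoOn_of_derivWithin_pos_right {c : ℝ → ℝ} {ε : ℝ} (hε : 0 < ε)
    (hc : ContDiffOn ℝ ∞ c (Icc 0 ε)) (h : 0 < derivWithin c (Ici 0) 0) :
    ∃ δ > 0, StrictMonoOn c (Icc 0 δ) := by
  have hd := hc.continuousOn_derivWithin (uniqueDiffOn_Icc hε) (by simp)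
  have h0 : derivWithin c (Icc 0 ε) 0 = derivWithin c (Ici 0) 0 := by
    apply derivWithin_congr_set
    have : Iio ε ∈ 𝓝 (0 : ℝ) := Iio_mem_nhds hε
    filter_upwards [this] with s (hs : s < ε)
    exact propext ⟨fun h => h.1, fun h => ⟨h, hs.le⟩⟩
  have hpos : ∀ᶠ s in 𝓝[Icc 0 ε] 0, 0 < derivWithin c (Icc 0 ε) s :=
    (hd 0 ⟨le_rfl, hε.le⟩).eventually (by rw [h0]; exact lt_mem_nhds h)
  rw [nhdsWithin_Icc_eq_nhdsGE hε] at hpos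
  obtain ⟨δ, hδ, hsub⟩ := mem_nhdsGE_iff_exists_Icc_subset.1 hpos
  have hδ : 0 < δ := hδ
  refine ⟨min δ ε, lt_min hδ hε, ?_⟩
  apply strictMonoOn_of_deriv_pos (convex_Icc _ _)
  · exact hc.continuousOn.mono (Icc_subset_Icc_right (min_le_right _ _))
  · intro s hs
    rw [interior_Icc] at hs
    have hsε : s ∈ Ioo 0 ε := ⟨hs.1, hs.2.trans_le (min_le_right _ _)⟩
    have := hsub (show s ∈ Icc 0 δ from ⟨hs.1.le, (hs.2.trans_le (min_le_left _ _)).le⟩)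
    rw [Set.mem_ofPred_eq, derivWithin_of_mem_nhds (Icc_mem_nhds hsε.1 hsε.2)] at this
    exact this

theorem strictMonoOn_of_derivWithin_pos_left {c : ℝ → ℝ} {ε : ℝ} (hε : 0 < ε)
    (hc : ContDiffOn ℝ ∞ c (Icc (-ε) 0)) (h : 0 < derivWithin c (Iic 0) 0) :
    ∃ δ > 0, StrictMonoOn c (Icc (-δ) 0) := by
  have hc' : ContDiffOn ℝ ∞ (fun s => -c (-s)) (Icc 0 ε) := by
    refine (hc.comp contDiff_neg.contDiffOn fun s hs => ?_).neg
    exact ⟨by linarith [hs.2], by linarith [hs.1]⟩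
  have hd : derivWithin (fun s => -c (-s)) (Ici 0) 0 = derivWithin c (Iic 0) 0 := by
    rw [derivWithin.fun_neg, derivWithin_comp_neg]
    simp
  obtain ⟨δ, hδ, hm⟩ := strictMonoOn_of_derivWithin_pos_right hε hc' (by rwa [hd])
  refine ⟨δ, hδ, fun s hs t ht hst => ?_⟩
  have := hm (a := -t) ⟨by linarith [ht.2], by linarith [ht.1]⟩ (b := -s)
    ⟨by linarith [hs.2], by linarith [hs.1]⟩ (by linarith)
  simp only [neg_neg] at this
  linarith

/-- The vector `‖w‖ v + ‖v‖ w` bisects the angle between `v` and `w`. As they are not opposite,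
Cauchy–Schwarz for `v` and `-w` is strict, and the bisector makes an acute angle with both. -/
theorem inner_add_pos_of_not_sameRay {v w : Plane} (hv : v ≠ 0) (hw : w ≠ 0)
    (h : ¬ SameRay ℝ v (-w)) :
    0 < inner ℝ (‖w‖ • v + ‖v‖ • w) v ∧ 0 < inner ℝ (‖w‖ • v + ‖v‖ • w) w := by
  have hv' := norm_pos_iff.2 hv
  have hw' := norm_pos_iff.2 hw
  have hlt : inner ℝ v (-w) < ‖v‖ * ‖-w‖ := by
    refine lt_of_le_of_ne (real_inner_le_norm _ _) fun heq => h ?_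
    rw [inner_eq_norm_mul_iff_real] at heq
    rw [sameRay_iff_norm_smul_eq]
    exact heq.symm
  rw [inner_neg_right, norm_neg] at hlt
  constructor
  · rw [inner_add_left, real_inner_smul_left, real_inner_smul_left, real_inner_self_eq_norm_sq,
      real_inner_comm]
    nlinarith
  · rw [inner_add_left, real_inner_smul_left, real_inner_smul_left, real_inner_self_eq_norm_sq]
    nlinarith

section Finite

variable {M : Type*} [TopologicalSpace M] [ChartedSpace (EuclideanHalfSpace 2) M]
variable {γ : UnitAddCircle → M}

theorem IsGenericLoop.continuous (hγ : IsGenericLoop γ) : Continuous γ := by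
  rw [continuous_iff_continuousAt]
  intro x
  have : ContinuousAt (curve γ x) 0 := by
    rw [continuousAt_iff_continuous_left_right]
    obtain ⟨ε, hε, h⟩ := hγ.smooth_right x
    obtain ⟨δ, hδ, h'⟩ := hγ.smooth_left x
    refine ⟨?_, ?_⟩
    · have := h'.continuousOn 0 ⟨by linarith, le_rfl⟩
      rwa [ContinuousWithinAt, nhdsWithin_Icc_eq_nhdsLE (by linarith)] at this
    · have := h.continuousOn 0 ⟨le_rfl, hε.le⟩
      rwa [ContinuousWithinAt, nhdsWithin_Icc_eq_nhdsGE hε] at this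
  rw [ContinuousAt, nhds_eq_map_add x, tendsto_map'_iff]
  rwa [ContinuousAt, show curve γ x 0 = γ x by simp [curve]] at this

theorem IsGenericLoop.continuous_curve (hγ : IsGenericLoop γ) (x : UnitAddCircle) :
    Continuous (curve γ x) :=
  hγ.continuous.comp (continuous_const.add (AddCircle.continuous_mk' 1))

theorem IsGenericLoop.eventually_mem_source (hγ : IsGenericLoop γ) (x : UnitAddCircle) :
    ∀ᶠ s in 𝓝 (0 : ℝ), curve γ x s ∈ (extChartAt (𝓡∂ 2) (γ x)).source :=
  (hγ.continuous_curve x).continuousAt.eventually_mem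
    ((isOpen_extChartAt_source _).mem_nhds (by simp [curve]))

variable [IsManifold (𝓡∂ 2) ∞ M]

theorem contDiffOn_chartCurve {x : UnitAddCircle} {s : Set ℝ}
    (h : ContMDiffOn 𝓘(ℝ, ℝ) (𝓡∂ 2) ∞ (curve γ x) s)
    (hs : ∀ t ∈ s, curve γ x t ∈ (extChartAt (𝓡∂ 2) (γ x)).source) :
    ContDiffOn ℝ ∞ (chartCurve γ x) s := by
  rw [← contMDiffOn_iff_contDiffOn]
  intro t ht
  have h1 : ContMDiffAt (𝓡∂ 2) 𝓘(ℝ, Plane) ∞ (extChartAt (𝓡∂ 2) (γ x)) (curve γ x t) :=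
    contMDiffAt_extChartAt' (by simpa using hs t ht)
  exact h1.comp_contMDiffWithinAt t (h t ht)

/-- A generic loop is locally injective. -/
theorem IsGenericLoop.exists_injOn (hγ : IsGenericLoop γ) (x : UnitAddCircle) :
    ∃ U ∈ 𝓝 x, InjOn γ U := by
  obtain ⟨hL, hR⟩ := inner_add_pos_of_not_sameRay (hγ.velocityLeft_ne x) (hγ.velocityRight_ne x)
    (hγ.not_cusp x)
  -- The height in the bisecting direction `n` has positive derivative on both sides of the possible
  -- corner. It is therefore strictly increasing across it, which forces injectivity.
  set n := ‖velocityRight γ x‖ • velocityLeft γ x + ‖velocityLeft γ x‖ • velocityRight γ x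
  obtain ⟨ρ, hρ, hmem⟩ := Metric.eventually_nhds_iff_ball.1 (hγ.eventually_mem_source x)
  obtain ⟨ε, hε, hr⟩ := hγ.smooth_right x
  obtain ⟨δ, hδ, hl⟩ := hγ.smooth_left x
  have hε' : 0 < min ε (ρ / 2) := by positivity
  have hδ' : 0 < min δ (ρ / 2) := by positivity
  have hcr := contDiffOn_chartCurve (s := Icc 0 (min ε (ρ / 2)))
    (hr.mono (Icc_subset_Icc_right (min_le_left _ _)))
    fun t ht => hmem t (by
      rw [mem_ball_zero_iff, Real.norm_eq_abs, abs_lt]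
      constructor <;> linarith [ht.1, ht.2.trans (min_le_right _ _)])
  have hcl := contDiffOn_chartCurve (s := Icc (-(min δ (ρ / 2))) 0)
    (hl.mono (Icc_subset_Icc_left (neg_le_neg (min_le_left _ _))))
    fun t ht => hmem t (by
      rw [mem_ball_zero_iff, Real.norm_eq_abs, abs_lt]
      constructor <;> linarith [ht.2, neg_le.1 (ht.1), min_le_right δ (ρ / 2)])
  have hdr := (hcr.differentiableOn (by simp) 0 ⟨le_rfl, hε'.le⟩).mono_of_mem_nhdsWithin
    (t := Ici 0) (Icc_mem_nhdsGE hε')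
  have hdl := (hcl.differentiableOn (by simp) 0 ⟨by linarith, le_rfl⟩).mono_of_mem_nhdsWithin
    (t := Iic 0) (Icc_mem_nhdsLE (neg_lt_zero.2 hδ'))
  have hir : HasDerivWithinAt (fun s => inner ℝ n (chartCurve γ x s))
      (inner ℝ n (velocityRight γ x)) (Ici 0) 0 :=
    (innerSL ℝ n).hasFDerivAt.comp_hasDerivWithinAt (0 : ℝ) hdr.hasDerivWithinAt
  have hil : HasDerivWithinAt (fun s => inner ℝ n (chartCurve γ x s))
      (inner ℝ n (velocityLeft γ x)) (Iic 0) 0 :=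
    (innerSL ℝ n).hasFDerivAt.comp_hasDerivWithinAt (0 : ℝ) hdl.hasDerivWithinAt
  obtain ⟨r₁, hr₁, hm₁⟩ := strictMonoOn_of_derivWithin_pos_right hε'
    ((innerSL ℝ n).contDiff.comp_contDiffOn hcr)
    (by
      have := hir.derivWithin (uniqueDiffWithinAt_Ici 0)
      simp only [Function.comp_def, innerSL_apply_apply]
      rw [this]; exact hR)
  obtain ⟨r₂, hr₂, hm₂⟩ := strictMonoOn_of_derivWithin_pos_left hδ'
    ((innerSL ℝ n).contDiff.comp_contDiffOn hcl)
    (by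
      have := hil.derivWithin (uniqueDiffWithinAt_Iic 0)
      simp only [Function.comp_def, innerSL_apply_apply]
      rw [this]; exact hL)
  have hm := hm₂.union hm₁ (isGreatest_Icc (by linarith)) (isLeast_Icc hr₁.le)
  rw [Icc_union_Icc_eq_Icc (by linarith) hr₁.le] at hm
  refine ⟨(fun s : ℝ => x + (s : UnitAddCircle)) '' Icc (-r₂) r₁, ?_, ?_⟩
  · rw [nhds_eq_map_add]
    exact image_mem_map (Icc_mem_nhds (by linarith) hr₁)
  · rintro _ ⟨s, hs, rfl⟩ _ ⟨t, ht, rfl⟩ hst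
    have : s = t := hm.injOn hs ht (by
      simp only [Function.comp_def, chartCurve, curve]
      rw [hst])
    rw [this]

/-- The pairs of distinct parameters with the same image form a finite set. -/
theorem IsGenericLoop.finite_pairs [T2Space M] (hγ : IsGenericLoop γ) :
    {q : UnitAddCircle × UnitAddCircle | q.1 ≠ q.2 ∧ γ q.1 = γ q.2}.Finite := by
  by_contra hinf
  obtain ⟨⟨x, y⟩, -, hacc⟩ := Set.Infinite.exists_accPt_of_subset_isCompact hinf isCompact_univ
    (subset_univ _)
  rw [accPt_iff_frequently] at hacc
  refine hacc ?_
  by_cases hxy : x = y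
  · subst hxy
    obtain ⟨U, hU, hi⟩ := hγ.exists_injOn x
    filter_upwards [prod_mem_nhds hU hU] with q hq h
    exact h.2.1 (hi hq.1 hq.2 h.2.2)
  by_cases hγxy : γ x = γ y
  · have hda := hasStrictDerivAt_chartCurve (hγ.smooth_crossing _ _ hxy hγxy)
    have hdb := hasStrictDerivAt_chartCurve (hγ.smooth_crossing _ _ (Ne.symm hxy) hγxy.symm)
    have hv := hγ.transversal _ _ hxy hγxy
    -- With the second branch negated, the map is `(s, t) ↦ a s - b t - a 0`. Pairs with `a s = b t`
    -- form one fibre of it, so local injectivity leaves only `(0, 0)`.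
    obtain ⟨e, he0, he⟩ := exists_openPartialHomeomorph_crossMap hda hdb.neg (by
      rw [show cross (velocity γ x) (-velocity γ y) = -cross (velocity γ x) (velocity γ y) by
        simp [cross]; ring]
      exact neg_ne_zero.2 hv)
    have hpair : Tendsto (fun q : ℝ × ℝ => (!₂[q.1, q.2] : Plane)) (𝓝 (0, 0)) (𝓝 0) := by
      have hc : Continuous fun q : ℝ × ℝ => (!₂[q.1, q.2] : Plane) := by
        fun_prop
      exact hc.tendsto' _ _ (by ext i; fin_cases i <;> simp)
    rw [nhds_prod_eq, nhds_eq_map_add x, nhds_eq_map_add y, prod_map_map_eq, eventually_map,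
      ← nhds_prod_eq]
    filter_upwards [hpair (e.open_source.mem_nhds he0)] with ⟨s, t⟩ hst ⟨h1, h2, h3⟩
    dsimp only at h1 h2 h3 hst
    have heq : e !₂[s, t] = e 0 := by
      rw [he]
      have h4 : chartCurve γ x s = chartCurve γ y t := by
        rw [chartCurve, chartCurve, curve, curve, h3, hγxy]
      have h5 : chartCurve γ x 0 = chartCurve γ y 0 := by
        rw [chartCurve_zero, chartCurve_zero, hγxy]
      simp [crossMap, h4, h5]
    have := e.injOn hst he0 heq
    apply h1
    have hs : s = 0 := by simpa using congrArg (fun z : Plane => z 0) this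
    have ht : t = 0 := by simpa using congrArg (fun z : Plane => z 1) this
    simp [hs, ht]
  · have hc : ContinuousAt (fun q : UnitAddCircle × UnitAddCircle => (γ q.1, γ q.2)) (x, y) :=
      ((hγ.continuous.comp continuous_fst).prodMk (hγ.continuous.comp continuous_snd)).continuousAt
    filter_upwards [hc.eventually_mem (isClosed_diagonal.isOpen_compl.mem_nhds hγxy)] with q hq h
    exact hq h.2.2

theorem GenericLoop.finite_crossings [T2Space M] (α : GenericLoop M) : α.crossings.Finite := by
  refine (α.generic.finite_pairs.image fun q => α q.1).subset ?_
  rintro p ⟨x, y, hxy, hx, hy⟩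
  exact ⟨(x, y), ⟨hxy, hx.trans hy.symm⟩, hx⟩

theorem finite_numberedCrossing [T2Space M] (α : GenericLoop M) : Finite (NumberedCrossing α) := by
  have := α.generic.finite_pairs.to_subtype
  refine Finite.of_injective (fun c : NumberedCrossing α =>
    (⟨(c.fst, c.snd), c.ne, c.eq⟩ :
      {q : UnitAddCircle × UnitAddCircle | q.1 ≠ q.2 ∧ α q.1 = α q.2})) fun c d h => ?_
  simp only [Subtype.mk.injEq, Prod.mk.injEq] at h
  exact NumberedCrossing.ext h.1 h.2

/-- Every loop has a point that is not a self-crossing. -/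
theorem GenericLoop.exists_pointedLoop [T2Space M] (α : GenericLoop M) :
    ∃ P : PointedLoop M, P.loop = α := by
  have hfin : (range fun c : NumberedCrossing α => c.fst).Finite :=
    have := finite_numberedCrossing α
    finite_range _
  -- The numbers `1 / (n + 2)` lie in `(0, 1)`, where `frac` recovers them.
  have : Infinite UnitAddCircle := Infinite.of_injective
    (fun n : ℕ => (((1 : ℝ) / (n + 2) : ℝ) : UnitAddCircle)) fun n m hnm => by
      have hlt : ∀ n : ℕ, (1 : ℝ) / (n + 2) < 1 := fun n => by
        rw [div_lt_one (by positivity)]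
        have : (0 : ℝ) ≤ n := n.cast_nonneg
        linarith
      have := congrArg frac hnm
      simp only at this
      rw [frac_coe (by positivity) (hlt n), frac_coe (by positivity) (hlt m)] at this
      field_simp at this
      have h2 : (m : ℝ) = n := by linarith
      exact_mod_cast h2.symm
  obtain ⟨x, hx⟩ := hfin.exists_notMem
  refine ⟨⟨α, α x, ⟨x, rfl⟩, ?_⟩, rfl⟩
  rintro ⟨a, b, hab, ha, hb⟩
  rcases α.generic.double a b x (ha.trans hb.symm) hb with h | h | h
  · exact hab h
  · exact hx ⟨⟨b, a, hab.symm, hb.trans ha.symm⟩, h⟩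
  · exact hx ⟨⟨a, b, hab, ha.trans hb.symm⟩, h⟩

end Finite

/-! ### The cyclic order of the circle -/

theorem frac_add_of_lt_one {x y : UnitAddCircle} (h : frac x + frac y < 1) :
    frac (x + y) = frac x + frac y :=
  frac_eq_of_coe (add_nonneg (frac_nonneg _) (frac_nonneg _)) h (by simp)

theorem frac_add_of_one_le {x y : UnitAddCircle} (h : 1 ≤ frac x + frac y) :
    frac (x + y) = frac x + frac y - 1 :=
  frac_eq_of_coe (by linarith) (by linarith [frac_lt_one x, frac_lt_one y])
    (by rw [← coe_add_one]; simp)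

theorem frac_sub_of_le {x y : UnitAddCircle} (h : frac y ≤ frac x) :
    frac (x - y) = frac x - frac y :=
  frac_eq_of_coe (by linarith) (by linarith [frac_lt_one x, frac_nonneg y]) (by simp)

theorem frac_sub_of_lt {x y : UnitAddCircle} (h : frac x < frac y) :
    frac (x - y) = frac x - frac y + 1 :=
  frac_eq_of_coe (by linarith [frac_lt_one y, frac_nonneg x]) (by linarith)
    (by rw [coe_add_one]; simp)

theorem frac_sub_base_of_le {x y b : UnitAddCircle} (h : frac (y - b) ≤ frac (x - b)) :
    frac (x - y) = frac (x - b) - frac (y - b) := by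
  rw [← frac_sub_of_le h, sub_sub_sub_cancel_right]

theorem frac_sub_base_of_lt {x y b : UnitAddCircle} (h : frac (x - b) < frac (y - b)) :
    frac (x - y) = frac (x - b) - frac (y - b) + 1 := by
  rw [← frac_sub_of_lt h, sub_sub_sub_cancel_right]

/-- The map `φ : S¹ → S¹` preserves the cyclic order. -/
def CyclicMono (φ : UnitAddCircle → UnitAddCircle) : Prop :=
  ∀ a x y, frac (φ x - φ a) < frac (φ y - φ a) ↔ frac (x - a) < frac (y - a)

/-- `F` maps `[0, 1)` increasingly into an interval of length `1`, so the arc from `φ a` to `φ x`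
has length `F x - F a`, with `1` added exactly when `x` comes before `a`. The wrap therefore occurs
on both sides simultaneously. -/
theorem cyclicMono_of_strictMonoOn {F : ℝ → ℝ} (hF : StrictMonoOn F (Ico 0 1))
    (h1 : ∀ s ∈ Ico (0 : ℝ) 1, F s < F 0 + 1) :
    CyclicMono fun u => ((F (frac u) : ℝ) : UnitAddCircle) := by
  have hmem : ∀ u, frac u ∈ Ico (0 : ℝ) 1 := fun u => ⟨frac_nonneg u, frac_lt_one u⟩
  have hF0 : ∀ u, F 0 ≤ F (frac u) := fun u =>
    hF.monotoneOn ⟨le_rfl, one_pos⟩ (hmem u) (frac_nonneg u)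
  have hle : ∀ u v, frac v ≤ frac u →
      frac (((F (frac u) : ℝ) : UnitAddCircle) - (F (frac v) : ℝ)) = F (frac u) - F (frac v) :=
    fun u v huv => frac_eq_of_coe (by linarith [hF.monotoneOn (hmem v) (hmem u) huv])
      (by linarith [h1 _ (hmem u), hF0 v]) (by simp)
  have hlt : ∀ u v, frac u < frac v →
      frac (((F (frac u) : ℝ) : UnitAddCircle) - (F (frac v) : ℝ)) =
        F (frac u) - F (frac v) + 1 :=
    fun u v huv => frac_eq_of_coe (by linarith [h1 _ (hmem v), hF0 u])
      (by linarith [hF (hmem u) (hmem v) huv]) (by rw [coe_add_one]; simp)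
  intro a x y
  dsimp only
  have hx1 := h1 _ (hmem x)
  have hy1 := h1 _ (hmem y)
  have hx0 := hF0 x
  have hy0 := hF0 y
  have := frac_nonneg x
  have := frac_nonneg y
  have := frac_lt_one x
  have := frac_lt_one y
  have hxy := hF.lt_iff_lt (hmem x) (hmem y)
  rcases le_or_gt (frac a) (frac x) with hx | hx <;> rcases le_or_gt (frac a) (frac y) with hy | hy
  · rw [hle _ _ hx, hle _ _ hy, frac_sub_of_le hx, frac_sub_of_le hy, sub_lt_sub_iff_right,
      sub_lt_sub_iff_right, hxy]
  · rw [hle _ _ hx, hlt _ _ hy, frac_sub_of_le hx, frac_sub_of_lt hy]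
    exact iff_of_true (by linarith) (by linarith)
  · rw [hlt _ _ hx, hle _ _ hy, frac_sub_of_lt hx, frac_sub_of_le hy]
    exact iff_of_false (by linarith) (by linarith)
  · rw [hlt _ _ hx, hlt _ _ hy, frac_sub_of_lt hx, frac_sub_of_lt hy, add_lt_add_iff_right,
      sub_lt_sub_iff_right, add_lt_add_iff_right, sub_lt_sub_iff_right, hxy]

theorem cyclicMono_arcPoint {P Q : UnitAddCircle} (h : P ≠ Q) : CyclicMono (arcPoint P Q) := by
  have hl := frac_pos (sub_ne_zero.2 h.symm)
  have := cyclicMono_of_strictMonoOn (F := fun s => frac P + frac (Q - P) * s)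
    (fun s _ t _ hst => by have := mul_lt_mul_of_pos_left hst hl; linarith)
    (fun s hs => by nlinarith [hs.1, hs.2, frac_lt_one (Q - P)])
  convert this using 2 with u
  rw [AddCircle.coe_add, coe_frac, arcPoint]

/-- The increment over a period is a positive integer. If it were at least `2`, `F` would take the
value `F t + 1` strictly inside the period, contradicting injectivity of `f`. -/
theorem lift_add_one {f : UnitAddCircle ≃ₜ UnitAddCircle} {F : ℝ ≃o ℝ}
    (hF : ∀ t : ℝ, f (t : UnitAddCircle) = (F t : UnitAddCircle)) (t : ℝ) : F (t + 1) = F t + 1 := by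
  have h1 : ((F t : ℝ) : UnitAddCircle) = (F (t + 1) : ℝ) := by rw [← hF, ← hF, coe_add_one]
  obtain ⟨n, hn⟩ := coe_eq_coe_iff.1 h1
  have hpos : (0 : ℝ) < n := by
    rw [← hn]
    linarith [F.strictMono (show t < t + 1 by linarith)]
  have hpos' : 0 < n := by exact_mod_cast hpos
  rcases (show 1 ≤ n from hpos').eq_or_lt with h | h
  · rw [← h, Int.cast_one] at hn
    linarith
  · exfalso
    have h2 : (2 : ℝ) ≤ n := by exact_mod_cast h
    set y := F.symm (F t + 1) with hy
    have hFy : F y = F t + 1 := F.apply_symm_apply _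
    have hty : t < y := F.lt_iff_lt.1 (by linarith)
    have hyt : y < t + 1 := F.lt_iff_lt.1 (by linarith)
    have h3 : f (y : UnitAddCircle) = f (t : UnitAddCircle) := by
      rw [hF, hF, hFy, coe_add_one]
    obtain ⟨m, hm⟩ := coe_eq_coe_iff.1 (f.injective h3).symm
    have h4 : (0 : ℝ) < m := by linarith
    have h5 : (m : ℝ) < 1 := by linarith
    have h4' : 0 < m := by exact_mod_cast h4
    have h5' : m < 1 := by exact_mod_cast h5
    omega

theorem OrientationPreserving.cyclicMono {f : UnitAddCircle ≃ₜ UnitAddCircle}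
    (hf : OrientationPreserving f) : CyclicMono f := by
  obtain ⟨F, hF⟩ := hf
  have := cyclicMono_of_strictMonoOn (F := F) (F.strictMono.strictMonoOn _) (fun s hs => by
    have h1 := lift_add_one hF 0
    rw [← h1]
    exact F.strictMono (by linarith [hs.2]))
  convert this using 2 with u
  rw [← hF, coe_frac]

/-! ### Reparametrizations of the circle -/

theorem exists_homeomorph_of_lift (Φ : ℝ ≃o ℝ) (h : ∀ t, Φ (t + 1) = Φ t + 1) :
    ∃ g : UnitAddCircle ≃ₜ UnitAddCircle, ∀ t : ℝ, g (t : UnitAddCircle) = (Φ t : UnitAddCircle) := by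
  have hs : ∀ t, Φ.symm (t + 1) = Φ.symm t + 1 := fun t => by
    rw [OrderIso.symm_apply_eq, h, OrderIso.apply_symm_apply]
  have hp : Function.Periodic (fun t : ℝ => ((Φ t : ℝ) : UnitAddCircle)) 1 := fun t => by
    simp only [h, coe_add_one]
  have hp' : Function.Periodic (fun t : ℝ => ((Φ.symm t : ℝ) : UnitAddCircle)) 1 := fun t => by
    simp only [hs, coe_add_one]
  refine ⟨⟨⟨hp.lift, hp'.lift, fun x => ?_, fun x => ?_⟩, ?_, ?_⟩, fun t => rfl⟩
  · induction x using QuotientAddGroup.induction_on with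
    | H t =>
      have h1 : hp.lift (t : UnitAddCircle) = ((Φ t : ℝ) : UnitAddCircle) := rfl
      have h2 : hp'.lift ((Φ t : ℝ) : UnitAddCircle) =
        ((Φ.symm (Φ t) : ℝ) : UnitAddCircle) := rfl
      exact (congrArg hp'.lift h1).trans (h2.trans (by rw [OrderIso.symm_apply_apply]))
  · induction x using QuotientAddGroup.induction_on with
    | H t =>
      have h1 : hp'.lift (t : UnitAddCircle) = ((Φ.symm t : ℝ) : UnitAddCircle) := rfl
      have h2 : hp.lift ((Φ.symm t : ℝ) : UnitAddCircle) =
        ((Φ (Φ.symm t) : ℝ) : UnitAddCircle) := rfl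
      exact (congrArg hp.lift h1).trans (h2.trans (by rw [OrderIso.apply_symm_apply]))
  · exact continuous_coinduced_dom.2 ((AddCircle.continuous_mk' 1).comp Φ.continuous)
  · exact continuous_coinduced_dom.2 ((AddCircle.continuous_mk' 1).comp Φ.symm.continuous)

/-- An increasing bijection of `[0, 1]` induces an orientation preserving homeomorphism of the
circle. -/
theorem exists_homeomorph_of_unit (G : ℝ ≃o ℝ) (h0 : G 0 = 0) (h1 : G 1 = 1) :
    ∃ g : UnitAddCircle ≃ₜ UnitAddCircle, OrientationPreserving g ∧
      ∀ u, frac (g u) = G (frac u) := by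
  have hG : ∀ s, 0 ≤ s → s < 1 → 0 ≤ G s ∧ G s < 1 := fun s hs0 hs1 => by
    constructor
    · rw [← h0]; exact G.monotone hs0
    · rw [← h1]; exact G.strictMono hs1
  -- The restriction of `G` to `[0, 1)` is extended equivariantly under integer translations.
  have hmono : StrictMono fun x : ℝ => (⌊x⌋ : ℝ) + G (Int.fract x) := fun x y hxy => by
    dsimp only
    rcases (Int.floor_mono hxy.le).eq_or_lt with h | h
    · have : Int.fract x < Int.fract y := by
        rw [Int.fract, Int.fract, h]; linarith
      rw [h]
      linarith [G.strictMono this]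
    · have h' : (⌊x⌋ : ℝ) + 1 ≤ ⌊y⌋ := by exact_mod_cast h
      linarith [(hG _ (Int.fract_nonneg x) (Int.fract_lt_one x)).2,
        (hG _ (Int.fract_nonneg y) (Int.fract_lt_one y)).1]
  have hsurj : Function.Surjective fun x : ℝ => (⌊x⌋ : ℝ) + G (Int.fract x) := fun y => by
    have hs0 : 0 ≤ G.symm (Int.fract y) := by
      rw [← G.le_iff_le, h0, G.apply_symm_apply]; exact Int.fract_nonneg y
    have hs1 : G.symm (Int.fract y) < 1 := by
      rw [← G.lt_iff_lt, h1, G.apply_symm_apply]; exact Int.fract_lt_one y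
    refine ⟨⌊y⌋ + G.symm (Int.fract y), ?_⟩
    have hfl : ⌊(⌊y⌋ : ℝ) + G.symm (Int.fract y)⌋ = ⌊y⌋ := by
      rw [Int.floor_intCast_add, Int.floor_eq_zero_iff.2 ⟨hs0, hs1⟩, add_zero]
    have hfr : Int.fract ((⌊y⌋ : ℝ) + G.symm (Int.fract y)) = G.symm (Int.fract y) := by
      rw [Int.fract_intCast_add, Int.fract_eq_self.2 ⟨hs0, hs1⟩]
    simp only [hfl, hfr, OrderIso.apply_symm_apply]
    exact Int.floor_add_fract y
  set Φ := hmono.orderIsoOfSurjective _ hsurj with hΦ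
  have hval : ∀ x, Φ x = ⌊x⌋ + G (Int.fract x) := fun x => rfl
  obtain ⟨g, hg⟩ := exists_homeomorph_of_lift Φ fun t => by
    rw [hval, hval, Int.floor_add_one, Int.fract_add_one]
    push_cast; ring
  refine ⟨g, ⟨Φ, hg⟩, fun u => ?_⟩
  have hu := hG _ (frac_nonneg u) (frac_lt_one u)
  refine frac_eq_of_coe hu.1 hu.2 ?_
  conv_rhs => rw [← coe_frac u, hg, hval,
    Int.floor_eq_zero_iff.2 (show frac u ∈ Ico 0 1 from ⟨frac_nonneg u, frac_lt_one u⟩),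
    Int.fract_eq_self.2 ⟨frac_nonneg u, frac_lt_one u⟩]
  simp

/-- An orientation preserving homeomorphism of the circle maps arcs to arcs. -/
theorem OrientationPreserving.exists_arc {f : UnitAddCircle ≃ₜ UnitAddCircle}
    (hf : OrientationPreserving f) {P Q : UnitAddCircle} (h : P ≠ Q) :
    ∃ g : UnitAddCircle ≃ₜ UnitAddCircle, OrientationPreserving g ∧
      ∀ u, f (arcPoint P Q u) = arcPoint (f P) (f Q) (g u) := by
  obtain ⟨F, hF⟩ := hf
  set p := frac P with hp
  set l := frac (Q - P) with hl
  have hl0 : 0 < l := frac_pos (sub_ne_zero.2 h.symm)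
  have hl1 : l < 1 := frac_lt_one _
  have hL0 : 0 < F (p + l) - F p := by linarith [F.strictMono (show p < p + l by linarith)]
  have hL1 : F (p + l) - F p < 1 := by
    linarith [F.strictMono (show p + l < p + 1 by linarith), lift_add_one hF p]
  have hP : ((p : ℝ) : UnitAddCircle) = P := coe_frac P
  have hQ : ((p + l : ℝ) : UnitAddCircle) = Q := by
    rw [AddCircle.coe_add, hP, hl, coe_frac]; abel
  have hL : frac (f Q - f P) = F (p + l) - F p := by
    refine frac_eq_of_coe hL0.le hL1 ?_
    rw [AddCircle.coe_sub, ← hF, ← hF, hQ, hP]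
  -- In affine parameters of the two arcs, `f` becomes `s ↦ (F (p + l s) - F p) / L`, where `L` is
  -- the length of the image arc; it fixes `0` and `1`.
  obtain ⟨g, hg, hgG⟩ := exists_homeomorph_of_unit
    ((((OrderIso.mulLeft₀ l hl0).trans (OrderIso.addLeft p)).trans F).trans
      ((OrderIso.addRight (-F p)).trans (OrderIso.mulLeft₀ _ (inv_pos.2 hL0))))
    (by simp) (by
      simp only [OrderIso.trans_apply, OrderIso.mulLeft₀_apply, OrderIso.addLeft_apply,
        OrderIso.addRight_apply, mul_one]
      rw [← sub_eq_add_neg, inv_mul_cancel₀ hL0.ne'])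
  refine ⟨g, hg, fun u => ?_⟩
  rw [arcPoint, arcPoint, hgG, hL]
  simp only [OrderIso.trans_apply, OrderIso.mulLeft₀_apply, OrderIso.addLeft_apply,
    OrderIso.addRight_apply]
  rw [mul_inv_cancel_left₀ hL0.ne']
  conv_lhs => rw [← hP]
  rw [← AddCircle.coe_add, hF, ← hP, hF, ← AddCircle.coe_add, hP]
  congr 1
  ring

theorem orientationPreserving_addRight (r : UnitAddCircle) :
    OrientationPreserving (Homeomorph.addRight r) :=
  ⟨OrderIso.addRight (frac r), fun t => by simp⟩

/-! ### Arcs of arcs -/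

/-- The parameter of the point `x` of the arc `PQ`. -/
noncomputable def arcParam (P Q x : UnitAddCircle) : UnitAddCircle :=
  ((frac (x - P) / frac (Q - P) : ℝ) : UnitAddCircle)

theorem frac_arcParam {P Q x : UnitAddCircle} (h : frac (x - P) < frac (Q - P)) :
    frac (arcParam P Q x) = frac (x - P) / frac (Q - P) := by
  have hl : 0 < frac (Q - P) := (frac_nonneg _).trans_lt h
  exact frac_coe (div_nonneg (frac_nonneg _) hl.le) ((div_lt_one hl).2 h)

theorem arcPoint_arcParam {P Q x : UnitAddCircle} (h : frac (x - P) < frac (Q - P)) :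
    arcPoint P Q (arcParam P Q x) = x := by
  have hl : 0 < frac (Q - P) := (frac_nonneg _).trans_lt h
  rw [arcPoint, frac_arcParam h, mul_div_cancel₀ _ hl.ne', coe_frac, add_sub_cancel]

theorem frac_arcPoint_sub_lt {P Q : UnitAddCircle} (h : P ≠ Q) (u : UnitAddCircle) :
    frac (arcPoint P Q u - P) < frac (Q - P) := by
  rw [frac_arcPoint_sub]
  nlinarith [frac_pos (sub_ne_zero.2 h.symm), frac_lt_one u]

theorem arcParam_arcPoint {P Q : UnitAddCircle} (h : P ≠ Q) (u : UnitAddCircle) :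
    arcParam P Q (arcPoint P Q u) = u :=
  arcPoint_injective h (arcPoint_arcParam (frac_arcPoint_sub_lt h u))

/-- The arc of an arc that does not contain its end points is an arc. -/
theorem arcPoint_arcPoint {P Q u v : UnitAddCircle} (h : frac u < frac v) (s : UnitAddCircle) :
    arcPoint P Q (arcPoint u v s) = arcPoint (arcPoint P Q u) (arcPoint P Q v) s := by
  have hu := frac_nonneg u
  have hv := frac_lt_one v
  have hs0 := frac_nonneg s
  have hs1 := frac_lt_one s
  have h1 : frac (arcPoint u v s) = frac u + (frac v - frac u) * frac s := by
    refine frac_eq_of_coe ?_ ?_ ?_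
    · nlinarith
    · nlinarith
    · rw [arcPoint, frac_sub_of_le h.le]; simp
  have h2 : frac (arcPoint P Q v - arcPoint P Q u) = frac (Q - P) * (frac v - frac u) := by
    rw [frac_sub_base_of_le (b := P), frac_arcPoint_sub, frac_arcPoint_sub]
    · ring
    · rw [frac_arcPoint_sub, frac_arcPoint_sub]
      exact mul_le_mul_of_nonneg_left h.le (frac_nonneg _)
  rw [arcPoint, h1, arcPoint, h2, arcPoint, add_assoc, ← AddCircle.coe_add]
  congr 2
  ring

/-- Moving from `U` along an arc of length `l`, and then from `P` along an arc of length `m`. -/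
noncomputable def brokenArc (U : UnitAddCircle) (l : ℝ) (P : UnitAddCircle) (m : ℝ)
    (s : UnitAddCircle) : UnitAddCircle :=
  if (l + m) * frac s < l then U + (((l + m) * frac s : ℝ) : UnitAddCircle)
  else P + (((l + m) * frac s - l : ℝ) : UnitAddCircle)

/-- Both sides run through the same two pieces in opposite order; starting after the first piece
means shifting the parameter by its share `l / (l + m)` of the total length. -/
theorem brokenArc_rotate (U P : UnitAddCircle) {l m : ℝ} (hl : 0 < l) (hm : 0 < m)
    (s : UnitAddCircle) :
    brokenArc P m U l s = brokenArc U l P m (s + ((l / (l + m) : ℝ) : UnitAddCircle)) := by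
  have hlm : 0 < l + m := by linarith
  have hr : frac ((l / (l + m) : ℝ) : UnitAddCircle) = l / (l + m) :=
    frac_coe (by positivity) ((div_lt_one hlm).2 (by linarith))
  have hr' : (l + m) * (l / (l + m)) = l := mul_div_cancel₀ _ hlm.ne'
  have hms : (m + l) * frac s = (l + m) * frac s := by ring
  rcases lt_or_ge ((l + m) * frac s) m with h | h
  · have h1 : frac s + frac ((l / (l + m) : ℝ) : UnitAddCircle) < 1 := by
      rw [hr, ← mul_lt_mul_iff_right₀ hlm, mul_add, hr']; linarith
    have h2 : (l + m) * frac (s + ((l / (l + m) : ℝ) : UnitAddCircle)) =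
        (l + m) * frac s + l := by rw [frac_add_of_lt_one h1, hr, mul_add, hr']
    rw [brokenArc, brokenArc, hms, h2, if_pos h, if_neg (by nlinarith [frac_nonneg s])]
    simp
  · have h1 : 1 ≤ frac s + frac ((l / (l + m) : ℝ) : UnitAddCircle) := by
      rw [hr, ← mul_le_mul_iff_right₀ hlm, mul_add, hr']; linarith
    have h2 : (l + m) * frac (s + ((l / (l + m) : ℝ) : UnitAddCircle)) =
        (l + m) * frac s - m := by rw [frac_add_of_one_le h1, hr, mul_sub, mul_add, hr']; ring
    rw [brokenArc, brokenArc, hms, h2, if_neg (by linarith),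
      if_pos (by nlinarith [frac_lt_one s])]

/-- On the arc `PQ`, closed up to a circle, the way from `U` to the earlier point `V` runs to the
end `Q`, jumps to `P` and continues to `V`. -/
theorem arcPoint_arcParam_wrap {P Q U V : UnitAddCircle} (hVU : frac (V - P) < frac (U - P))
    (hUQ : frac (U - P) < frac (Q - P)) (s : UnitAddCircle) :
    arcPoint P Q (arcPoint (arcParam P Q U) (arcParam P Q V) s) =
      brokenArc U (frac (Q - U)) P (frac (V - P)) s := by
  have hl : 0 < frac (Q - P) := (frac_nonneg _).trans_lt hUQ
  have hu := frac_arcParam hUQ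
  have hv := frac_arcParam (hVU.trans hUQ)
  set u := arcParam P Q U with hudef
  set v := arcParam P Q V with hvdef
  have hlu : frac (Q - P) * frac u = frac (U - P) := by rw [hu, mul_div_cancel₀ _ hl.ne']
  have hlv : frac (Q - P) * frac v = frac (V - P) := by rw [hv, mul_div_cancel₀ _ hl.ne']
  have hvu : frac v < frac u := by
    rw [hu, hv]; exact div_lt_div_of_pos_right hVU hl
  have hQU : frac (Q - U) = frac (Q - P) - frac (U - P) := frac_sub_base_of_le hUQ.le
  have hlen := frac_sub_of_lt hvu
  have hmul : frac (Q - P) * (frac (v - u) * frac s) =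
      (frac (Q - U) + frac (V - P)) * frac s := by
    rw [hlen, hQU, ← hlu, ← hlv]; ring
  have hs0 := frac_nonneg s
  have hs1 := frac_lt_one s
  have hlen0 := frac_nonneg (v - u)
  have hfr : frac (((frac (v - u) * frac s : ℝ)) : UnitAddCircle) = frac (v - u) * frac s :=
    frac_coe (mul_nonneg hlen0 hs0) (by nlinarith [frac_lt_one (v - u)])
  rw [brokenArc]
  split_ifs with h
  · have h1 : frac u + frac (((frac (v - u) * frac s : ℝ)) : UnitAddCircle) < 1 := by
      rw [hfr, ← mul_lt_mul_iff_right₀ hl, mul_add, hlu, hmul]; linarith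
    rw [arcPoint, arcPoint, frac_add_of_lt_one h1, hfr, mul_add, hmul, hlu, AddCircle.coe_add,
      coe_frac]
    abel
  · have h1 : 1 ≤ frac u + frac (((frac (v - u) * frac s : ℝ)) : UnitAddCircle) := by
      rw [hfr, ← mul_le_mul_iff_right₀ hl, mul_add, hlu, hmul]; linarith
    rw [arcPoint, arcPoint, frac_add_of_one_le h1, hfr, mul_sub, mul_add, hmul, hlu]
    congr 2
    rw [hQU]; ring

/-- If the points `P, V, U, Q` are in cyclic order, then the two ways to cut the arcs `VU` and `QP`
out of the circle differ by a rotation. -/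
theorem exists_rotation_wrap {P Q U V : UnitAddCircle} (hPV : V ≠ P)
    (hVU : frac (V - P) < frac (U - P)) (hUQ : frac (U - P) < frac (Q - P)) :
    ∃ r : UnitAddCircle, ∀ s,
      arcPoint U V (arcPoint (arcParam U V P) (arcParam U V Q) s) =
        arcPoint P Q (arcPoint (arcParam P Q U) (arcParam P Q V) (s + r)) := by
  have h0 : 0 < frac (V - P) := frac_pos (sub_ne_zero.2 hPV)
  have hQ : frac (Q - U) = frac (Q - P) - frac (U - P) := frac_sub_base_of_le hUQ.le
  have hP : frac (P - U) = 0 - frac (U - P) + 1 := by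
    rw [frac_sub_base_of_lt (b := P)] <;> rw [sub_self, frac_zero]
    linarith
  have hV : frac (V - U) = frac (V - P) - frac (U - P) + 1 := frac_sub_base_of_lt hVU
  refine ⟨((frac (Q - U) / (frac (Q - U) + frac (V - P)) : ℝ) : UnitAddCircle), fun s => ?_⟩
  -- Both sides become broken arcs made of the pieces `UQ` and `PV`, taken in opposite order.
  rw [arcPoint_arcParam_wrap (by rw [hQ, hP]; linarith [frac_lt_one (Q - P)])
    (by rw [hP, hV]; linarith), arcPoint_arcParam_wrap hVU hUQ,
    brokenArc_rotate _ _ (by rw [hQ]; linarith) h0]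

/-! ### Isotopy invariance of the cobracket sums -/

section Crossings

variable {M : Type*} [TopologicalSpace M] [ChartedSpace (EuclideanHalfSpace 2) M]

theorem PointedLoop.eq_baseParam {P : PointedLoop M} {x : UnitAddCircle} (h : P.loop x = P.base) :
    x = P.baseParam := by
  by_contra hne
  exact P.base_notMem ⟨_, _, hne, h, P.loop_baseParam⟩

theorem PointedLoop.gen_eq_of_isotopic (R : Type*) [CommRing R] {P Q : PointedLoop M}
    (h : PointedLoop.Isotopic P Q) : P.gen R = Q.gen R := by
  rw [PointedLoop.gen, PointedLoop.gen, Quotient.sound (show P ≈ Q from h)]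

theorem GenericLoop.gen_eq_of_isotopic (R : Type*) [CommRing R] {α β : GenericLoop M}
    (h : GenericLoop.Isotopic α β) : α.gen R = β.gen R := by
  rw [GenericLoop.gen, GenericLoop.gen, Quotient.sound (show α ≈ β from h)]

/-- The bijection between the numbered crossings of two isotopic loops. -/
def crossingEquiv {α β : GenericLoop M} (k : M ≃ₜ M) (f : UnitAddCircle ≃ₜ UnitAddCircle)
    (H : ∀ x, β x = k (α (f x))) : NumberedCrossing β ≃ NumberedCrossing α where
  toFun c := ⟨f c.fst, f c.snd, f.injective.ne c.ne, k.injective (by rw [← H, ← H, c.eq])⟩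
  invFun c := ⟨f.symm c.fst, f.symm c.snd, f.symm.injective.ne c.ne, by
    rw [H, H, f.apply_symm_apply, f.apply_symm_apply, c.eq]⟩
  left_inv c := by ext <;> simp
  right_inv c := by ext <;> simp

@[simp] theorem forgetBase_gen (R : Type*) [CommRing R] (P : PointedLoop M) :
    forgetBase M R (P.gen R) = P.loop.gen R := by
  rw [PointedLoop.gen, GenericLoop.gen, forgetBase, Finsupp.lmapDomain_apply,
    Finsupp.mapDomain_single]
  rfl

theorem NumberedCrossing.isFromBase_swap {P : PointedLoop M} (c : NumberedCrossing P.loop) :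
    c.swap.IsFromBase ↔ ¬ c.IsFromBase := by
  change frac (c.snd - P.baseParam) < frac (c.fst - P.baseParam) ↔ ¬ _ < _
  rw [not_lt]
  refine ⟨le_of_lt, fun h => lt_of_le_of_ne h fun h' => c.ne ?_⟩
  exact (sub_left_injective (frac_injective h')).symm

variable [IsManifold (𝓡∂ 2) ∞ M]

theorem mul_pos_iff_sign (s : ℤˣ) (d : ℝ) :
    0 < ((s : ℤ) : ℝ) * d ↔ (s : ℤ) * (SignType.sign d : ℤ) = 1 := by
  rcases lt_trichotomy d 0 with h | h | h <;> rcases Int.units_eq_one_or s with rfl | rfl <;>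
    simp [h, h.le]

namespace NumberedCrossing

/-- The cross product is antisymmetric, and transversality excludes zero, so exactly one numeration
is positive. -/
theorem isPositive_swap (o : SurfaceOrientation M) {α : GenericLoop M} (c : NumberedCrossing α) :
    c.swap.IsPositive o ↔ ¬ c.IsPositive o := by
  have h1 : c.swap.point = c.point := c.eq.symm
  have h2 := α.generic.transversal _ _ c.ne c.eq
  rw [IsPositive, IsPositive, h1, show cross (velocity α c.swap.fst) (velocity α c.swap.snd) =
    -cross (velocity α c.fst) (velocity α c.snd) from cross_swap _ _, mul_neg, neg_pos, not_lt]
  refine ⟨le_of_lt, fun h => lt_of_le_of_ne h (mul_ne_zero ?_ h2)⟩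
  rcases Int.units_eq_one_or (o.sign c.point) with h | h <;> simp [h]

theorem eps_swap (R : Type*) [CommRing R] (o : SurfaceOrientation M) {α : GenericLoop M}
    (c : NumberedCrossing α) : c.swap.eps R o = -c.eps R o := by
  rw [eps, eps]
  by_cases h : c.IsPositive o
  · rw [if_neg (by rw [isPositive_swap]; exact not_not.2 h), if_pos h]
  · rw [if_pos ((isPositive_swap o c).2 h), if_neg h, neg_neg]

end NumberedCrossing

section Isotopy

variable {α β : GenericLoop M} {h : unitInterval → M ≃ₜ M} {f : UnitAddCircle ≃ₜ UnitAddCircle}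

theorem isPositive_crossingEquiv (o : SurfaceOrientation M) (hh : IsAmbientIsotopy h)
    (hf : OrientationPreserving f) (H : ∀ x, β x = h 1 (α (f x))) (c : NumberedCrossing β) :
    (crossingEquiv (h 1) f H c).IsPositive o ↔ c.IsPositive o := by
  have key := sign_cross_isotopy o α.generic β.generic hh hf H c.ne c.eq
  rw [NumberedCrossing.IsPositive, NumberedCrossing.IsPositive, mul_pos_iff_sign, mul_pos_iff_sign]
  change (o.sign (α (f c.fst)) : ℤ) * (SignType.sign
    (cross (velocity α (f c.fst)) (velocity α (f c.snd))) : ℤ) = 1 ↔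
    (o.sign (β c.fst) : ℤ) * (SignType.sign (cross (velocity β c.fst) (velocity β c.snd)) : ℤ) = 1
  rw [key]
  have hsq : (o.sign (β c.fst) : ℤ) * o.sign (β c.fst) = 1 := by
    rcases Int.units_eq_one_or (o.sign (β c.fst)) with h | h <;> simp [h]
  refine Eq.congr_left ?_
  linear_combination (-(SignType.sign
    (cross (velocity α (f c.fst)) (velocity α (f c.snd))) : ℤ) * o.sign (α (f c.fst))) * hsq

theorem eps_crossingEquiv (R : Type*) [CommRing R] (o : SurfaceOrientation M)
    (hh : IsAmbientIsotopy h) (hf : OrientationPreserving f) (H : ∀ x, β x = h 1 (α (f x)))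
    (c : NumberedCrossing β) : (crossingEquiv (h 1) f H c).eps R o = c.eps R o := by
  have := isPositive_crossingEquiv o hh hf H c
  rw [NumberedCrossing.eps, NumberedCrossing.eps]
  by_cases hc : c.IsPositive o
  · rw [if_pos hc, if_pos (this.2 hc)]
  · rw [if_neg hc, if_neg fun h => hc (this.1 h)]

theorem gen_arc_crossingEquiv (R : Type*) [CommRing R] (hh : IsAmbientIsotopy h)
    (hf : OrientationPreserving f) (H : ∀ x, β x = h 1 (α (f x))) (c : NumberedCrossing β) :
    (crossingEquiv (h 1) f H c).arc.gen R = c.arc.gen R := by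
  obtain ⟨g, hg, hfg⟩ := hf.exists_arc c.ne
  refine GenericLoop.gen_eq_of_isotopic R ⟨h, g, hh, hg, fun u => ?_⟩
  change β (arcPoint c.fst c.snd u) = h 1 (α (arcPoint (f c.fst) (f c.snd) (g u)))
  rw [H, hfg]

/-- The bijection of crossings keeps positivity, and `f` maps the two arcs of a crossing onto those
of its image, so the terms match. -/
theorem GenericLoop.cobracketSum_eq_of_isotopic (R : Type*) [CommRing R] (o : SurfaceOrientation M)
    (hαβ : GenericLoop.Isotopic α β) : α.cobracketSum R o = β.cobracketSum R o := by
  obtain ⟨h, f, hh, hf, H⟩ := hαβ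
  set E := (crossingEquiv (h 1) f H).subtypeEquiv
    fun c => (isPositive_crossingEquiv o hh hf H c).symm with hE
  refine (finsum_eq_of_bijective E E.bijective fun c => ?_).symm
  have h1 := gen_arc_crossingEquiv R hh hf H c.1
  have h2 := gen_arc_crossingEquiv R hh hf H c.1.swap
  change (E c).1.swap.arc.gen R = _ at h2
  change (E c).1.arc.gen R = _ at h1
  rw [h1, h2]

theorem PointedLoop.cobracketSum_eq_of_isotopic (R : Type*) [CommRing R] (o : SurfaceOrientation M)
    {P Q : PointedLoop M} (hPQ : PointedLoop.Isotopic P Q) :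
    P.cobracketSum R o = Q.cobracketSum R o := by
  obtain ⟨h, f, hh, hf, H, Hb⟩ := hPQ
  have hb : f Q.baseParam = P.baseParam := by
    apply PointedLoop.eq_baseParam
    apply (h 1).injective
    rw [← H, Q.loop_baseParam, Hb]
  set E := (crossingEquiv (h 1) f H).subtypeEquiv (p := fun c => c.IsFromBase)
    (q := fun c => c.IsFromBase) (fun c => by
      change frac _ < frac _ ↔ frac (f c.fst - P.baseParam) < frac (f c.snd - P.baseParam)
      rw [← hb]
      exact (hf.cyclicMono _ _ _).symm) with hE
  refine (finsum_eq_of_bijective E E.bijective fun c => ?_).symm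
  have h0 := eps_crossingEquiv R o hh hf H c.1
  change (E c).1.eps R o = _ at h0
  have h1 : (E c).1.innerLoop.gen R = c.1.innerLoop.gen R := by
    obtain ⟨g, hg, hfg⟩ := hf.exists_arc c.1.ne
    refine PointedLoop.gen_eq_of_isotopic R ⟨h, g, hh, hg, fun u => ?_, H _⟩
    change Q.loop (arcPoint c.1.fst c.1.snd u) =
      h 1 (P.loop (arcPoint (f c.1.fst) (f c.1.snd) (g u)))
    rw [H, hfg]
  have h2 : ((E c).1.outerLoop (E c).2).gen R = (c.1.outerLoop c.2).gen R := by
    obtain ⟨g, hg, hfg⟩ := hf.exists_arc c.1.ne.symm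
    refine PointedLoop.gen_eq_of_isotopic R ⟨h, g, hh, hg, fun u => ?_, Hb⟩
    change Q.loop (arcPoint c.1.snd c.1.fst u) =
      h 1 (P.loop (arcPoint (f c.1.snd) (f c.1.fst) (g u)))
    rw [H, hfg]
  rw [h0, h1, h2]

end Isotopy

/-! ### The two cobracket sums are compatible -/

theorem neg_smul_sub {R V : Type*} [CommRing R] [AddCommGroup V] [Module R V] (a : R) (x y : V) :
    (-a) • (x - y) = a • (y - x) := by
  rw [neg_smul, ← smul_neg, neg_sub]

/-- Each of `p` and `q` selects exactly one element of every orbit of `s`, and `g` is constant on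
orbits. -/
theorem finsum_subtype_eq_of_involution {X A : Type*} [Finite X] [AddCommMonoid A] (s : X → X)
    (hs : ∀ x, s (s x) = x) {p q : X → Prop} (hp : ∀ x, p (s x) ↔ ¬ p x)
    (hq : ∀ x, q (s x) ↔ ¬ q x) (g : X → A) (hg : ∀ x, g (s x) = g x) :
    ∑ᶠ x : {x // p x}, g x = ∑ᶠ x : {x // q x}, g x := by
  classical
  let φ : {x // p x} → {x // q x} := fun x =>
    if h : q x then ⟨x, h⟩ else ⟨s x, (hq _).2 h⟩
  refine finsum_eq_of_bijective φ ⟨fun x y hxy => ?_, fun y => ?_⟩ fun x => ?_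
  · simp only [φ] at hxy
    have hne : ∀ x y : {x // p x}, x.1 ≠ s y.1 := fun x y h => (hp _).1 (h ▸ x.2) y.2
    split_ifs at hxy with h1 h2 h2
    · exact Subtype.ext (Subtype.mk.inj hxy)
    · exact absurd (Subtype.mk.inj hxy) (hne x y)
    · exact absurd (Subtype.mk.inj hxy).symm (hne y x)
    · have := congrArg s (Subtype.mk.inj hxy)
      rw [hs, hs] at this
      exact Subtype.ext this
  · by_cases h : p y
    · exact ⟨⟨y, h⟩, by simp [φ, y.2]⟩
    · refine ⟨⟨s y, (hp _).2 h⟩, ?_⟩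
      have : ¬ q (s y) := fun h' => (hq _).1 h' y.2
      simp [φ, this, hs]
  · simp only [φ]
    split_ifs with h
    · rfl
    · exact (hg _).symm

/-- Swapping the numeration negates both `ε` and the antisymmetric tensor, so the term depends only
on the crossing. The numeration from the base point may thus be exchanged for the positive one, for
which `ε = 1`. -/
theorem map_forgetBase_cobracketSum [T2Space M] (R : Type*) [CommRing R] (o : SurfaceOrientation M)
    (P : PointedLoop M) :
    TensorProduct.map (forgetBase M R) (forgetBase M R) (P.cobracketSum R o) =
      P.loop.cobracketSum R o := by
  have := finite_numberedCrossing P.loop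
  set g : NumberedCrossing P.loop → LoopModule M R ⊗[R] LoopModule M R := fun c =>
    c.eps R o • (c.arc.gen R ⊗ₜ[R] c.swap.arc.gen R - c.swap.arc.gen R ⊗ₜ[R] c.arc.gen R) with hg
  have h1 : TensorProduct.map (forgetBase M R) (forgetBase M R) (P.cobracketSum R o) =
      ∑ᶠ c : {c : NumberedCrossing P.loop // c.IsFromBase}, g c := by
    rw [PointedLoop.cobracketSum, map_finsum _ (toFinite _)]
    refine finsum_congr fun c => ?_
    rw [map_smul, map_sub, TensorProduct.map_tmul, TensorProduct.map_tmul, forgetBase_gen,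
      forgetBase_gen]
    rfl
  have h2 : P.loop.cobracketSum R o =
      ∑ᶠ c : {c : NumberedCrossing P.loop // c.IsPositive o}, g c := by
    refine finsum_congr fun c => ?_
    rw [hg]
    dsimp only
    rw [NumberedCrossing.eps, if_pos c.2, one_smul]
  rw [h1, h2]
  refine finsum_subtype_eq_of_involution NumberedCrossing.swap (fun _ => rfl)
    (fun c => c.isFromBase_swap) (fun c => c.isPositive_swap o) g fun c => ?_
  have hss : c.swap.swap = c := rfl
  rw [hg]
  dsimp only
  rw [hss, NumberedCrossing.eps_swap]
  exact neg_smul_sub _ _ _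

end Crossings

/-! ### The co-Jacobi identity for systems of chords -/

section Algebra

variable {R V : Type*} [CommRing R] [AddCommGroup V] [Module R V]

/-- The sum of the cyclic permutations. -/
noncomputable def cycSum (R V : Type*) [CommRing R] [AddCommGroup V] [Module R V] :
    V ⊗[R] (V ⊗[R] V) →ₗ[R] V ⊗[R] (V ⊗[R] V) :=
  LinearMap.id + cyc R V + cyc R V ∘ₗ cyc R V

theorem cyc_tmul (x y z : V) : cyc R V (x ⊗ₜ (y ⊗ₜ z)) = z ⊗ₜ (x ⊗ₜ y) := by
  simp [cyc]

theorem cycSum_tmul (x y z : V) :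
    cycSum R V (x ⊗ₜ (y ⊗ₜ z)) = cycSum R V (z ⊗ₜ (x ⊗ₜ y)) := by
  simp only [cycSum, LinearMap.add_apply, LinearMap.id_apply, LinearMap.comp_apply, cyc_tmul]
  abel

/-- Here `A c` is the inner loop and `B c` the outer loop of the chord `c`; `C c d` is what remains
of `A c` after cutting off `d` inside it, and `D c d` what remains after cutting off two disjoint
arcs. Interlaced pairs do not occur in `hA` and `hB`. Under the cyclic sum, a nested pair appears
once from cutting the outer chord first and once from cutting the inner one first, with opposite
signs. The terms of disjoint pairs are antisymmetric in `c`, `d` because `D` is symmetric. -/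
theorem cycSum_lTensor_sum_eq_zero {I : Type*} [Fintype I] (ν : V →ₗ[R] V ⊗[R] V) (ε : I → R)
    (A B : I → V) (C D : I → I → V) (ins apart : I → I → Prop) [DecidableRel ins]
    [DecidableRel apart] (hapart : ∀ c d, apart c d ↔ apart d c)
    (hD : ∀ c d, apart c d → D c d = D d c)
    (hA : ∀ c, ν (A c) = ∑ d, if ins c d then
      ε d • (A d ⊗ₜ[R] C c d - C c d ⊗ₜ[R] A d) else 0)
    (hB : ∀ c, ν (B c) = (∑ d, if ins d c then
      ε d • (C d c ⊗ₜ[R] B d - B d ⊗ₜ[R] C d c) else 0) +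
        ∑ d, if apart c d then ε d • (A d ⊗ₜ[R] D c d - D c d ⊗ₜ[R] A d) else 0) :
    cycSum R V (ν.lTensor V (∑ c, ε c • (A c ⊗ₜ[R] B c - B c ⊗ₜ[R] A c))) = 0 := by
  set T : V → V → V → V ⊗[R] (V ⊗[R] V) := fun x y z => cycSum R V (x ⊗ₜ (y ⊗ₜ z)) with hT
  have hcyc : ∀ x y z, T x y z = T z x y := cycSum_tmul
  have hL : ∀ x y z (r : R), cycSum R V (x ⊗ₜ (r • (y ⊗ₜ[R] z - z ⊗ₜ[R] y))) =
      r • (T x y z - T x z y) := fun x y z r => by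
    rw [TensorProduct.tmul_smul, map_smul, TensorProduct.tmul_sub, map_sub]
  have hsum : ∀ (x : V) (p : I → Prop) [DecidablePred p] (y z : I → V),
      cycSum R V (x ⊗ₜ (∑ d, if p d then ε d • (y d ⊗ₜ[R] z d - z d ⊗ₜ[R] y d) else 0)) =
        ∑ d, if p d then ε d • (T x (y d) (z d) - T x (z d) (y d)) else 0 := by
    intro x p _ y z
    rw [TensorProduct.tmul_sum, map_sum]
    refine Finset.sum_congr rfl fun d _ => ?_
    split_ifs
    · exact hL _ _ _ _
    · rw [TensorProduct.tmul_zero, map_zero]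
  have h1 : ∀ c, cycSum R V (ν.lTensor V (A c ⊗ₜ[R] B c - B c ⊗ₜ[R] A c)) =
      (∑ d, if ins d c then ε d • (T (A c) (C d c) (B d) - T (A c) (B d) (C d c)) else 0) +
      (∑ d, if apart c d then ε d • (T (A c) (A d) (D c d) - T (A c) (D c d) (A d)) else 0) -
      ∑ d, if ins c d then ε d • (T (B c) (A d) (C c d) - T (B c) (C c d) (A d)) else 0 := by
    intro c
    rw [map_sub, map_sub, LinearMap.lTensor_tmul, LinearMap.lTensor_tmul, hA, hB,
      TensorProduct.tmul_add, map_add, hsum, hsum, hsum]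
  simp only [map_sum, map_smul, h1]
  simp only [smul_sub, smul_add, Finset.smul_sum, smul_ite, smul_zero, Finset.sum_sub_distrib,
    Finset.sum_add_distrib]
  have e1 : (∑ c, ∑ d, if ins c d then
      ε c • ε d • T (B c) (A d) (C c d) - ε c • ε d • T (B c) (C c d) (A d) else 0) =
      ∑ c, ∑ d, if ins d c then
        ε c • ε d • T (A c) (C d c) (B d) - ε c • ε d • T (A c) (B d) (C d c) else 0 := by
    rw [Finset.sum_comm]
    refine Finset.sum_congr rfl fun c _ => Finset.sum_congr rfl fun d _ => ?_
    rw [hcyc (A c) (C d c), hcyc (A c) (B d), hcyc (C d c) (A c), smul_comm (ε d) (ε c), smul_comm (ε d) (ε c)]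
  have e2 : (∑ c, ∑ d, if apart c d then
      ε c • ε d • T (A c) (A d) (D c d) - ε c • ε d • T (A c) (D c d) (A d) else 0) = 0 := by
    have : ∀ c d, (if apart c d then
        ε c • ε d • T (A c) (A d) (D c d) - ε c • ε d • T (A c) (D c d) (A d) else 0) =
        (if apart c d then ε c • ε d • T (A c) (A d) (D c d) else 0) -
        if apart d c then ε d • ε c • T (A d) (A c) (D d c) else 0 := fun c d => by
      by_cases h : apart c d
      · rw [if_pos h, if_pos h, if_pos ((hapart c d).1 h), ← hD c d h, hcyc (A c) (D c d),
          smul_comm (ε d) (ε c)]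
      · rw [if_neg h, if_neg h, if_neg fun h' => h ((hapart c d).2 h'), sub_zero]
    simp only [this, Finset.sum_sub_distrib]
    rw [sub_eq_zero, Finset.sum_comm]
  rw [e1, e2, add_zero, sub_self]

/-- Lets sums over the crossings of a cut-out loop be written as sums over chords of the original
loop, as the algebraic cancellation requires. -/
theorem finsum_eq_sum_ite {E I A : Type*} [Fintype I] [AddCommMonoid A] (ι : E → I)
    (hι : Function.Injective ι) (p : I → Prop) [DecidablePred p]
    (hp : ∀ d, (∃ e, ι e = d) ↔ p d) (f : E → A) (G : I → A) (h : ∀ e, f e = G (ι e)) :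
    ∑ᶠ e, f e = ∑ d, if p d then G d else 0 := by
  classical
  rw [finsum_congr h, ← finsum_mem_range hι, finsum_mem_def, finsum_eq_sum_of_fintype]
  refine Finset.sum_congr rfl fun d _ => ?_
  have : d ∈ range ι ↔ p d := hp d
  by_cases hd : p d
  · rw [if_pos hd, indicator_of_mem (this.2 hd)]
  · rw [if_neg hd, indicator_of_notMem (fun h => hd (this.1 h))]

end Algebra

/-! ### The crossings of the two loops cut out by a crossing -/

section ArcCrossings

variable {M : Type*}

theorem restrictArc_restrictArc_of_lt (γ : UnitAddCircle → M) {P Q x y : UnitAddCircle}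
    (hx : frac (x - P) < frac (y - P)) (hy : frac (y - P) < frac (Q - P)) :
    restrictArc (restrictArc γ P Q) (arcParam P Q x) (arcParam P Q y) = restrictArc γ x y := by
  ext s
  have hl : 0 < frac (Q - P) := (frac_nonneg _).trans_lt hy
  have h : frac (arcParam P Q x) < frac (arcParam P Q y) := by
    rw [frac_arcParam hy, frac_arcParam (hx.trans hy)]
    exact div_lt_div_of_pos_right hx hl
  simp only [restrictArc]
  rw [arcPoint_arcPoint h, arcPoint_arcParam hy, arcPoint_arcParam (hx.trans hy)]

variable [TopologicalSpace M] [ChartedSpace (EuclideanHalfSpace 2) M]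

open Classical in
/-- The generator given by the loop `γ` pointed at `b`, if this is a pointed loop. -/
noncomputable def loopClass (R : Type*) [CommRing R] (γ : UnitAddCircle → M) (b : M) :
    PointedLoopModule M R :=
  if h : ∃ P : PointedLoop M, P.loop.toFun = γ ∧ P.base = b then h.choose.gen R else 0

/-- The pointed loop chosen in `loopClass` has the same underlying map and base point, so the
identity is an isotopy. The default value `0` plays no role once a pointed loop exists. -/
theorem PointedLoop.gen_eq_loopClass (R : Type*) [CommRing R] (P : PointedLoop M)
    {γ : UnitAddCircle → M} {b : M} (hγ : P.loop.toFun = γ) (hb : P.base = b) :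
    P.gen R = loopClass R γ b := by
  have h : ∃ P : PointedLoop M, P.loop.toFun = γ ∧ P.base = b := ⟨P, hγ, hb⟩
  rw [loopClass, dif_pos h]
  refine PointedLoop.gen_eq_of_isotopic R ⟨_, _, .refl, .refl, fun x => ?_, ?_⟩
  · exact (congrFun (h.choose_spec.1.trans hγ.symm) x)
  · exact h.choose_spec.2.trans hb.symm

theorem PointedLoop.gen_eq_of_reparam (R : Type*) [CommRing R] {P Q : PointedLoop M}
    {f : UnitAddCircle ≃ₜ UnitAddCircle} (hf : OrientationPreserving f)
    (h : ∀ x, Q.loop x = P.loop (f x)) (hb : Q.base = P.base) : P.gen R = Q.gen R :=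
  PointedLoop.gen_eq_of_isotopic R ⟨_, f, .refl, hf, h, hb⟩

/-! ### Chords of a pointed loop and their relative position -/

namespace PointedLoop

/-- The position of a parameter on the way from the base point. -/
noncomputable def pos (P : PointedLoop M) (x : UnitAddCircle) : ℝ := frac (x - P.baseParam)

theorem pos_nonneg (P : PointedLoop M) (x : UnitAddCircle) : 0 ≤ P.pos x := frac_nonneg _

theorem pos_lt_one (P : PointedLoop M) (x : UnitAddCircle) : P.pos x < 1 := frac_lt_one _

theorem pos_injective (P : PointedLoop M) : Function.Injective P.pos := fun _ _ h =>
  sub_left_injective (frac_injective h)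

theorem frac_sub_of_pos_le {P : PointedLoop M} {x y : UnitAddCircle} (h : P.pos y ≤ P.pos x) :
    frac (x - y) = P.pos x - P.pos y := frac_sub_base_of_le h

theorem frac_sub_of_pos_lt {P : PointedLoop M} {x y : UnitAddCircle} (h : P.pos x < P.pos y) :
    frac (x - y) = P.pos x - P.pos y + 1 := frac_sub_base_of_lt h

/-- The crossings of a pointed loop, numbered from the base point. -/
abbrev Chord (P : PointedLoop M) := {c : NumberedCrossing P.loop // c.IsFromBase}

namespace Chord

variable {P : PointedLoop M}

theorem pos_lt (c : P.Chord) : P.pos c.1.fst < P.pos c.1.snd := c.2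

/-- The chord `d` lies inside the arc cut out by the chord `c`. -/
def Inside (c d : P.Chord) : Prop := P.pos c.1.fst < P.pos d.1.fst ∧ P.pos d.1.snd < P.pos c.1.snd

/-- The arcs cut out by the chords `c` and `d` are disjoint. -/
def Apart (c d : P.Chord) : Prop := P.pos d.1.snd < P.pos c.1.fst ∨ P.pos c.1.snd < P.pos d.1.fst

theorem Apart.symm {c d : P.Chord} (h : Apart c d) : Apart d c := Or.symm h

theorem Apart.not_inside {c d : P.Chord} (h : Apart c d) : ¬ Inside d c := fun h' => by
  have := c.pos_lt
  have := d.pos_lt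
  rcases h with h | h <;> linarith [h'.1, h'.2]

end Chord

end PointedLoop

theorem velocity_restrictArc (γ : UnitAddCircle → M) (P Q : UnitAddCircle) {u : UnitAddCircle}
    (hu : u ≠ 0) :
    velocity (restrictArc γ P Q) u = frac (Q - P) • velocity γ (arcPoint P Q u) := by
  apply velocity_of_eq
  filter_upwards [Ioo_mem_nhds (show -frac u < 0 by linarith [frac_pos hu])
    (show 0 < 1 - frac u by linarith [frac_lt_one u])] with s hs
  exact curve_restrictArc γ P Q u (by linarith [hs.1]) (by linarith [hs.2])

variable [IsManifold (𝓡∂ 2) ∞ M]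

/-- A crossing of the loop cut out by `c`, considered as a crossing of the given loop. -/
noncomputable def NumberedCrossing.ofArc {α : GenericLoop M} (c : NumberedCrossing α)
    (e : NumberedCrossing c.arc) : NumberedCrossing α :=
  ⟨arcPoint c.fst c.snd e.fst, arcPoint c.fst c.snd e.snd, (arcPoint_injective c.ne).ne e.ne, e.eq⟩

theorem NumberedCrossing.ofArc_injective {α : GenericLoop M} (c : NumberedCrossing α) :
    Function.Injective c.ofArc := fun _ _ h =>
  NumberedCrossing.ext (arcPoint_injective c.ne (congrArg NumberedCrossing.fst h))
    (arcPoint_injective c.ne (congrArg NumberedCrossing.snd h))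

theorem NumberedCrossing.exists_ofArc {α : GenericLoop M} (c d : NumberedCrossing α)
    (h1 : frac (d.fst - c.fst) < frac (c.snd - c.fst))
    (h2 : frac (d.snd - c.fst) < frac (c.snd - c.fst)) :
    ∃ e : NumberedCrossing c.arc, c.ofArc e = d := by
  refine ⟨⟨arcParam c.fst c.snd d.fst, arcParam c.fst c.snd d.snd, fun h => d.ne ?_, ?_⟩, ?_⟩
  · rw [← arcPoint_arcParam h1, h, arcPoint_arcParam h2]
  · change α (arcPoint _ _ _) = α (arcPoint _ _ _)
    rw [arcPoint_arcParam h1, arcPoint_arcParam h2, d.eq]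
  · exact NumberedCrossing.ext (arcPoint_arcParam h1) (arcPoint_arcParam h2)

/-- The parameter `0` is the corner created at the cut, and the cut point is no longer a
self-crossing of the arc. -/
theorem NumberedCrossing.fst_ne_zero {α : GenericLoop M} {c : NumberedCrossing α}
    (e : NumberedCrossing c.arc) : e.fst ≠ 0 := fun h =>
  c.point_notMem_crossings_arc ⟨e.fst, e.snd, e.ne, by rw [h]; simp [arc, restrictArc, point],
    by rw [← e.eq, h]; simp [arc, restrictArc, point]⟩

/-- Restriction to the arc multiplies both velocities by the same positive length, away from the
corner. -/
theorem NumberedCrossing.eps_ofArc (R : Type*) [CommRing R] (o : SurfaceOrientation M)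
    {α : GenericLoop M} (c : NumberedCrossing α) (e : NumberedCrossing c.arc) :
    (c.ofArc e).eps R o = e.eps R o := by
  have hl := frac_pos (sub_ne_zero.2 c.ne.symm)
  have h1 : velocity c.arc.toFun e.fst = _ := velocity_restrictArc α.toFun c.fst c.snd (fst_ne_zero (c := c) e)
  have h2 : velocity c.arc.toFun e.snd = _ :=
    velocity_restrictArc α.toFun c.fst c.snd (fst_ne_zero (c := c) e.swap)
  have : (c.ofArc e).IsPositive o ↔ e.IsPositive o := by
    rw [IsPositive, IsPositive, h1, h2, cross_smul, mul_left_comm]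
    exact (mul_pos_iff_of_pos_left (mul_pos hl hl)).symm
  rw [eps, eps]
  by_cases hc : e.IsPositive o
  · rw [if_pos hc, if_pos (this.2 hc)]
  · rw [if_neg hc, if_neg fun h => hc (this.1 h)]

end ArcCrossings

section Chords

variable {M : Type*} [TopologicalSpace M] [ChartedSpace (EuclideanHalfSpace 2) M]

namespace PointedLoop.Chord

variable {P : PointedLoop M}

/-- For a chord `d` inside `c`, the loop obtained from the arc cut out by `c` by removing the arc
cut out by `d`. -/
noncomputable def nestedClass (R : Type*) [CommRing R] (c d : P.Chord) : PointedLoopModule M R :=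
  loopClass R (restrictArc (restrictArc P.loop c.1.fst c.1.snd)
    (arcParam c.1.fst c.1.snd d.1.snd) (arcParam c.1.fst c.1.snd d.1.fst)) (P.loop c.1.fst)

/-- For chords `c`, `d` that are apart, the loop obtained by removing the two arcs that they cut
out. -/
noncomputable def apartClass (R : Type*) [CommRing R] (c d : P.Chord) : PointedLoopModule M R :=
  loopClass R (restrictArc (restrictArc P.loop c.1.snd c.1.fst)
    (arcParam c.1.snd c.1.fst d.1.snd) (arcParam c.1.snd c.1.fst d.1.fst)) P.base

theorem frac_snd_sub_fst (c : P.Chord) :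
    frac (c.1.snd - c.1.fst) = P.pos c.1.snd - P.pos c.1.fst :=
  PointedLoop.frac_sub_of_pos_le c.pos_lt.le

theorem frac_fst_sub_snd (c : P.Chord) :
    frac (c.1.fst - c.1.snd) = P.pos c.1.fst - P.pos c.1.snd + 1 :=
  PointedLoop.frac_sub_of_pos_lt c.pos_lt

theorem pos_arcPoint (c : P.Chord) (u : UnitAddCircle) :
    P.pos (arcPoint c.1.fst c.1.snd u) =
      P.pos c.1.fst + (P.pos c.1.snd - P.pos c.1.fst) * frac u := by
  have h := frac_arcPoint_sub c.1.fst c.1.snd u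
  have hlt := frac_arcPoint_sub_lt c.1.ne u
  rw [c.frac_snd_sub_fst] at h hlt
  have hsplit : arcPoint c.1.fst c.1.snd u - P.baseParam =
      (arcPoint c.1.fst c.1.snd u - c.1.fst) + (c.1.fst - P.baseParam) := by abel
  rw [PointedLoop.pos, hsplit, frac_add_of_lt_one, h, add_comm]
  · rfl
  · change _ + P.pos c.1.fst < 1
    linarith [P.pos_lt_one c.1.snd]

/-- The points of the arc that contains the base point. -/
theorem frac_sub_snd_lt_iff (c : P.Chord) (x : UnitAddCircle) :
    frac (x - c.1.snd) < frac (c.1.fst - c.1.snd) ↔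
      P.pos c.1.snd ≤ P.pos x ∨ P.pos x < P.pos c.1.fst := by
  have h0 := c.pos_lt
  have h1 := P.pos_nonneg c.1.fst
  have h2 := P.pos_lt_one x
  rw [c.frac_fst_sub_snd]
  rcases le_or_gt (P.pos c.1.snd) (P.pos x) with h | h
  · rw [PointedLoop.frac_sub_of_pos_le h]
    exact iff_of_true (by linarith) (Or.inl h)
  · rw [PointedLoop.frac_sub_of_pos_lt h]
    constructor
    · exact fun h' => Or.inr (by linarith)
    · rintro (h' | h') <;> linarith

theorem frac_fst_lt_snd_of_apart {c d : P.Chord} (h : Apart c d) :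
    frac (d.1.fst - c.1.snd) < frac (d.1.snd - c.1.snd) ∧
      frac (d.1.snd - c.1.snd) < frac (c.1.fst - c.1.snd) := by
  have hc := c.pos_lt
  have hd := d.pos_lt
  rw [c.frac_fst_sub_snd]
  rcases h with h | h
  · rw [PointedLoop.frac_sub_of_pos_lt (by linarith), PointedLoop.frac_sub_of_pos_lt (by linarith)]
    constructor <;> linarith
  · rw [PointedLoop.frac_sub_of_pos_le (by linarith), PointedLoop.frac_sub_of_pos_le (by linarith)]
    constructor <;> linarith [P.pos_lt_one d.1.snd, P.pos_nonneg c.1.fst]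

theorem frac_snd_lt_fst_of_inside {c d : P.Chord} (h : Inside d c) :
    frac (d.1.snd - c.1.snd) < frac (d.1.fst - c.1.snd) ∧
      frac (d.1.fst - c.1.snd) < frac (c.1.fst - c.1.snd) := by
  have hc := c.pos_lt
  obtain ⟨h1, h2⟩ := h
  rw [c.frac_fst_sub_snd, PointedLoop.frac_sub_of_pos_le h2.le,
    PointedLoop.frac_sub_of_pos_lt (by linarith)]
  constructor <;> linarith [P.pos_lt_one d.1.snd, P.pos_nonneg d.1.fst]

variable [IsManifold (𝓡∂ 2) ∞ M]

/-! #### Chords of the inner loop -/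

theorem innerLoop_baseParam (c : P.Chord) : c.1.innerLoop.baseParam = 0 :=
  (PointedLoop.eq_baseParam (P := c.1.innerLoop) (x := 0) (by
    change P.loop (arcPoint _ _ 0) = P.loop c.1.fst
    rw [arcPoint_zero])).symm

theorem isFromBase_ofArc_iff (c : P.Chord) (e : NumberedCrossing c.1.innerLoop.loop) :
    (c.1.ofArc e).IsFromBase ↔ e.IsFromBase := by
  change P.pos (arcPoint _ _ _) < P.pos (arcPoint _ _ _) ↔
    frac (e.fst - c.1.innerLoop.baseParam) < frac (e.snd - c.1.innerLoop.baseParam)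
  rw [c.innerLoop_baseParam, sub_zero, sub_zero, c.pos_arcPoint, c.pos_arcPoint,
    add_lt_add_iff_left, mul_lt_mul_iff_right₀ (sub_pos.2 c.pos_lt)]

/-- A chord of the inner loop, considered as a chord of the given loop. -/
noncomputable def ofInner (c : P.Chord) (e : c.1.innerLoop.Chord) : P.Chord :=
  ⟨c.1.ofArc e.1, (c.isFromBase_ofArc_iff e.1).2 e.2⟩

theorem ofInner_injective (c : P.Chord) : Function.Injective c.ofInner := fun _ _ h =>
  Subtype.ext (c.1.ofArc_injective (congrArg Subtype.val h))

/-- Both endpoints of `d` must lie on the arc of `c`. The inequalities are strict because a crossing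
of the arc avoids its corner and the parameter `frac` is less than `1`. -/
theorem exists_ofInner_iff (c d : P.Chord) : (∃ e, c.ofInner e = d) ↔ Inside c d := by
  have hc := c.pos_lt
  have hd := d.pos_lt
  constructor
  · rintro ⟨e, rfl⟩
    have h1 : P.pos (c.ofInner e).1.fst = _ := c.pos_arcPoint e.1.fst
    have h2 : P.pos (c.ofInner e).1.snd = _ := c.pos_arcPoint e.1.snd
    have h0 : 0 < frac e.1.fst := frac_pos (NumberedCrossing.fst_ne_zero (c := c.1) e.1)
    have h3 := frac_lt_one e.1.snd
    have hl : 0 < P.pos c.1.snd - P.pos c.1.fst := by linarith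
    refine ⟨?_, ?_⟩
    · rw [h1]; linarith [mul_pos hl h0]
    · rw [h2]; linarith [mul_lt_mul_of_pos_left h3 hl]
  · rintro ⟨h1, h2⟩
    obtain ⟨e, he⟩ := c.1.exists_ofArc d.1
      (by rw [c.frac_snd_sub_fst, PointedLoop.frac_sub_of_pos_le h1.le]; linarith)
      (by rw [c.frac_snd_sub_fst, PointedLoop.frac_sub_of_pos_le (h1.trans hd).le]; linarith)
    exact ⟨⟨e, (c.isFromBase_ofArc_iff e).1 (he ▸ d.2)⟩, Subtype.ext he⟩

theorem gen_innerLoop_ofInner (R : Type*) [CommRing R] (c : P.Chord) (e : c.1.innerLoop.Chord) :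
    e.1.innerLoop.gen R = (c.ofInner e).1.innerLoop.gen R := by
  have hlt : frac e.1.fst < frac e.1.snd := by
    have : frac (e.1.fst - _) < frac (e.1.snd - _) := e.2
    simpa [c.innerLoop_baseParam] using this
  refine PointedLoop.gen_eq_of_reparam R .refl (fun x => ?_) rfl
  change P.loop (arcPoint (arcPoint _ _ _) (arcPoint _ _ _) x) =
    P.loop (arcPoint _ _ (arcPoint _ _ x))
  rw [arcPoint_arcPoint hlt]

theorem gen_outerLoop_ofInner (R : Type*) [CommRing R] (c : P.Chord) (e : c.1.innerLoop.Chord) :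
    (e.1.outerLoop e.2).gen R = nestedClass R c (c.ofInner e) := by
  refine PointedLoop.gen_eq_loopClass R _ ?_ rfl
  change restrictArc (restrictArc P.loop _ _) e.1.snd e.1.fst =
    restrictArc (restrictArc P.loop _ _) (arcParam _ _ (arcPoint _ _ _))
      (arcParam _ _ (arcPoint _ _ _))
  rw [arcParam_arcPoint c.1.ne, arcParam_arcPoint c.1.ne]

-- Chords of the inner loop are the chords inside `c`, with unchanged sign and inner loop; their
-- outer loops are the nested remainders.
open Classical in
theorem cobracketSum_innerLoop [Fintype P.Chord] (R : Type*) [CommRing R]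
    (o : SurfaceOrientation M) (c : P.Chord) :
    c.1.innerLoop.cobracketSum R o = ∑ d : P.Chord, if Inside c d then
      d.1.eps R o • (d.1.innerLoop.gen R ⊗ₜ[R] nestedClass R c d -
        nestedClass R c d ⊗ₜ[R] d.1.innerLoop.gen R) else 0 := by
  refine finsum_eq_sum_ite c.ofInner c.ofInner_injective _ c.exists_ofInner_iff _
    (fun d => d.1.eps R o • (d.1.innerLoop.gen R ⊗ₜ[R] nestedClass R c d -
        nestedClass R c d ⊗ₜ[R] d.1.innerLoop.gen R)) fun e => ?_
  rw [c.gen_innerLoop_ofInner R e, c.gen_outerLoop_ofInner R e]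
  congr 1
  exact (c.1.eps_ofArc R o e.1).symm

/-! #### Chords of the outer loop -/

/-- The pointed loop that remains after removing the arc cut out by a chord. -/
noncomputable abbrev outer (c : P.Chord) : PointedLoop M := c.1.outerLoop c.2

theorem arcPoint_outer_baseParam (c : P.Chord) :
    arcPoint c.1.snd c.1.fst c.outer.baseParam = P.baseParam :=
  PointedLoop.eq_baseParam c.outer.loop_baseParam

/-- The outer arc passes through the base point of `P`, so the order from the base point is a matter
of cyclic order, which `arcPoint` preserves. -/
theorem isFromBase_ofArc_swap_iff (c : P.Chord) (e : NumberedCrossing c.outer.loop) :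
    NumberedCrossing.IsFromBase (P := P) (c.1.swap.ofArc e) ↔ e.IsFromBase := by
  have h := cyclicMono_arcPoint c.1.ne.symm c.outer.baseParam e.fst e.snd
  rw [c.arcPoint_outer_baseParam] at h
  exact h

/-- A chord of the outer loop, considered as a chord of the given loop. -/
noncomputable def ofOuter (c : P.Chord) (e : c.outer.Chord) : P.Chord :=
  ⟨c.1.swap.ofArc e.1, (c.isFromBase_ofArc_swap_iff e.1).2 e.2⟩

theorem ofOuter_injective (c : P.Chord) : Function.Injective c.ofOuter := fun _ _ h =>
  Subtype.ext (c.1.swap.ofArc_injective (congrArg Subtype.val h))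

/-- A chord survives when neither endpoint lies on the removed arc: each is before `c.fst` or after
`c.snd`. Its endpoints being ordered, it either encloses `c` or is apart from it; interlaced chords
are lost. -/
theorem exists_ofOuter_iff (c d : P.Chord) :
    (∃ e, c.ofOuter e = d) ↔ Inside d c ∨ Apart c d := by
  have hc := c.pos_lt
  have hd := d.pos_lt
  constructor
  · rintro ⟨e, rfl⟩
    have key : ∀ u : UnitAddCircle, u ≠ 0 → P.pos c.1.snd < P.pos (arcPoint c.1.snd c.1.fst u) ∨
        P.pos (arcPoint c.1.snd c.1.fst u) < P.pos c.1.fst := fun u hu => by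
      refine ((c.frac_sub_snd_lt_iff _).1 (frac_arcPoint_sub_lt c.1.ne.symm u)).imp_left
        fun h => lt_of_le_of_ne h fun h' => hu ?_
      apply arcPoint_injective c.1.ne.symm
      rw [arcPoint_zero, ← P.pos_injective h']
    have h1 := key e.1.fst (NumberedCrossing.fst_ne_zero (c := c.1.swap) e.1)
    have h2 := key e.1.snd (NumberedCrossing.fst_ne_zero (c := c.1.swap) e.1.swap)
    change (P.pos (arcPoint c.1.snd c.1.fst e.1.fst) < P.pos c.1.fst ∧
      P.pos c.1.snd < P.pos (arcPoint c.1.snd c.1.fst e.1.snd)) ∨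
      (P.pos (arcPoint c.1.snd c.1.fst e.1.snd) < P.pos c.1.fst ∨
      P.pos c.1.snd < P.pos (arcPoint c.1.snd c.1.fst e.1.fst))
    tauto
  · intro h
    obtain ⟨e, he⟩ := c.1.swap.exists_ofArc d.1
      ((c.frac_sub_snd_lt_iff _).2 (by
        rcases h with h | h | h
        · exact Or.inr h.1
        · exact Or.inr (hd.trans h)
        · exact Or.inl h.le))
      ((c.frac_sub_snd_lt_iff _).2 (by
        rcases h with h | h | h
        · exact Or.inl h.2.le
        · exact Or.inr h
        · exact Or.inl (h.trans hd).le))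
    refine ⟨⟨e, (c.isFromBase_ofArc_swap_iff e).1 ?_⟩, Subtype.ext he⟩
    have := d.2
    rw [← he] at this
    exact this

theorem arcParam_ofOuter_fst (c : P.Chord) (e : c.outer.Chord) :
    arcParam c.1.snd c.1.fst (c.ofOuter e).1.fst = e.1.fst :=
  arcParam_arcPoint c.1.ne.symm _

theorem arcParam_ofOuter_snd (c : P.Chord) (e : c.outer.Chord) :
    arcParam c.1.snd c.1.fst (c.ofOuter e).1.snd = e.1.snd :=
  arcParam_arcPoint c.1.ne.symm _

/-- The arc of a chord apart from `c` does not pass the corner of the outer loop, so it is literally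
the same parametrized arc. -/
theorem gen_innerLoop_ofOuter_of_apart (R : Type*) [CommRing R] (c : P.Chord) (e : c.outer.Chord)
    (h : Apart c (c.ofOuter e)) : e.1.innerLoop.gen R = (c.ofOuter e).1.innerLoop.gen R := by
  refine PointedLoop.gen_eq_of_reparam R .refl (fun x => ?_) rfl
  have h' := frac_fst_lt_snd_of_apart h
  have := congrFun (restrictArc_restrictArc_of_lt P.loop h'.1 h'.2) x
  rw [arcParam_ofOuter_fst, arcParam_ofOuter_snd] at this
  exact this.symm

/-- Removing the arc of a chord that encloses `c` also removes what was left around `c`, so the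
previous removal of `c` is invisible. -/
theorem gen_outerLoop_ofOuter_of_inside (R : Type*) [CommRing R] (c : P.Chord) (e : c.outer.Chord)
    (h : Inside (c.ofOuter e) c) : (e.1.outerLoop e.2).gen R = (c.ofOuter e).outer.gen R := by
  refine PointedLoop.gen_eq_of_reparam R .refl (fun x => ?_) rfl
  have h' := frac_snd_lt_fst_of_inside h
  have := congrFun (restrictArc_restrictArc_of_lt P.loop h'.1 h'.2) x
  rw [arcParam_ofOuter_fst, arcParam_ofOuter_snd] at this
  exact this.symm

theorem gen_outerLoop_ofOuter (R : Type*) [CommRing R] (c : P.Chord) (e : c.outer.Chord) :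
    (e.1.outerLoop e.2).gen R = apartClass R c (c.ofOuter e) := by
  refine PointedLoop.gen_eq_loopClass R _ ?_ rfl
  rw [arcParam_ofOuter_fst, arcParam_ofOuter_snd]
  rfl

/-- Let `d` enclose `c`. Cutting `c` first and then taking the inner loop of `d` runs from `d.fst`
to `c.fst` and from `c.snd` to `d.snd`. Taking the inner loop of `d` first and then removing `c`
gives the same two pieces in the other order. Both are pointed at the crossing of `d`. -/
theorem gen_innerLoop_ofOuter_of_inside (R : Type*) [CommRing R] (c : P.Chord) (e : c.outer.Chord)
    (h : Inside (c.ofOuter e) c) : e.1.innerLoop.gen R = nestedClass R (c.ofOuter e) c := by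
  have h' := frac_snd_lt_fst_of_inside h
  obtain ⟨e', he'⟩ := ((c.ofOuter e).exists_ofInner_iff c).2 h
  have h1 := gen_outerLoop_ofInner R (c.ofOuter e) e'
  rw [he'] at h1
  rw [← h1]
  -- The condition `V ≠ P` says that the chords do not share their second endpoint, which holds
  -- because `c` is strictly inside.
  obtain ⟨r, hr⟩ := exists_rotation_wrap (fun hV => by
    have := h.2
    rw [hV] at this
    exact lt_irrefl _ this) h'.1 h'.2
  refine PointedLoop.gen_eq_of_reparam R (orientationPreserving_addRight r) (fun x => ?_) rfl
  have hfst : arcParam (c.ofOuter e).1.fst (c.ofOuter e).1.snd c.1.fst = e'.1.fst := by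
    rw [← congrArg (fun d : P.Chord => d.1.fst) he']
    exact arcParam_arcPoint (c.ofOuter e).1.ne _
  have hsnd : arcParam (c.ofOuter e).1.fst (c.ofOuter e).1.snd c.1.snd = e'.1.snd := by
    rw [← congrArg (fun d : P.Chord => d.1.snd) he']
    exact arcParam_arcPoint (c.ofOuter e).1.ne _
  have := congrArg P.loop.toFun (hr x)
  rw [hfst, hsnd, arcParam_ofOuter_fst, arcParam_ofOuter_snd] at this
  exact this

/-- Removing two disjoint arcs in either order leaves the same two pieces, differing only in the
starting corner, that is, by a rotation. -/
theorem apartClass_comm (R : Type*) [CommRing R] {c d : P.Chord} (h : Apart c d) :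
    apartClass R c d = apartClass R d c := by
  obtain ⟨e, rfl⟩ := (c.exists_ofOuter_iff d).2 (Or.inr h)
  obtain ⟨e', he'⟩ := ((c.ofOuter e).exists_ofOuter_iff c).2 (Or.inr h.symm)
  have h1 := gen_outerLoop_ofOuter R c e
  have h2 := gen_outerLoop_ofOuter R (c.ofOuter e) e'
  rw [he'] at h2
  rw [← h1, ← h2]
  have h' := frac_fst_lt_snd_of_apart h
  obtain ⟨r, hr⟩ := exists_rotation_wrap (fun hV => by
    have h3 := c.pos_lt
    have h4 := (c.ofOuter e).pos_lt
    rcases h with h | h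
    · rw [hV] at h4; linarith
    · rw [hV] at h; linarith) h'.1 h'.2
  refine PointedLoop.gen_eq_of_reparam R (orientationPreserving_addRight r) (fun x => ?_) rfl
  have hfst : arcParam (c.ofOuter e).1.snd (c.ofOuter e).1.fst c.1.fst = e'.1.fst := by
    rw [← congrArg (fun d : P.Chord => d.1.fst) he']
    exact arcParam_ofOuter_fst _ _
  have hsnd : arcParam (c.ofOuter e).1.snd (c.ofOuter e).1.fst c.1.snd = e'.1.snd := by
    rw [← congrArg (fun d : P.Chord => d.1.snd) he']
    exact arcParam_ofOuter_snd _ _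
  have := congrArg P.loop.toFun (hr x)
  rw [hfst, hsnd, arcParam_ofOuter_fst, arcParam_ofOuter_snd] at this
  exact this

-- The surviving chords split into those that enclose `c`, whose outer loops are unchanged, and
-- those apart from `c`, whose inner loops are unchanged. `Apart.not_inside` makes the cases
-- exclusive, so every chord contributes to at most one sum.
open Classical in
theorem cobracketSum_outer [Fintype P.Chord] (R : Type*) [CommRing R]
    (o : SurfaceOrientation M) (c : P.Chord) :
    c.outer.cobracketSum R o = (∑ d : P.Chord, if Inside d c then
      d.1.eps R o • (nestedClass R d c ⊗ₜ[R] d.outer.gen R -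
        d.outer.gen R ⊗ₜ[R] nestedClass R d c) else 0) +
      ∑ d : P.Chord, if Apart c d then
        d.1.eps R o • (d.1.innerLoop.gen R ⊗ₜ[R] apartClass R c d -
          apartClass R c d ⊗ₜ[R] d.1.innerLoop.gen R) else 0 := by
  rw [← Finset.sum_add_distrib]
  refine (finsum_eq_sum_ite c.ofOuter c.ofOuter_injective _ c.exists_ofOuter_iff _
    (fun d => (if Inside d c then
      d.1.eps R o • (nestedClass R d c ⊗ₜ[R] d.outer.gen R -
        d.outer.gen R ⊗ₜ[R] nestedClass R d c) else 0) + if Apart c d then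
        d.1.eps R o • (d.1.innerLoop.gen R ⊗ₜ[R] apartClass R c d -
          apartClass R c d ⊗ₜ[R] d.1.innerLoop.gen R) else 0) fun e => ?_).trans ?_
  · have heps : e.1.eps R o = (c.ofOuter e).1.eps R o := (c.1.swap.eps_ofArc R o e.1).symm
    rcases (c.exists_ofOuter_iff _).1 ⟨e, rfl⟩ with h | h
    · rw [if_pos h, if_neg fun h' => h'.not_inside h, add_zero,
        c.gen_innerLoop_ofOuter_of_inside R e h, c.gen_outerLoop_ofOuter_of_inside R e h, heps]
    · rw [if_neg h.not_inside, if_pos h, zero_add,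
        c.gen_innerLoop_ofOuter_of_apart R e h, c.gen_outerLoop_ofOuter R e, heps]
  · refine Finset.sum_congr rfl fun d _ => ?_
    by_cases h : Inside d c ∨ Apart c d
    · rw [if_pos h]
    · rw [if_neg h, if_neg fun h' => h (Or.inl h'), if_neg fun h' => h (Or.inr h'), add_zero]

end PointedLoop.Chord

end Chords

/-! ### The cobrackets -/

section Cobracket

theorem comm_apply_eq_neg_of_add_eq_zero {R A : Type*} [CommRing R] [AddCommGroup A] [Module R A]
    (ν : A →ₗ[R] A ⊗[R] A) (x : A) (h : TensorProduct.comm R A A (ν x) + ν x = 0) :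
    ((TensorProduct.comm R A A).toLinearMap ∘ₗ ν) x = (-ν) x :=
  eq_neg_of_add_eq_zero_left h

/-- The tensor powers of `φ` commute with the flip, with the cyclic permutation and with the
cobrackets, so both identities hold on the image of `φ`, which is everything. -/
theorem IsLieCobracket.of_surjective {R A B : Type*} [CommRing R] [AddCommGroup A] [Module R A]
    [AddCommGroup B] [Module R B] {ν : A →ₗ[R] A ⊗[R] A} {μ : B →ₗ[R] B ⊗[R] B} (φ : A →ₗ[R] B)
    (hφ : Function.Surjective φ) (h : μ ∘ₗ φ = TensorProduct.map φ φ ∘ₗ ν)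
    (hν : IsLieCobracket ν) : IsLieCobracket μ := by
  have h' : ∀ x, μ (φ x) = TensorProduct.map φ φ (ν x) := fun x => LinearMap.congr_fun h x
  constructor
  · ext1 y
    obtain ⟨x, rfl⟩ := hφ y
    have hx := LinearMap.congr_fun hν.antisymm x
    simp only [LinearMap.comp_apply, LinearMap.neg_apply, LinearEquiv.coe_coe] at hx ⊢
    rw [h', ← map_neg, ← hx]
    have : ∀ t : A ⊗[R] A, TensorProduct.comm R B B (TensorProduct.map φ φ t) =
        TensorProduct.map φ φ (TensorProduct.comm R A A t) := fun t => by
      induction t with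
      | zero => simp
      | tmul a b => simp
      | add s t hs ht => simp [hs, ht]
    exact this _
  · change cycSum R B ∘ₗ μ.lTensor B ∘ₗ μ = 0
    have hJ : cycSum R A ∘ₗ ν.lTensor A ∘ₗ ν = 0 := hν.coJacobi
    ext1 y
    obtain ⟨x, rfl⟩ := hφ y
    have hx := LinearMap.congr_fun hJ x
    simp only [LinearMap.comp_apply, LinearMap.zero_apply] at hx ⊢
    have h1 : ∀ t : A ⊗[R] A, μ.lTensor B (TensorProduct.map φ φ t) =
        TensorProduct.map φ (TensorProduct.map φ φ) (ν.lTensor A t) := fun t => by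
      induction t with
      | zero => simp
      | tmul a b => simp [h']
      | add s t hs ht => simp [hs, ht]
    have hc : ∀ t : A ⊗[R] (A ⊗[R] A), cyc R B (TensorProduct.map φ (TensorProduct.map φ φ) t) =
        TensorProduct.map φ (TensorProduct.map φ φ) (cyc R A t) := fun t => by
      have : cyc R B ∘ₗ TensorProduct.map φ (TensorProduct.map φ φ) =
          TensorProduct.map φ (TensorProduct.map φ φ) ∘ₗ cyc R A := by
        ext a b c
        simp [cyc_tmul]
      exact LinearMap.congr_fun this t
    have h2 : ∀ t : A ⊗[R] (A ⊗[R] A),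
        cycSum R B (TensorProduct.map φ (TensorProduct.map φ φ) t) =
          TensorProduct.map φ (TensorProduct.map φ φ) (cycSum R A t) := fun t => by
      simp only [cycSum, LinearMap.add_apply, LinearMap.id_apply, LinearMap.comp_apply, hc, map_add]
    rw [h', h1, h2, hx, map_zero]

variable {M : Type*} [TopologicalSpace M] [ChartedSpace (EuclideanHalfSpace 2) M]

theorem PointedLoopModule.hom_ext {R A : Type*} [CommRing R] [AddCommMonoid A] [Module R A]
    {f g : PointedLoopModule M R →ₗ[R] A} (h : ∀ P : PointedLoop M, f (P.gen R) = g (P.gen R)) :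
    f = g := by
  refine Finsupp.lhom_ext' fun q => LinearMap.ext_ring ?_
  induction q using Quotient.inductionOn with
  | h P => exact h P

variable [IsManifold (𝓡∂ 2) ∞ M]

/-- Every loop can be given a base point off its self-crossings, so each generator is hit. -/
theorem forgetBase_surjective [T2Space M] (R : Type*) [CommRing R] :
    Function.Surjective (forgetBase M R) := by
  refine Finsupp.mapDomain_surjective fun q => ?_
  induction q using Quotient.inductionOn with
  | h α =>
    obtain ⟨P, rfl⟩ := α.exists_pointedLoop
    exact ⟨⟦P⟧, rfl⟩

/-- The cobracket on the module of pointed loops. -/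
noncomputable def pointedCobracket (R : Type*) [CommRing R] (o : SurfaceOrientation M) :
    PointedLoopModule M R →ₗ[R] PointedLoopModule M R ⊗[R] PointedLoopModule M R :=
  Finsupp.linearCombination R (Quotient.lift (fun P : PointedLoop M => P.cobracketSum R o)
    fun _ _ h => PointedLoop.cobracketSum_eq_of_isotopic R o h)

/-- The cobracket on the module of loops. -/
noncomputable def loopCobracket (R : Type*) [CommRing R] (o : SurfaceOrientation M) :
    LoopModule M R →ₗ[R] LoopModule M R ⊗[R] LoopModule M R :=
  Finsupp.linearCombination R (Quotient.lift (fun α : GenericLoop M => α.cobracketSum R o)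
    fun _ _ h => GenericLoop.cobracketSum_eq_of_isotopic R o h)

theorem pointedCobracket_gen (R : Type*) [CommRing R] (o : SurfaceOrientation M)
    (P : PointedLoop M) : pointedCobracket R o (P.gen R) = P.cobracketSum R o := by
  rw [pointedCobracket, PointedLoop.gen, Finsupp.linearCombination_single, one_smul,
    Quotient.lift_mk]

theorem loopCobracket_gen (R : Type*) [CommRing R] (o : SurfaceOrientation M)
    (α : GenericLoop M) : loopCobracket R o (α.gen R) = α.cobracketSum R o := by
  rw [loopCobracket, GenericLoop.gen, Finsupp.linearCombination_single, one_smul,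
    Quotient.lift_mk]

theorem loopCobracket_comp_forgetBase [T2Space M] (R : Type*) [CommRing R]
    (o : SurfaceOrientation M) : loopCobracket R o ∘ₗ forgetBase M R =
      TensorProduct.map (forgetBase M R) (forgetBase M R) ∘ₗ pointedCobracket R o := by
  refine PointedLoopModule.hom_ext fun P => ?_
  rw [LinearMap.comp_apply, LinearMap.comp_apply, forgetBase_gen, loopCobracket_gen,
    pointedCobracket_gen, map_forgetBase_cobracketSum]

/-- Antisymmetry holds term by term. For co-Jacobi, the crossings of inner and outer loops are
expressed through chords of `P`, and the cancellation for chord systems applies. -/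
theorem isLieCobracket_pointedCobracket [T2Space M] (R : Type*) [CommRing R]
    (o : SurfaceOrientation M) : IsLieCobracket (pointedCobracket (M := M) R o) := by
  classical
  constructor
  · refine PointedLoopModule.hom_ext fun P => ?_
    have := finite_numberedCrossing P.loop
    refine comm_apply_eq_neg_of_add_eq_zero _ _ ?_
    rw [pointedCobracket_gen, PointedLoop.cobracketSum, ← LinearEquiv.coe_coe,
      map_finsum _ (toFinite _), ← finsum_add_distrib (toFinite _) (toFinite _)]
    refine (finsum_congr fun c => ?_).trans finsum_zero
    rw [LinearEquiv.coe_coe, map_smul, map_sub, TensorProduct.comm_tmul, TensorProduct.comm_tmul,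
      ← smul_add]
    simp
  · refine PointedLoopModule.hom_ext fun P => ?_
    have := finite_numberedCrossing P.loop
    have := Fintype.ofFinite P.Chord
    change cycSum R _ ((pointedCobracket R o).lTensor _ (pointedCobracket R o (P.gen R))) = 0
    rw [pointedCobracket_gen, PointedLoop.cobracketSum, finsum_eq_sum_of_fintype]
    refine cycSum_lTensor_sum_eq_zero (pointedCobracket R o) (fun c : P.Chord => c.1.eps R o)
      (fun c => c.1.innerLoop.gen R) (fun c => c.outer.gen R)
      (PointedLoop.Chord.nestedClass R) (PointedLoop.Chord.apartClass R)
      PointedLoop.Chord.Inside PointedLoop.Chord.Apart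
      (fun c d => ⟨fun h => h.symm, fun h => h.symm⟩)
      (fun c d h => PointedLoop.Chord.apartClass_comm R h) (fun c => ?_) (fun c => ?_)
    · rw [pointedCobracket_gen, PointedLoop.Chord.cobracketSum_innerLoop]
    · rw [pointedCobracket_gen, PointedLoop.Chord.cobracketSum_outer]

end Cobracket

end SurfaceLoop

/-! ### The main theorem -/

open SurfaceLoop in
theorem mainTheorem7 (R : Type*) [CommRing R] (M : Type*) [TopologicalSpace M] [T2Space M]
    [ChartedSpace (EuclideanHalfSpace 2) M] [IsManifold (𝓡∂ 2) ∞ M] (o : SurfaceOrientation M) :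
    (∀ α : GenericLoop M, α.crossings.Finite) ∧
    ∃ ν : PointedLoopModule M R →ₗ[R] PointedLoopModule M R ⊗[R] PointedLoopModule M R,
      (∀ α : PointedLoop M, ν (α.gen R) = α.cobracketSum R o) ∧
      IsLieCobracket ν ∧
      ∃ ν₀ : LoopModule M R →ₗ[R] LoopModule M R ⊗[R] LoopModule M R,
        IsLieCobracket ν₀ ∧
        ν₀ ∘ₗ forgetBase M R = TensorProduct.map (forgetBase M R) (forgetBase M R) ∘ₗ ν ∧
        (∀ μ : LoopModule M R →ₗ[R] LoopModule M R ⊗[R] LoopModule M R,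
          μ ∘ₗ forgetBase M R = TensorProduct.map (forgetBase M R) (forgetBase M R) ∘ₗ ν →
            μ = ν₀) ∧
        ∀ α : GenericLoop M, ν₀ (α.gen R) = α.cobracketSum R o := by
  have hν := isLieCobracket_pointedCobracket (M := M) R o
  have hcomp := loopCobracket_comp_forgetBase (M := M) R o
  have hsurj := forgetBase_surjective (M := M) R
  refine ⟨fun α => α.finite_crossings, pointedCobracket R o, pointedCobracket_gen R o, hν,
    loopCobracket R o, hν.of_surjective (forgetBase M R) hsurj hcomp, hcomp, fun μ hμ => ?_,
    loopCobracket_gen R o⟩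
  -- Uniqueness: two maps with the same composite with the surjection `forgetBase` agree.
  refine LinearMap.ext fun y => ?_
  obtain ⟨x, rfl⟩ := hsurj y
  exact LinearMap.congr_fun (hμ.trans hcomp.symm) x
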